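/- Let $M$ be a compact, connected, Hausdorff, second-countable smooth manifold (without boundary) of dimension $q$, and let $\phi\in\mathrm{Diff}^2(M)$ have only finitely many periodic points. Let $\ell$ be the lowest common multiple of their (minimal) periods (with $\ell=1$ if there are none), and let $N\in\mathbb N$ satisfy $N>\max\{2q,\ell\}$. Let $A$ be a real $N\times N$ matrix with spectral radius $\rho(A)<1$, let $\mathbf C\in\mathbb R^N$, and consider the linear state map $F(\mathbf x,z)=A\mathbf x+\mathbf C z$. For an observation map $\omega\in C^2(M,\mathbb R)$ let $$f_{(\phi,\omega,F)}(m)=\sum_{j=0}^{\infty}A^j\mathbf C\,\omega(\phi^{-j}(m)),\qquad m\in M,$$ be the associated generalized synchronization. Assume that $f_{(\phi,\omega,F)}\in C^2(M,\mathbb R^N)$ for every $\omega\in C^2(M,\mathbb R)$ and that the map $C^2(M,\mathbb R)\to C^2(M,\mathbb R^N)$, $\omega\mapsto f_{(\phi,\omega,F)}$, is continuous for the $C^2$ topologies. Suppose moreover that: (i) For each periodic point $m$ of $\phi$, with period $n$, the tangent map $T_m\phi^{-n}:T_mM\to T_mM$ has $q$ distinct (real or complex) eigenvalues $\lambda_1,\dots,\lambda_q$.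 If $\lambda_{\max}$ is an eigenvalue of highest absolute value among the eigenvalues of all these linear maps and $n_{\min}$ is the smallest period, then $\rho(\lambda_{\max}A^{n_{\min}})<1$ (this condition is void if there are no such eigenvalues). For each periodic point $m$ of period $n$ the vectors $$(\mathbb I-\lambda_jA^n)^{-1}(\mathbb I-A)^{-1}(\mathbb I-A^n)\mathbf C\in\mathbb C^N,\qquad j=1,\dots,q,$$ with $\lambda_1,\dots,\lambda_q$ the eigenvalues of $T_m\phi^{-n}$, are linearly independent over $\mathbb C$. (ii) The vectors $\mathbf C,A\mathbf C,\dots,A^{N-1}\mathbf C$ are linearly independent. Then for generic $\omega\in C^2(M,\mathbb R)$ the generalized synchronization $f_{(\phi,\omega,F)}\in C^2(M,\mathbb R^N)$ is an embedding; that is, the set of $\omega\in C^2(M,\mathbb R)$ for which $f_{(\phi,\omega,F)}$ is an injective immersion and a homeomorphism onto its image is open and dense in $C^2(M,\mathbb R)$ with respect to the $C^2$ topology. -/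

import Mathlib

open scoped Manifold Matrix

noncomputable section

namespace LinearGS

/-- The space `C²(M, F)` of twice continuously differentiable maps from a `q`-dimensional
manifold `M` (without boundary) to a normed space `F`. -/
abbrev C2Map (q : ℕ) (M : Type*) [TopologicalSpace M]
    [ChartedSpace (EuclideanSpace ℝ (Fin q)) M]
    (F : Type*) [NormedAddCommGroup F] [NormedSpace ℝ F] : Type _ :=
  ContMDiffMap (𝓡 q) 𝓘(ℝ, F) M F 2

/-- The `C²` topology on `C²(M, F)`: uniform convergence of the local representatives `f ∘ e⁻¹`
and of their derivatives up to order two on compact subsets of chart domains. For compact `M` it is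
the topology of the usual `C²` Banach norm `‖f‖_∞ + ‖Df‖_∞ + ‖D²f‖_∞`. -/
instance C2Map.instTopologicalSpace (q : ℕ) (M : Type*) [TopologicalSpace M]
    [ChartedSpace (EuclideanSpace ℝ (Fin q)) M]
    (F : Type*) [NormedAddCommGroup F] [NormedSpace ℝ F] :
    TopologicalSpace (C2Map q M F) :=
  ⨅ (e ∈ atlas (EuclideanSpace ℝ (Fin q)) M) (k : Fin 3),
    TopologicalSpace.induced
      (fun f : C2Map q M F =>
        UniformOnFun.ofFun {K : Set (EuclideanSpace ℝ (Fin q)) | IsCompact K ∧ K ⊆ e.target}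
          (iteratedFDeriv ℝ (k : ℕ) (fun u => f (e.symm u))))
      inferInstance

/-- A property of the elements of a topological space is generic if it holds exactly on an open
and dense subset. -/
def IsGeneric {X : Type*} [TopologicalSpace X] (P : X → Prop) : Prop :=
  IsOpen {x | P x} ∧ Dense {x | P x}

/-- `f : M → F` is a `C²` embedding: it is of class `C²`, an immersion (every tangent map is
injective) and a homeomorphism onto its image. -/
structure IsC2Embedding (q : ℕ) {M : Type*} [TopologicalSpace M]
    [ChartedSpace (EuclideanSpace ℝ (Fin q)) M]
    {F : Type*} [NormedAddCommGroup F] [NormedSpace ℝ F] (f : M → F) : Prop where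
  contMDiff : ContMDiff (𝓡 q) 𝓘(ℝ, F) 2 f
  immersion : ∀ m : M, Function.Injective (mfderiv (𝓡 q) 𝓘(ℝ, F) f m)
  isEmbedding : Topology.IsEmbedding f

section Dynamics

variable {q : ℕ} {M : Type*} [TopologicalSpace M] [ChartedSpace (EuclideanSpace ℝ (Fin q)) M]

/-- The generalized synchronization `f_{(φ, ω, F)}(m) = ∑_{j ≥ 0} A ^ j C ω(φ⁻ʲ(m))` of the linear
state map `F(x, z) = A x + C z` driven by the observations `ω` of the dynamical system `φ`. -/
def generalizedSync {N : ℕ} (A : Matrix (Fin N) (Fin N) ℝ) (C : Fin N → ℝ)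
    (φ : Diffeomorph (𝓡 q) (𝓡 q) M M 2) (ω : M → ℝ) (m : M) : EuclideanSpace ℝ (Fin N) :=
  WithLp.toLp 2 (∑' j : ℕ, ω (φ.symm^[j] m) • (A ^ j *ᵥ C))

/-- For a periodic point `m` of `φ`, of period `n`, the tangent map `T_m φ⁻ⁿ : T_m M → T_m M`.
Since `φ⁻ⁿ(m) = m`, its source and its target are the same tangent space, which Mathlib realizes as
the model space of `M` through the preferred chart at `m`. -/
def periodTangentMap (φ : Diffeomorph (𝓡 q) (𝓡 q) M M 2) (m : M) :
    EuclideanSpace ℝ (Fin q) →L[ℝ] EuclideanSpace ℝ (Fin q) :=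
  mfderiv (𝓡 q) (𝓡 q) (φ.symm^[Function.minimalPeriod φ m]) m

/-- The real and complex eigenvalues of `T_m φ⁻ⁿ` at a periodic point `m` of period `n`, that is,
the eigenvalues of its complexification. -/
def periodEigenvalues (φ : Diffeomorph (𝓡 q) (𝓡 q) M M 2) (m : M) : Set ℂ :=
  {z | Module.End.HasEigenvalue
    ((periodTangentMap φ m : EuclideanSpace ℝ (Fin q) →ₗ[ℝ] EuclideanSpace ℝ (Fin q)).baseChange ℂ)
    z}

/-- `lam` is an eigenvalue of highest absolute value among the eigenvalues of all the tangent maps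
`T_m φ⁻ⁿ`, for `m` a periodic point of `φ` and `n` its period. -/
def IsMaxPeriodEigenvalue (φ : Diffeomorph (𝓡 q) (𝓡 q) M M 2) (lam : ℂ) : Prop :=
  (∃ m ∈ Function.periodicPts φ, lam ∈ periodEigenvalues φ m) ∧
    ∀ m ∈ Function.periodicPts φ, ∀ mu ∈ periodEigenvalues φ m, ‖mu‖ ≤ ‖lam‖

/-- `n` is the smallest period of the periodic points of `φ`. -/
def IsMinPeriod (φ : Diffeomorph (𝓡 q) (𝓡 q) M M 2) (n : ℕ) : Prop :=
  IsLeast (Function.minimalPeriod φ '' Function.periodicPts φ) n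

/-- The lowest common multiple of the periods of the periodic points of `φ`, if there are finitely
many of them (it is `1` if there are none). -/
def periodsLcm (φ : Diffeomorph (𝓡 q) (𝓡 q) M M 2) (h : (Function.periodicPts φ).Finite) : ℕ :=
  h.toFinset.lcm (Function.minimalPeriod φ)

end Dynamics

/-- A real matrix, seen as a complex one. -/
def toComplex {N : ℕ} (A : Matrix (Fin N) (Fin N) ℝ) : Matrix (Fin N) (Fin N) ℂ :=
  A.map Complex.ofReal

/-- The vector `(I - lam Aⁿ)⁻¹ (I - A)⁻¹ (I - Aⁿ) C` of `ℂᴺ`. -/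
def resolventVector {N : ℕ} (A : Matrix (Fin N) (Fin N) ℝ) (C : Fin N → ℝ) (n : ℕ) (lam : ℂ) :
    Fin N → ℂ :=
  ((1 - lam • toComplex A ^ n)⁻¹ * (1 - toComplex A)⁻¹ * (1 - toComplex A ^ n)) *ᵥ
    (fun i => (C i : ℂ))

end LinearGS

end

/-! The assignment ω ↦ f_ω is a linear map `S` from C²(M, ℝ) to C²(M, ℝᴺ), continuous by a closed
graph argument (`continuous_of_eq_sync`). On a compact manifold an embedding is an injective
immersion, and these form an open set in the C² topology (`C2Map.isOpen_injective_immersion`). Its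
preimage under `S` is open, so density is what remains. The tool throughout is the cocycle identity
f = ω C + A (f ∘ φ⁻¹) (`sync_eq`).

At a periodic point m of period n, choose ω so that its differentials along the orbit all pull back
to one covector α. Then D = T_m f satisfies D v = α(v) ∑_{j<n} AʲC + Aⁿ D(B v) with B = T_m φ⁻ⁿ. On
an eigenvector z of B, D z is α(z) times a resolvent vector, and independence of these vectors makes
D injective (`injective_of_resolventVector`, `exists_injective_tderiv`). Two periodic points are
separated by a function that is 1 at one of them and 0 at all other periodic points
(`exists_sync_ne`).

Away from the periodic points ψ ↦ T_m(Sψ)v, for v ≠ 0, and, for m ≠ m' not both periodic, ψ ↦ Sψ(m)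
- Sψ(m') are onto ℝᴺ (`exists_tderiv_eq`, `exists_sync_sub_eq`). A function concentrated at φ⁻ⁱ(m)
produces AⁱC up to a small remainder and terms already reached, the AⁱC span, and a
finite-dimensional range is closed. For differentials the remainder cannot be summed term by term,
because the tangent maps of φ⁻ʲ may outgrow the decay of Aʲ. Instead its sup norm is small, its
second derivative is bounded by continuity of `S`, and the first derivative is interpolated
(`exists_norm_tderiv_sub_le`).

Surjectivity feeds a parametric transversality argument: a family of nonzero conditions indexed by
2q < N real parameters holds after an arbitrarily small perturbation
(`exists_nhds_dense_eval_ne_zero`). `dense_injective_immersion` combines these perturbations in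
stages, first on pairs of periodic points, then on the diagonal, then on the remaining pairs, each
so small that earlier gains survive. -/

noncomputable section
namespace LinearGS

open scoped Topology
open Set Filter Function Metric

/-! ### The C² topology: joint continuity and vector space operations -/

section Topology

variable {q : ℕ} {M : Type*} [TopologicalSpace M] [ChartedSpace (EuclideanSpace ℝ (Fin q)) M]
  {F : Type*} [NormedAddCommGroup F] [NormedSpace ℝ F]

theorem C2Map.tendsto_iff {ι : Type*} {l : Filter ι} {G : ι → C2Map q M F} {g : C2Map q M F} :
    Tendsto G l (𝓝 g) ↔ ∀ e ∈ atlas (EuclideanSpace ℝ (Fin q)) M, ∀ k : Fin 3,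
      ∀ K : Set (EuclideanSpace ℝ (Fin q)), IsCompact K → K ⊆ e.target →
        TendstoUniformlyOn (fun i => iteratedFDeriv ℝ (k : ℕ) (fun u => G i (e.symm u)))
          (iteratedFDeriv ℝ (k : ℕ) (fun u => g (e.symm u))) l K := by
  simp only [nhds_iInf, nhds_induced, tendsto_iInf, tendsto_comap_iff,
    UniformOnFun.tendsto_iff_tendstoUniformlyOn, mem_ofPred_eq, and_imp]
  rfl

theorem mfderiv_eq_fderiv_chartAt {g : M → F} {m : M}
    (hg : MDifferentiableAt (𝓡 q) 𝓘(ℝ, F) g m) :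
    mfderiv (𝓡 q) 𝓘(ℝ, F) g m = fderiv ℝ (fun u => g ((chartAt (EuclideanSpace ℝ (Fin q)) m).symm u))
      (chartAt (EuclideanSpace ℝ (Fin q)) m m) := by
  simp only [mfderiv, hg]
  simp [writtenInExtChartAt, extChartAt, Function.comp_def]
  rfl

theorem C2Map.mdifferentiableAt (g : C2Map q M F) (m : M) :
    MDifferentiableAt (𝓡 q) 𝓘(ℝ, F) g m :=
  g.contMDiff.mdifferentiableAt (by norm_num)

variable [IsManifold (𝓡 q) (⊤ : ℕ∞) M]

theorem C2Map.contDiffOn (g : C2Map q M F)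
    {e : OpenPartialHomeomorph M (EuclideanSpace ℝ (Fin q))}
    (he : e ∈ atlas (EuclideanSpace ℝ (Fin q)) M) :
    ContDiffOn ℝ 2 (fun u => g (e.symm u)) e.target := by
  have h : IsManifold (𝓡 q) 2 M := inferInstance
  have h1 : ContMDiffOn (𝓡 q) (𝓡 q) 2 e.symm e.target :=
    contMDiffOn_symm_of_mem_maximalAtlas (IsManifold.subset_maximalAtlas he)
  exact (g.contMDiff.comp_contMDiffOn h1).contDiffOn

theorem C2Map.contDiffAt (g : C2Map q M F)
    {e : OpenPartialHomeomorph M (EuclideanSpace ℝ (Fin q))}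
    (he : e ∈ atlas (EuclideanSpace ℝ (Fin q)) M) {u : EuclideanSpace ℝ (Fin q)}
    (hu : u ∈ e.target) : ContDiffAt ℝ 2 (fun u => g (e.symm u)) u :=
  (g.contDiffOn he).contDiffAt (e.open_target.mem_nhds hu)

/-- Joint continuity rests on local compactness of ℝ^q: nearby maps are uniformly close on a compact
neighbourhood of `u`, and the derivative of `g` itself is continuous at `u`. -/
theorem C2Map.continuousAt_iteratedFDeriv (g : C2Map q M F)
    {e : OpenPartialHomeomorph M (EuclideanSpace ℝ (Fin q))}
    (he : e ∈ atlas (EuclideanSpace ℝ (Fin q)) M) (k : Fin 3) {u : EuclideanSpace ℝ (Fin q)}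
    (hu : u ∈ e.target) :
    ContinuousAt (fun p : C2Map q M F × EuclideanSpace ℝ (Fin q) =>
      iteratedFDeriv ℝ (k : ℕ) (fun u => p.1 (e.symm u)) p.2) (g, u) := by
  obtain ⟨K, hK, hKt, hKc⟩ := local_compact_nhds (e.open_target.mem_nhds hu)
  have h1 := C2Map.tendsto_iff.1 (tendsto_id (α := C2Map q M F) (x := 𝓝 g)) e he k K hKc hKt
  have hk : ((k : ℕ) : WithTop ℕ∞) ≤ 2 := by
    have : (k : ℕ) ≤ 2 := by omega
    exact_mod_cast this
  have h2 : ContinuousAt (iteratedFDeriv ℝ (k : ℕ) (fun u => g (e.symm u))) u :=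
    ((g.contDiffAt he hu).continuousAt_iteratedFDeriv hk)
  rw [ContinuousAt, Metric.tendsto_nhds]
  intro ε hε
  have h3 := Metric.tendstoUniformlyOn_iff.1 h1 (ε / 2) (half_pos hε)
  have h4 := Metric.tendsto_nhds.1 h2 (ε / 2) (half_pos hε)
  rw [nhds_prod_eq]
  filter_upwards [h3.prod_mk (h4.and hK)] with p hp
  have h5 := hp.1 p.2 hp.2.2
  rw [dist_comm] at h5
  calc _ ≤ _ := dist_triangle _ _ _
    _ < ε / 2 + ε / 2 := add_lt_add h5 hp.2.1
    _ = ε := add_halves ε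

theorem C2Map.continuousAt_apply (g : C2Map q M F)
    {e : OpenPartialHomeomorph M (EuclideanSpace ℝ (Fin q))}
    (he : e ∈ atlas (EuclideanSpace ℝ (Fin q)) M) {u : EuclideanSpace ℝ (Fin q)}
    (hu : u ∈ e.target) :
    ContinuousAt (fun p : C2Map q M F × EuclideanSpace ℝ (Fin q) => p.1 (e.symm p.2)) (g, u) := by
  have h := g.continuousAt_iteratedFDeriv he 0 hu
  exact ((continuousMultilinearCurryFin0 ℝ (EuclideanSpace ℝ (Fin q)) F).continuous.continuousAt).comp h

theorem C2Map.continuousAt_fderiv (g : C2Map q M F)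
    {e : OpenPartialHomeomorph M (EuclideanSpace ℝ (Fin q))}
    (he : e ∈ atlas (EuclideanSpace ℝ (Fin q)) M) {u : EuclideanSpace ℝ (Fin q)}
    (hu : u ∈ e.target) :
    ContinuousAt (fun p : C2Map q M F × EuclideanSpace ℝ (Fin q) =>
      fderiv ℝ (fun u => p.1 (e.symm u)) p.2) (g, u) := by
  have h := g.continuousAt_iteratedFDeriv he 1 hu
  have h2 := ((continuousMultilinearCurryFin1 ℝ (EuclideanSpace ℝ (Fin q)) F).continuous.continuousAt).comp h
  refine h2.congr (Eventually.of_forall fun p => ?_)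
  ext v
  simp [iteratedFDeriv_one_apply]

theorem C2Map.continuous_eval : Continuous (fun p : C2Map q M F × M => p.1 p.2) := by
  refine continuous_iff_continuousAt.2 fun ⟨g, m⟩ => ?_
  set e := chartAt (EuclideanSpace ℝ (Fin q)) m
  have hm : m ∈ e.source := mem_chart_source _ m
  have h1 := g.continuousAt_apply (chart_mem_atlas _ m) (e.map_source hm)
  have h2 : ContinuousAt (fun p : C2Map q M F × M => (p.1, e p.2)) (g, m) :=
    continuousAt_fst.prodMk ((e.continuousAt hm).comp continuousAt_snd)
  refine (ContinuousAt.comp (f := fun p : C2Map q M F × M => (p.1, e p.2)) h1 h2).congr ?_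
  filter_upwards [(continuousAt_snd (p := (g, m))).eventually (e.open_source.mem_nhds hm)] with p hp
  exact congrArg p.1 (e.left_inv hp)

instance C2Map.instContinuousAdd : ContinuousAdd (C2Map q M F) where
  continuous_add := by
    refine continuous_iff_continuousAt.2 fun ⟨g, h⟩ => C2Map.tendsto_iff.2 fun e he k K hK hKt => ?_
    have hk : ((k : ℕ) : WithTop ℕ∞) ≤ 2 := by
      have : (k : ℕ) ≤ 2 := by omega
      exact_mod_cast this
    have key : ∀ g h : C2Map q M F, EqOn (iteratedFDeriv ℝ (k : ℕ) (fun u => g (e.symm u)) +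
        iteratedFDeriv ℝ (k : ℕ) (fun u => h (e.symm u)))
        (iteratedFDeriv ℝ (k : ℕ) (fun u => (g + h) (e.symm u))) K := fun g h u hu =>
      (iteratedFDeriv_add_apply (((g.contDiffAt he (hKt hu))).of_le hk)
        ((h.contDiffAt he (hKt hu)).of_le hk)).symm
    have h1 := C2Map.tendsto_iff.1 (continuousAt_fst (p := (g, h))) e he k K hK hKt
    have h2 := C2Map.tendsto_iff.1 (continuousAt_snd (p := (g, h))) e he k K hK hKt
    exact ((h1.add h2).congr (Eventually.of_forall fun p => key p.1 p.2)).congr_right (key g h)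

theorem C2Map.continuous_smul_left (g : C2Map q M F) : Continuous (fun t : ℝ => t • g) := by
  refine continuous_iff_continuousAt.2 fun t => C2Map.tendsto_iff.2 fun e he k K hK hKt => ?_
  have hk : ((k : ℕ) : WithTop ℕ∞) ≤ 2 := by
    have : (k : ℕ) ≤ 2 := by omega
    exact_mod_cast this
  have key : ∀ t : ℝ, ∀ u ∈ K, iteratedFDeriv ℝ (k : ℕ) (fun u => (t • g) (e.symm u)) u =
      t • iteratedFDeriv ℝ (k : ℕ) (fun u => g (e.symm u)) u := fun t u hu =>
    iteratedFDeriv_const_smul_apply ((g.contDiffAt he (hKt hu)).of_le hk)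
  have hc : ContinuousOn (iteratedFDeriv ℝ (k : ℕ) (fun u => g (e.symm u))) K := fun u hu =>
    ((g.contDiffAt he (hKt hu)).continuousAt_iteratedFDeriv hk).continuousWithinAt
  obtain ⟨B, hB⟩ := hK.exists_bound_of_continuousOn hc
  rw [Metric.tendstoUniformlyOn_iff]
  intro ε hε
  have : ∀ᶠ s in 𝓝 t, ‖t - s‖ * (|B| + 1) < ε := by
    have : Tendsto (fun s => ‖t - s‖ * (|B| + 1)) (𝓝 t) (𝓝 (‖t - t‖ * (|B| + 1))) :=
      Continuous.tendsto (by fun_prop) t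
    exact this.eventually_lt_const (by simpa using hε)
  filter_upwards [this] with s hs u hu
  rw [key t u hu, key s u hu, dist_eq_norm, ← sub_smul, norm_smul]
  refine lt_of_le_of_lt (mul_le_mul_of_nonneg_left ?_ (norm_nonneg _)) hs
  linarith [hB u hu, le_abs_self B]

theorem C2Map.injective_mfderiv_iff (g : C2Map q M F)
    {e : OpenPartialHomeomorph M (EuclideanSpace ℝ (Fin q))}
    (he : e ∈ atlas (EuclideanSpace ℝ (Fin q)) M) {m : M} (hm : m ∈ e.source) :
    Injective (mfderiv (𝓡 q) 𝓘(ℝ, F) g m) ↔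
      Injective (fderiv ℝ (fun u => g (e.symm u)) (e m)) := by
  have h : IsManifold (𝓡 q) 1 M := inferInstance
  have hmd : e.MDifferentiable (𝓡 q) (𝓡 q) := mdifferentiable_of_mem_atlas he
  have h1 : MDifferentiableAt (𝓡 q) (𝓡 q) e m := hmd.mdifferentiableAt hm
  have h2 : MDifferentiableAt (𝓡 q) 𝓘(ℝ, F) (fun u => g (e.symm u)) (e m) :=
    ((g.contDiffAt he (e.map_source hm)).differentiableAt (by norm_num)).mdifferentiableAt
  have h3 : mfderiv (𝓡 q) 𝓘(ℝ, F) g m =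
      (mfderiv (𝓡 q) 𝓘(ℝ, F) (fun u => g (e.symm u)) (e m)).comp (mfderiv (𝓡 q) (𝓡 q) e m) := by
    rw [← mfderiv_comp m h2 h1]
    refine Filter.EventuallyEq.mfderiv_eq ?_
    filter_upwards [e.open_source.mem_nhds hm] with x hx
    simp [e.left_inv hx]
  rw [h3, mfderiv_eq_fderiv]
  have hb := hmd.mfderiv_bijective hm
  exact Injective.of_comp_iff' _ hb

end Topology

/-! ### Openness of injective immersions -/

section Stability

variable {q : ℕ} {M : Type*} [TopologicalSpace M] [ChartedSpace (EuclideanSpace ℝ (Fin q)) M]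
  {F : Type*} [NormedAddCommGroup F] [NormedSpace ℝ F] [IsManifold (𝓡 q) (⊤ : ℕ∞) M]

/-- Near an immersive point, injectivity and immersivity persist, uniformly for nearby maps. -/
theorem C2Map.eventually_of_injective_mfderiv (g : C2Map q M F) {m : M}
    (h : Injective (mfderiv (𝓡 q) 𝓘(ℝ, F) g m)) :
    ∀ᶠ p : C2Map q M F × (M × M) in 𝓝 (g, (m, m)),
      (p.1 p.2.1 = p.1 p.2.2 → p.2.1 = p.2.2) ∧
        Injective (mfderiv (𝓡 q) 𝓘(ℝ, F) p.1 p.2.1) := by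
  set e := chartAt (EuclideanSpace ℝ (Fin q)) m with he
  have hea : e ∈ atlas (EuclideanSpace ℝ (Fin q)) M := chart_mem_atlas _ m
  have hm : m ∈ e.source := mem_chart_source _ m
  have hu : e m ∈ e.target := e.map_source hm
  rw [g.injective_mfderiv_iff hea hm] at h
  set D := fderiv ℝ (fun u => g (e.symm u)) (e m) with hD
  -- `K` bounds the inverse of `D` on its image. If derivatives stay within `1 / (2 * K)` of `D` on
  -- a convex ball, then both a difference of points with equal images and a kernel vector satisfy
  -- ‖D v‖ ≤ ‖v‖ / (2K), which forces v = 0.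
  obtain ⟨K, hK, hanti⟩ := LinearMap.exists_antilipschitzWith (D : EuclideanSpace ℝ (Fin q) →ₗ[ℝ] F)
    (LinearMap.ker_eq_bot.2 h)
  have hKpos : (0 : ℝ) < K := hK
  have hbd : ∀ v, ‖v‖ ≤ K * ‖D v‖ := fun v => by
    simpa using hanti.le_mul_dist v 0
  have h1 := g.continuousAt_fderiv hea hu
  have h2 := Metric.tendsto_nhds.1 h1 (1 / (2 * K)) (by positivity)
  obtain ⟨P, hP, Q, hQ, hPQ⟩ := eventually_prod_iff.1 (by rwa [nhds_prod_eq] at h2)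
  obtain ⟨r, hr, hball⟩ := Metric.mem_nhds_iff.1 (Filter.inter_mem hQ (e.open_target.mem_nhds hu))
  have hU : e.source ∩ e ⁻¹' ball (e m) r ∈ 𝓝 m :=
    (e.isOpen_inter_preimage isOpen_ball).mem_nhds ⟨hm, mem_ball_self hr⟩
  have hder : ∀ g' : C2Map q M F, P g' → ∀ u ∈ ball (e m) r,
      ‖fderiv ℝ (fun u => g' (e.symm u)) u - D‖ ≤ 1 / (2 * K) := fun g' hg' u hu => by
    have := hPQ hg' (hball hu).1
    rw [dist_eq_norm] at this
    exact this.le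
  have hmain : ∀ v : EuclideanSpace ℝ (Fin q), ‖D v‖ ≤ 1 / (2 * K) * ‖v‖ → v = 0 := fun v hv => by
    have h3 := (hbd v).trans (mul_le_mul_of_nonneg_left hv hKpos.le)
    have h4 : (K : ℝ) * (1 / (2 * K) * ‖v‖) = ‖v‖ / 2 := by field_simp
    rw [h4] at h3
    exact norm_le_zero_iff.1 (by linarith)
  rw [nhds_prod_eq, nhds_prod_eq]
  filter_upwards [Filter.Eventually.prod_mk hP
    (Filter.Eventually.prod_mk (pa := fun x => x ∈ e.source ∩ e ⁻¹' ball (e m) r) hU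
      (pb := fun x => x ∈ e.source ∩ e ⁻¹' ball (e m) r) hU)]
  rintro ⟨g', x, y⟩ ⟨hg', hx, hy⟩
  refine ⟨fun hxy => ?_, ?_⟩
  · have h5 := (convex_ball (e m) r).norm_image_sub_le_of_norm_fderiv_le' (𝕜 := ℝ)
      (f := fun u => g' (e.symm u)) (φ := D) (C := 1 / (2 * K))
      (fun u hu => (g'.contDiffAt hea (hball hu).2).differentiableAt (by norm_num))
      (fun u hu => hder g' hg' u hu) hx.2 hy.2
    simp only [e.left_inv hx.1, e.left_inv hy.1] at h5
    simp only at hxy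
    rw [hxy, sub_self, zero_sub, norm_neg] at h5
    have h6 := sub_eq_zero.1 (hmain _ h5)
    exact (e.injOn hy.1 hx.1 h6).symm
  · rw [g'.injective_mfderiv_iff hea hx.1]
    refine (injective_iff_map_eq_zero _).2 fun v hv => hmain v ?_
    have h7 := (fderiv ℝ (fun u => g' (e.symm u)) (e x) - D).le_of_opNorm_le
      (hder g' hg' _ hx.2) v
    simpa [hv] using h7

theorem C2Map.eventually_apply_ne (g : C2Map q M F) {m m' : M} (h : g m ≠ g m') :
    ∀ᶠ p : C2Map q M F × (M × M) in 𝓝 (g, (m, m')), p.1 p.2.1 ≠ p.1 p.2.2 := by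
  have h1 : Continuous fun p : C2Map q M F × (M × M) => p.1 p.2.1 :=
    C2Map.continuous_eval.comp (f := fun p : C2Map q M F × (M × M) => (p.1, p.2.1)) (by fun_prop)
  have h2 : Continuous fun p : C2Map q M F × (M × M) => p.1 p.2.2 :=
    C2Map.continuous_eval.comp (f := fun p : C2Map q M F × (M × M) => (p.1, p.2.2)) (by fun_prop)
  exact (isOpen_ne_fun h1 h2).mem_nhds h

theorem C2Map.eventually_of_injective (g : C2Map q M F) {z : M × M}
    (himm : Injective (mfderiv (𝓡 q) 𝓘(ℝ, F) g z.1)) (hinj : g z.1 = g z.2 → z.1 = z.2) :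
    ∀ᶠ p : C2Map q M F × (M × M) in 𝓝 (g, z),
      (p.1 p.2.1 = p.1 p.2.2 → p.2.1 = p.2.2) ∧
        Injective (mfderiv (𝓡 q) 𝓘(ℝ, F) p.1 p.2.1) := by
  obtain ⟨x, y⟩ := z
  by_cases hxy : x = y
  · subst hxy
    exact g.eventually_of_injective_mfderiv himm
  · have h1 := g.eventually_of_injective_mfderiv himm
    have h2 : Tendsto (fun p : C2Map q M F × (M × M) => (p.1, (p.2.1, p.2.1))) (𝓝 (g, (x, y)))
        (𝓝 (g, (x, x))) := Continuous.tendsto (by fun_prop) (g, (x, y))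
    filter_upwards [g.eventually_apply_ne (fun h => hxy (hinj h)), h2.eventually h1] with p hp hp'
    exact ⟨fun h => (hp h).elim, hp'.2⟩

/-- Goodness of a pair persists for nearby maps and nearby pairs, on the diagonal thanks to
immersivity; compactness of M × M makes the neighbourhood of the map uniform. -/
theorem C2Map.isOpen_injective_immersion [CompactSpace M] :
    IsOpen {g : C2Map q M F | (∀ m, Injective (mfderiv (𝓡 q) 𝓘(ℝ, F) g m)) ∧ Injective g} := by
  refine isOpen_iff_mem_nhds.2 fun g hg => ?_
  have h := (isCompact_univ (X := M × M)).eventually_forall_of_forall_eventually (x₀ := g)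
    (P := fun g z => (g z.1 = g z.2 → z.1 = z.2) ∧ Injective (mfderiv (𝓡 q) 𝓘(ℝ, F) g z.1))
    (fun z _ => g.eventually_of_injective (hg.1 z.1) (fun h => hg.2 h))
  filter_upwards [h] with g' hg'
  exact ⟨fun m => (hg' (m, m) trivial).2, fun x y hxy => (hg' (x, y) trivial).1 hxy⟩

end Stability

/-! ### Parametric transversality below the critical dimension -/

section Avoidance

/-- Finitely many of the neighbourhoods cover `K`, and finite intersections of dense open sets are
dense, so no Baire property is needed. -/
theorem exists_dense_of_forall_nhds {X Z : Type*} [TopologicalSpace X] [TopologicalSpace Z]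
    {Q : X → Z → Prop} {K : Set Z} (hK : IsCompact K)
    (h : ∀ z ∈ K, ∃ V ∈ 𝓝 z, ∃ O : Set X, IsOpen O ∧ Dense O ∧ ∀ x ∈ O, ∀ y ∈ V, Q x y) :
    ∃ O : Set X, IsOpen O ∧ Dense O ∧ ∀ x ∈ O, ∀ y ∈ K, Q x y := by
  refine hK.induction_on (p := fun s => ∃ O : Set X, IsOpen O ∧ Dense O ∧ ∀ x ∈ O, ∀ y ∈ s, Q x y)
    ⟨univ, isOpen_univ, dense_univ, by simp⟩ ?_ ?_ ?_
  · rintro s t hst ⟨O, h1, h2, h3⟩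
    exact ⟨O, h1, h2, fun x hx y hy => h3 x hx y (hst hy)⟩
  · rintro s t ⟨O, h1, h2, h3⟩ ⟨O', h1', h2', h3'⟩
    refine ⟨O ∩ O', h1.inter h1', h2.inter_of_isOpen_left h2' h1, fun x hx y hy => ?_⟩
    exact hy.elim (h3 x hx.1 y) (h3' x hx.2 y)
  · intro z hz
    obtain ⟨V, hV, h⟩ := h z hz
    exact ⟨V, mem_nhdsWithin_of_mem_nhds hV, h⟩

/-- An affine family `x ↦ G x + L x t` with invertible `L` avoids `0` for a dense set of
parameters `t` when the space of the `x` has smaller dimension than that of the values. -/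
theorem exists_nhds_dense_add_ne_zero {E F : Type*} [NormedAddCommGroup E] [NormedSpace ℝ E]
    [FiniteDimensional ℝ E] [NormedAddCommGroup F] [NormedSpace ℝ F] [FiniteDimensional ℝ F]
    (hdim : Module.finrank ℝ E < Module.finrank ℝ F) {Ω : Set E} (hΩ : IsOpen Ω) {x₀ : E}
    (hx₀ : x₀ ∈ Ω) {L : E → F →L[ℝ] F} (hL : ContDiffOn ℝ 1 L Ω) (h0 : IsUnit (L x₀)) :
    ∃ U ∈ 𝓝 x₀, U ⊆ Ω ∧ ∀ G : E → F, ContDiffOn ℝ 1 G Ω →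
      Dense {t | ∀ x ∈ U, G x + L x t ≠ 0} := by
  have : CompleteSpace F := FiniteDimensional.complete ℝ F
  have hV : ∀ᶠ x in 𝓝 x₀, IsUnit (L x) :=
    (hL.continuousOn.continuousAt (hΩ.mem_nhds hx₀)).eventually (Units.isOpen.mem_nhds h0)
  obtain ⟨r, hr, hball⟩ := Metric.mem_nhds_iff.1 (hV.and (hΩ.mem_nhds hx₀))
  refine ⟨ball x₀ r, ball_mem_nhds _ hr, fun x hx => (hball hx).2, fun G hG => ?_⟩
  -- The bad parameters are the values t = -L(x)⁻¹ G(x): a C¹ image of a set of Hausdorff dimension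
  -- less than dim F, hence with dense complement.
  have hinv : ContDiffOn ℝ 1 (fun x => -(Ring.inverse (L x)) (G x)) (ball x₀ r) := by
    refine fun x hx => ContDiffAt.contDiffWithinAt ?_
    obtain ⟨w, hw⟩ := (hball hx).1
    have hLx := hL.contDiffAt (hΩ.mem_nhds (hball hx).2)
    have hGx := hG.contDiffAt (hΩ.mem_nhds (hball hx).2)
    have h1 : ContDiffAt ℝ 1 Ring.inverse (L x) := hw ▸ contDiffAt_ringInverse ℝ w
    exact ((h1.comp x hLx).clm_apply hGx).neg
  refine (hinv.dense_compl_image_of_dimH_lt_finrank (convex_ball x₀ r) subset_rfl ?_).mono ?_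
  · refine lt_of_le_of_lt (dimH_mono (subset_univ _)) ?_
    rw [Real.dimH_univ_eq_finrank]
    exact_mod_cast hdim
  · intro t ht x hx h
    refine ht ⟨x, hx, ?_⟩
    have h1 : Ring.inverse (L x) * L x = 1 := Ring.inverse_mul_cancel _ (hball hx).1
    have h2 : G x = -(L x t) := eq_neg_of_add_eq_zero_left h
    simp only [h2, map_neg, neg_neg]
    exact congrArg (fun T : F →L[ℝ] F => T t) h1

variable {q N : ℕ} {M : Type*} [TopologicalSpace M] [ChartedSpace (EuclideanSpace ℝ (Fin q)) M]
  [IsManifold (𝓡 q) (⊤ : ℕ∞) M]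

/-- Functions `ψ k` whose values at `x₀` are the basis vectors give an N-parameter affine family
through any ω, with parameter map `L x₀ = 1`. Surjectivity at the single point `x₀` suffices because
invertibility is open. -/
theorem exists_nhds_dense_eval_ne_zero {E : Type*} [NormedAddCommGroup E] [NormedSpace ℝ E]
    [FiniteDimensional ℝ E] (hdim : Module.finrank ℝ E < N)
    (S : C2Map q M ℝ →ₗ[ℝ] C2Map q M (EuclideanSpace ℝ (Fin N))) (hS : Continuous S)
    (ev : C2Map q M (EuclideanSpace ℝ (Fin N)) → E → EuclideanSpace ℝ (Fin N))
    {Ω : Set E} (hΩ : IsOpen Ω)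
    (hadd : ∀ g h, ∀ x ∈ Ω, ev (g + h) x = ev g x + ev h x)
    (hsmul : ∀ (c : ℝ) g, ∀ x ∈ Ω, ev (c • g) x = c • ev g x)
    (hev : ∀ g, ContDiffOn ℝ 1 (ev g) Ω)
    (hevc : ∀ g, ∀ x ∈ Ω, ContinuousAt (fun p : C2Map q M (EuclideanSpace ℝ (Fin N)) × E =>
      ev p.1 p.2) (g, x))
    {x₀ : E} (hx₀ : x₀ ∈ Ω) (hsurj : ∀ y, ∃ ψ, ev (S ψ) x₀ = y) :
    ∃ U ∈ 𝓝 x₀, ∃ O : Set (C2Map q M ℝ), IsOpen O ∧ Dense O ∧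
      ∀ ω ∈ O, ∀ x ∈ U, ev (S ω) x ≠ 0 := by
  choose ψ hψ using fun k : Fin N => hsurj (EuclideanSpace.single k 1)
  set L : E → EuclideanSpace ℝ (Fin N) →L[ℝ] EuclideanSpace ℝ (Fin N) := fun x =>
    ∑ k, (EuclideanSpace.proj k : EuclideanSpace ℝ (Fin N) →L[ℝ] ℝ).smulRight (ev (S (ψ k)) x)
    with hLdef
  have hLapp : ∀ x t, L x t = ∑ k, t k • ev (S (ψ k)) x := fun x t => by
    simp [hLdef]
  have hL : ContDiffOn ℝ 1 L Ω := by
    refine ContDiffOn.sum fun k _ => ?_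
    exact ((ContinuousLinearMap.smulRightL ℝ (EuclideanSpace ℝ (Fin N))
      (EuclideanSpace ℝ (Fin N)) (EuclideanSpace.proj k)).contDiff.comp_contDiffOn (hev _))
  have hL0 : L x₀ = 1 := by
    ext t i
    rw [hLapp]
    simp [hψ, Pi.single_apply]
  obtain ⟨U, hU, hUΩ, hG⟩ := exists_nhds_dense_add_ne_zero (by simpa using hdim) hΩ hx₀ hL
    (hL0 ▸ isUnit_one)
  -- Passing to a compact neighbourhood makes nonvanishing an open condition on ω.
  obtain ⟨K, hK, hKU, hKc⟩ := local_compact_nhds hU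
  refine ⟨K, hK, {ω | ∀ x ∈ K, ev (S ω) x ≠ 0}, ?_, ?_, fun ω hω => hω⟩
  · refine isOpen_iff_mem_nhds.2 fun ω hω => ?_
    refine hKc.eventually_forall_of_forall_eventually (P := fun ω x => ev (S ω) x ≠ 0)
      fun x hx => ?_
    have h2 : ContinuousAt (fun p : C2Map q M ℝ × E => (S p.1, p.2)) (ω, x) :=
      Continuous.continuousAt (by fun_prop)
    have h1 : ContinuousAt (fun p : C2Map q M ℝ × E => ev (S p.1) p.2) (ω, x) :=
      ContinuousAt.comp (g := fun p : C2Map q M (EuclideanSpace ℝ (Fin N)) × E => ev p.1 p.2)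
        (f := fun p : C2Map q M ℝ × E => (S p.1, p.2)) (x := (ω, x)) (hevc (S ω) x (hUΩ (hKU hx))) h2
    exact h1.eventually_ne (hω x hx)
  · intro ω
    have hsumev : ∀ t : EuclideanSpace ℝ (Fin N), ∀ x ∈ Ω, ∀ s : Finset (Fin N),
        ev (S (ω + ∑ k ∈ s, t k • ψ k)) x = ev (S ω) x + ∑ k ∈ s, t k • ev (S (ψ k)) x := by
      intro t x hx s
      classical
      induction s using Finset.induction_on with
      | empty => simp
      | insert a s ha ih =>
        rw [Finset.sum_insert ha, Finset.sum_insert ha, add_left_comm, map_add, hadd _ _ x hx, ih,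
          map_smul, hsmul _ _ x hx, add_left_comm]
    have hcts : Continuous fun t : EuclideanSpace ℝ (Fin N) => ω + ∑ k, t k • ψ k := by
      refine continuous_const.add (continuous_finsetSum _ fun k _ => ?_)
      exact (C2Map.continuous_smul_left (ψ k)).comp (by fun_prop)
    have h0 : ω + ∑ k, (0 : EuclideanSpace ℝ (Fin N)) k • ψ k = ω := by simp
    have h3 := map_mem_closure (t := {ω | ∀ x ∈ K, ev (S ω) x ≠ 0}) hcts
      (hG (fun x => ev (S ω) x) (hev _) 0) fun t ht x hx => by
        rw [hsumev t x (hUΩ (hKU hx)), ← hLapp]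
        exact ht x (hKU hx)
    rwa [h0] at h3

end Avoidance

/-! ### Summability of powers of a matrix of spectral radius below one -/

section Spectral

variable {N : ℕ}

attribute [local instance] Matrix.linftyOpNormedRing Matrix.linftyOpNormedAlgebra

/-- Gelfand's formula puts the n-th roots of the norms eventually below some r < 1, so a geometric
series dominates. -/
theorem summable_norm_pow_of_spectralRadius_lt_one {B : Matrix (Fin N) (Fin N) ℂ}
    (hB : spectralRadius ℂ B < 1) : Summable fun j : ℕ => ‖B ^ j‖ := by
  obtain ⟨r, hr, hr1⟩ := ENNReal.lt_iff_exists_nnreal_btwn.1 hB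
  have hr1' : r < 1 := by exact_mod_cast hr1
  have h1 := (spectrum.pow_nnnorm_pow_one_div_tendsto_nhds_spectralRadius B).eventually_lt_const hr
  refine Summable.of_norm_bounded_eventually_nat (g := fun j => (r : ℝ) ^ j)
    (summable_geometric_of_lt_one r.2 (by exact_mod_cast hr1')) ?_
  filter_upwards [h1, eventually_gt_atTop 0] with n hn hn0
  rw [norm_norm]
  have hn0' : (0 : ℝ) < n := by exact_mod_cast hn0
  have h2 : ((‖B ^ n‖₊ : ENNReal) ^ (1 / n : ℝ)) ^ (n : ℝ) ≤ (r : ENNReal) ^ (n : ℝ) :=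
    ENNReal.rpow_le_rpow hn.le hn0'.le
  rw [← ENNReal.rpow_mul, one_div_mul_cancel hn0'.ne', ENNReal.rpow_one, ENNReal.rpow_natCast] at h2
  have h3 : ‖B ^ n‖₊ ≤ r ^ n := by exact_mod_cast h2
  exact_mod_cast h3

theorem toComplex_pow (A : Matrix (Fin N) (Fin N) ℝ) (j : ℕ) :
    toComplex (A ^ j) = toComplex A ^ j :=
  map_pow (Complex.ofRealHom.mapMatrix (m := Fin N)) A j

theorem toComplex_mulVec (A : Matrix (Fin N) (Fin N) ℝ) (x : Fin N → ℝ) :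
    toComplex A *ᵥ (fun i => (x i : ℂ)) = fun i => ((A *ᵥ x) i : ℂ) := by
  ext i
  simp [toComplex, Matrix.mulVec, dotProduct]

theorem summable_norm_pow_mulVec {A : Matrix (Fin N) (Fin N) ℝ}
    (hA : spectralRadius ℂ (toComplex A) < 1) (x : EuclideanSpace ℝ (Fin N)) :
    Summable fun j : ℕ => ‖(Matrix.toEuclideanCLM (𝕜 := ℝ) A ^ j) x‖ := by
  set y : Fin N → ℂ := fun i => (x i : ℂ)
  have h1 := (summable_norm_pow_of_spectralRadius_lt_one hA).mul_right ‖y‖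
  have h2 : ∀ i : Fin N, Summable fun j : ℕ => ‖((Matrix.toEuclideanCLM (𝕜 := ℝ) A ^ j) x) i‖ := by
    intro i
    refine h1.of_nonneg_of_le (fun j => norm_nonneg _) fun j => ?_
    have h3 : ((Matrix.toEuclideanCLM (𝕜 := ℝ) A ^ j) x) i = (A ^ j *ᵥ x.ofLp) i := by
      rw [← map_pow]
      exact congrFun (Matrix.ofLp_toEuclideanCLM _ _) i
    have h4 : ‖((A ^ j *ᵥ x.ofLp) i : ℂ)‖ ≤ ‖toComplex A ^ j *ᵥ y‖ := by
      rw [← toComplex_pow, toComplex_mulVec]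
      exact norm_le_pi_norm (fun i => ((A ^ j *ᵥ x.ofLp) i : ℂ)) i
    rw [h3]
    rw [Complex.norm_real] at h4
    exact h4.trans (Matrix.linfty_opNorm_mulVec _ _)
  have h3 : Summable fun j : ℕ => ∑ i, ‖((Matrix.toEuclideanCLM (𝕜 := ℝ) A ^ j) x) i‖ :=
    summable_sum fun i _ => h2 i
  refine h3.of_nonneg_of_le (fun j => norm_nonneg _) fun j => ?_
  rw [EuclideanSpace.norm_eq]
  refine Real.sqrt_le_iff.2 ⟨Finset.sum_nonneg fun i _ => norm_nonneg _, ?_⟩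
  exact Finset.sum_sq_le_sq_sum_of_nonneg fun i _ => norm_nonneg _

end Spectral

/-! ### The synchronization series and its cocycle identity -/

section Sync

variable {q N : ℕ} {M : Type*} [TopologicalSpace M] [ChartedSpace (EuclideanSpace ℝ (Fin q)) M]

theorem generalizedSync_eq (A : Matrix (Fin N) (Fin N) ℝ) (C : Fin N → ℝ)
    (φ : Diffeomorph (𝓡 q) (𝓡 q) M M 2) (w : M → ℝ) (m : M) :
    generalizedSync A C φ w m =
      ∑' j : ℕ, w (φ.symm^[j] m) • (Matrix.toEuclideanCLM (𝕜 := ℝ) A ^ j) (WithLp.toLp 2 C) := by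
  have h := (EuclideanSpace.equiv (Fin N) ℝ).symm.map_tsum
    (f := fun j : ℕ => w (φ.symm^[j] m) • (A ^ j *ᵥ C)) (L := SummationFilter.unconditional ℕ)
  refine Eq.trans h (tsum_congr fun j => ?_)
  rw [map_smul, ← map_pow]
  rfl


/-- The differential of a map on `M`, as a map on the model space. -/
def tderiv {F : Type*} [NormedAddCommGroup F] [NormedSpace ℝ F] (g : M → F) (m : M) :
    EuclideanSpace ℝ (Fin q) →L[ℝ] F :=
  mfderiv (𝓡 q) 𝓘(ℝ, F) g m

/-- The tangent map of a self-map of `M`, as a map on the model space. -/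
def tmap (h : M → M) (m : M) : EuclideanSpace ℝ (Fin q) →L[ℝ] EuclideanSpace ℝ (Fin q) :=
  mfderiv (𝓡 q) (𝓡 q) h m

theorem mdifferentiable_iterate (φ : Diffeomorph (𝓡 q) (𝓡 q) M M 2) (n : ℕ) :
    MDifferentiable (𝓡 q) (𝓡 q) (φ^[n]) := by
  induction n with
  | zero => exact mdifferentiable_id
  | succ n ih =>
    rw [iterate_succ']
    exact (φ.mdifferentiable (by norm_num)).comp ih

theorem tmap_comp {h k : M → M} (hh : MDifferentiable (𝓡 q) (𝓡 q) h)
    (hk : MDifferentiable (𝓡 q) (𝓡 q) k) (m : M) :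
    tmap (h ∘ k) m = (tmap (q := q) h (k m)).comp (tmap k m) :=
  mfderiv_comp m (hh _) (hk _)

theorem tmap_id (m : M) : tmap (q := q) (id : M → M) m = ContinuousLinearMap.id ℝ _ :=
  mfderiv_id

theorem tmap_iterate_succ (φ : Diffeomorph (𝓡 q) (𝓡 q) M M 2) (n : ℕ) (m : M) :
    tmap (φ^[n + 1]) m = (tmap (q := q) (φ^[n]) (φ m)).comp (tmap φ m) := by
  rw [iterate_succ]
  exact tmap_comp (mdifferentiable_iterate φ n) (φ.mdifferentiable (by norm_num)) m

theorem tmap_injective (φ : Diffeomorph (𝓡 q) (𝓡 q) M M 2) (m : M) :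
    Injective (tmap (q := q) φ m) := by
  have h := tmap_comp (φ.symm.mdifferentiable (by norm_num)) (φ.mdifferentiable (by norm_num)) m
  have h1 : (φ.symm ∘ φ : M → M) = id := funext φ.symm_apply_apply
  rw [h1, tmap_id] at h
  intro v w hvw
  have h2 := congrArg (fun L : EuclideanSpace ℝ (Fin q) →L[ℝ] _ => L v - L w) h
  simp only [ContinuousLinearMap.comp_apply, hvw, sub_self] at h2
  exact sub_eq_zero.1 h2

theorem tmap_iterate_injective (φ : Diffeomorph (𝓡 q) (𝓡 q) M M 2) (n : ℕ) (m : M) :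
    Injective (tmap (q := q) (φ^[n]) m) := by
  induction n generalizing m with
  | zero =>
    have := tmap_id (q := q) m
    rw [iterate_zero, this]
    exact injective_id
  | succ n ih =>
    rw [tmap_iterate_succ]
    exact (ih _).comp (tmap_injective φ m)

variable {F : Type*} [NormedAddCommGroup F] [NormedSpace ℝ F]

/-- The series `∑ Tʲ c w(φ⁻ʲ(m))`. -/
def sync (T : F →L[ℝ] F) (c : F) (φ : Diffeomorph (𝓡 q) (𝓡 q) M M 2) (w : M → ℝ) (m : M) : F :=
  ∑' j : ℕ, w (φ.symm^[j] m) • (T ^ j) c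

theorem C2Map.exists_bound [CompactSpace M] (w : C2Map q M F) : ∃ B, ∀ m, ‖w m‖ ≤ B := by
  obtain ⟨B, hB⟩ := isCompact_univ.exists_bound_of_continuousOn w.contMDiff.continuous.continuousOn
  exact ⟨B, fun m => hB m trivial⟩

variable {T : F →L[ℝ] F} {c : F} {φ : Diffeomorph (𝓡 q) (𝓡 q) M M 2}

/-- The cocycle identity is differentiated instead of the series, whose termwise derivatives need
not be summable. -/
theorem tderiv_eq_of_cocycle {f : M → F} (hf : MDifferentiable (𝓡 q) 𝓘(ℝ, F) f) (w : C2Map q M ℝ)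
    (h : ∀ m, f m = w m • c + T (f (φ.symm m))) (m : M) (v : EuclideanSpace ℝ (Fin q)) :
    tderiv f m v = tderiv w m v • c + T (tderiv f (φ.symm m) (tmap φ.symm m v)) := by
  have h1 : HasMFDerivAt (𝓡 q) 𝓘(ℝ, ℝ) w m (mfderiv (𝓡 q) 𝓘(ℝ, ℝ) w m) :=
    (w.mdifferentiableAt m).hasMFDerivAt
  have h2 := (hf (φ.symm m)).hasMFDerivAt
  have h3 := (φ.symm.mdifferentiable (by norm_num) m).hasMFDerivAt
  have h4 := ((ContinuousLinearMap.toSpanSingleton ℝ c).hasMFDerivAt (x := w m)).comp m h1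
  have h5 := (T.hasMFDerivAt (x := f (φ.symm m))).comp m (h2.comp m h3)
  have h6 := h4.add h5
  have h7 : f = (ContinuousLinearMap.toSpanSingleton ℝ c ∘ w) + (T ∘ (f ∘ φ.symm)) := by
    funext x
    simpa using h x
  rw [← h7] at h6
  have h8 := h6.mfderiv
  exact congrArg (fun L : EuclideanSpace ℝ (Fin q) →L[ℝ] F => L v) h8

theorem tderiv_eq_sum_of_cocycle {f : M → F} (hf : MDifferentiable (𝓡 q) 𝓘(ℝ, F) f)
    (w : C2Map q M ℝ)
    (h : ∀ m, f m = w m • c + T (f (φ.symm m))) (n : ℕ) (m : M) (v : EuclideanSpace ℝ (Fin q)) :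
    tderiv f m v = ∑ j ∈ Finset.range n,
        tderiv w (φ.symm^[j] m) (tmap (φ.symm^[j]) m v) • (T ^ j) c +
      (T ^ n) (tderiv f (φ.symm^[n] m) (tmap (φ.symm^[n]) m v)) := by
  induction n with
  | zero =>
    have := tmap_id (q := q) m
    simp [this]
  | succ n ih =>
    have h1 : tmap (φ.symm^[n + 1]) m v = tmap φ.symm (φ.symm^[n] m) (tmap (φ.symm^[n]) m v) := by
      rw [iterate_succ', tmap_comp (φ.symm.mdifferentiable (by norm_num))
        (mdifferentiable_iterate φ.symm n)]
      rfl
    rw [ih, tderiv_eq_of_cocycle hf w h (φ.symm^[n] m), Finset.sum_range_succ, map_add, map_smul,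
      add_assoc, iterate_succ_apply', pow_succ, mul_apply_eq_comp, h1]

variable [CompleteSpace F]

theorem summable_sync (hc : Summable fun j => ‖(T ^ j) c‖) {w : M → ℝ} {B : ℝ}
    (hB : ∀ m, ‖w m‖ ≤ B) (m : M) :
    Summable fun j : ℕ => w (φ.symm^[j] m) • (T ^ j) c := by
  refine Summable.of_norm_bounded (hc.mul_left B) fun j => ?_
  rw [norm_smul]
  exact mul_le_mul_of_nonneg_right (hB _) (norm_nonneg _)

/-- Only the sup norm of `w` enters, so the bound ignores derivatives of φ and is uniform in `m`.
For n = 0 it is the pointwise estimate behind the continuity of `S`. -/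
theorem norm_sync_le_tail (hc : Summable fun j => ‖(T ^ j) c‖) {w : M → ℝ} {B : ℝ}
    (hB : ∀ m, ‖w m‖ ≤ B) (n : ℕ) (m : M) :
    ‖sync T c φ w m - ∑ j ∈ Finset.range n, w (φ.symm^[j] m) • (T ^ j) c‖ ≤
      B * ∑' j, ‖(T ^ (j + n)) c‖ := by
  rw [sync, ← (summable_sync hc hB m).sum_add_tsum_nat_add n, add_sub_cancel_left]
  have hc' := (summable_nat_add_iff n).2 hc
  rw [← tsum_mul_left]
  refine tsum_of_norm_bounded (hc'.mul_left B).hasSum fun j => ?_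
  rw [norm_smul]
  exact mul_le_mul_of_nonneg_right (hB _) (norm_nonneg _)

variable [CompactSpace M]

theorem sync_add (hc : Summable fun j => ‖(T ^ j) c‖) (w w' : C2Map q M ℝ) (m : M) :
    sync T c φ (w + w' : C2Map q M ℝ) m = sync T c φ w m + sync T c φ w' m := by
  obtain ⟨B, hB⟩ := w.exists_bound
  obtain ⟨B', hB'⟩ := w'.exists_bound
  rw [sync, sync, sync, ← (summable_sync hc hB m).tsum_add (summable_sync hc hB' m)]
  exact tsum_congr fun j => add_smul _ _ _

theorem sync_smul (r : ℝ) (w : C2Map q M ℝ) (m : M) :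
    sync T c φ (r • w : C2Map q M ℝ) m = r • sync T c φ w m := by
  rw [sync, sync, ← tsum_const_smul'']
  exact tsum_congr fun j => mul_smul r (w (φ.symm^[j] m)) _

theorem sync_eq (hc : Summable fun j => ‖(T ^ j) c‖) (w : C2Map q M ℝ) (m : M) :
    sync T c φ w m = w m • c + T (sync T c φ w (φ.symm m)) := by
  obtain ⟨B, hB⟩ := w.exists_bound
  rw [sync, (summable_sync hc hB m).tsum_eq_zero_add, sync,
    T.map_tsum (summable_sync hc hB (φ.symm m))]
  congr 1
  refine tsum_congr fun j => ?_
  rw [map_smul, iterate_succ_apply, pow_succ', mul_apply_eq_comp]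

theorem sync_eq_sum (hc : Summable fun j => ‖(T ^ j) c‖) (w : C2Map q M ℝ) (n : ℕ) (m : M) :
    sync T c φ w m = ∑ j ∈ Finset.range n, w (φ.symm^[j] m) • (T ^ j) c +
      (T ^ n) (sync T c φ w (φ.symm^[n] m)) := by
  induction n with
  | zero => simp
  | succ n ih =>
    rw [ih, sync_eq hc w (φ.symm^[n] m), Finset.sum_range_succ, map_add, map_smul, add_assoc,
      iterate_succ_apply', pow_succ, mul_apply_eq_comp]

end Sync

/-! ### Extending functions from a chart by zero -/

section ChartLift

theorem norm_iteratedFDeriv_comp_le_of_eventually {E F G : Type*} [NormedAddCommGroup E]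
    [NormedSpace ℝ E] [NormedAddCommGroup F] [NormedSpace ℝ F] [NormedAddCommGroup G]
    [NormedSpace ℝ G] {g : F → G} {f : E → F} {n : ℕ} {N : WithTop ℕ∞} {x : E} {C D : ℝ}
    (hg : ContDiff ℝ N g) (hf : ∀ᶠ z in 𝓝 x, ContDiffAt ℝ N f z) (hn : n ≤ N)
    (hC : ∀ i, i ≤ n → ‖iteratedFDeriv ℝ i g (f x)‖ ≤ C)
    (hD : ∀ i, 1 ≤ i → i ≤ n → ‖iteratedFDeriv ℝ i f x‖ ≤ D ^ i) :
    ‖iteratedFDeriv ℝ n (g ∘ f) x‖ ≤ n.factorial * C * D ^ n := by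
  obtain ⟨s, hs, hso, hxs⟩ := _root_.eventually_nhds_iff.1 hf
  rw [← iteratedFDerivWithin_of_isOpen n hso hxs]
  refine norm_iteratedFDerivWithin_comp_le hg.contDiffOn
    (fun z hz => (hs z hz).contDiffWithinAt) hn uniqueDiffOn_univ hso.uniqueDiffOn
    (mapsTo_univ f s) hxs ?_ ?_
  · simpa only [iteratedFDerivWithin_univ] using hC
  · simpa only [iteratedFDerivWithin_of_isOpen _ hso hxs] using hD

variable {q : ℕ} {M : Type*} [TopologicalSpace M]

open Classical in
/-- A function on the target of a chart, transported to `M` and extended by zero. -/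
def chartLift (e : OpenPartialHomeomorph M (EuclideanSpace ℝ (Fin q)))
    (k : EuclideanSpace ℝ (Fin q) → ℝ) (x : M) : ℝ :=
  if x ∈ e.source then k (e x) else 0

variable {e : OpenPartialHomeomorph M (EuclideanSpace ℝ (Fin q))}

theorem chartLift_of_mem (k : EuclideanSpace ℝ (Fin q) → ℝ) {x : M} (hx : x ∈ e.source) :
    chartLift e k x = k (e x) := if_pos hx

theorem chartLift_ne_zero {k : EuclideanSpace ℝ (Fin q) → ℝ} {x : M}
    (hx : chartLift e k x ≠ 0) : x ∈ e.source ∧ k (e x) ≠ 0 := by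
  by_cases h : x ∈ e.source
  · rw [chartLift_of_mem k h] at hx
    exact ⟨h, hx⟩
  · exact absurd (if_neg h) hx

variable [T2Space M]

/-- The compact image of `K` is closed because M is Hausdorff, so one neighbourhood of `x` serves
for all `k` supported in `K`. -/
theorem chartLift_eventually_eq_zero {K : Set (EuclideanSpace ℝ (Fin q))} (hK : IsCompact K)
    (hKt : K ⊆ e.target) {x : M} (hx : x ∉ e.source) :
    ∀ᶠ y in 𝓝 x, ∀ k : EuclideanSpace ℝ (Fin q) → ℝ, support k ⊆ K → chartLift e k y = 0 := by
  have h1 : IsClosed (e.symm '' K) :=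
    (hK.image_of_continuousOn (e.continuousOn_symm.mono hKt)).isClosed
  have h2 : x ∉ e.symm '' K := by
    rintro ⟨u, hu, rfl⟩
    exact hx (e.map_target (hKt hu))
  filter_upwards [h1.isOpen_compl.mem_nhds h2] with y hy k hk
  by_contra h
  obtain ⟨h3, h4⟩ := chartLift_ne_zero h
  exact hy ⟨e y, hk h4, e.left_inv h3⟩

variable [ChartedSpace (EuclideanSpace ℝ (Fin q)) M] [IsManifold (𝓡 q) (⊤ : ℕ∞) M]

theorem contMDiff_chartLift (he : e ∈ atlas (EuclideanSpace ℝ (Fin q)) M)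
    {K : Set (EuclideanSpace ℝ (Fin q))} (hK : IsCompact K) (hKt : K ⊆ e.target)
    {k : EuclideanSpace ℝ (Fin q) → ℝ} (hk : ContDiff ℝ 2 k) (hs : support k ⊆ K) :
    ContMDiff (𝓡 q) 𝓘(ℝ, ℝ) 2 (chartLift e k) := by
  have h : IsManifold (𝓡 q) 2 M := inferInstance
  intro x
  by_cases hx : x ∈ e.source
  · have h1 : ContMDiffAt (𝓡 q) (𝓡 q) 2 e x :=
      (contMDiffOn_of_mem_maximalAtlas (IsManifold.subset_maximalAtlas he)).contMDiffAt
        (e.open_source.mem_nhds hx)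
    refine (hk.contMDiff.contMDiffAt.comp x h1).congr_of_eventuallyEq ?_
    filter_upwards [e.open_source.mem_nhds hx] with y hy
    exact chartLift_of_mem k hy
  · refine (contMDiffAt_const (c := (0 : ℝ))).congr_of_eventuallyEq ?_
    filter_upwards [chartLift_eventually_eq_zero hK hKt hx] with y hy
    exact hy k hs

/-- Convergence must be tested in every chart, not only in `e`. Where the charts overlap,
derivatives of the transition map are locally bounded and the chain rule costs a constant; outside
`e.source` the lifts vanish nearby. -/
theorem tendsto_zero_of_chartLift (he : e ∈ atlas (EuclideanSpace ℝ (Fin q)) M)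
    {K : Set (EuclideanSpace ℝ (Fin q))} (hK : IsCompact K) (hKt : K ⊆ e.target)
    {ι : Type*} {l : Filter ι} {k : ι → EuclideanSpace ℝ (Fin q) → ℝ}
    (hk : ∀ i, ContDiff ℝ 2 (k i)) (hs : ∀ i, support (k i) ⊆ K) {B : ι → ℝ}
    (hB : Tendsto B l (𝓝 0))
    (hbd : ∀ i, ∀ j ≤ 2, ∀ u, ‖iteratedFDeriv ℝ j (k i) u‖ ≤ B i) {G : ι → C2Map q M ℝ}
    (hG : ∀ i x, G i x = chartLift e (k i) x) : Tendsto G l (𝓝 0) := by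
  have hman : IsManifold (𝓡 q) 2 M := inferInstance
  refine C2Map.tendsto_iff.2 fun e' he' n K' hK' hKt' => ?_
  have hn : (n : ℕ) ≤ 2 := by omega
  have hn' : ((n : ℕ) : WithTop ℕ∞) ≤ 2 := by exact_mod_cast hn
  rw [← tendstoLocallyUniformlyOn_iff_tendstoUniformlyOn_of_compact hK',
    Metric.tendstoLocallyUniformlyOn_iff]
  intro ε hε y hy
  have hzero : ∀ u, iteratedFDeriv ℝ (n : ℕ) (fun u => (0 : C2Map q M ℝ) (e'.symm u)) u = 0 :=
    fun u => by
      have : (fun u => (0 : C2Map q M ℝ) (e'.symm u)) = fun _ => (0 : ℝ) := rfl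
      rw [this]
      simp
  simp only [hzero, dist_zero_left]
  have hcont : ContinuousAt e'.symm y := e'.continuousAt_symm (hKt' hy)
  by_cases hx : e'.symm y ∈ e.source
  · set τ : EuclideanSpace ℝ (Fin q) → EuclideanSpace ℝ (Fin q) := fun u => e (e'.symm u) with hτ
    have hV : ∀ᶠ u in 𝓝 y, ContDiffAt ℝ 2 τ u ∧ e'.symm u ∈ e.source := by
      have h1 : ∀ᶠ u in 𝓝 y, u ∈ e'.target := e'.open_target.mem_nhds (hKt' hy)
      have h2 : ∀ᶠ u in 𝓝 y, e'.symm u ∈ e.source := hcont.eventually (e.open_source.mem_nhds hx)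
      filter_upwards [h1, h2] with u hu1 hu2
      refine ⟨?_, hu2⟩
      have h3 : ContMDiffAt (𝓡 q) (𝓡 q) 2 e'.symm u :=
        (contMDiffOn_symm_of_mem_maximalAtlas (IsManifold.subset_maximalAtlas he')).contMDiffAt
          (e'.open_target.mem_nhds hu1)
      have h4 : ContMDiffAt (𝓡 q) (𝓡 q) 2 e (e'.symm u) :=
        (contMDiffOn_of_mem_maximalAtlas (IsManifold.subset_maximalAtlas he)).contMDiffAt
          (e.open_source.mem_nhds hu2)
      exact contMDiffAt_iff_contDiffAt.1 (h4.comp u h3)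
    obtain ⟨D, hD1, hD⟩ : ∃ D : ℝ, 1 ≤ D ∧ ∀ᶠ u in 𝓝 y, ∀ i, 1 ≤ i → i ≤ 2 →
        ‖iteratedFDeriv ℝ i τ u‖ ≤ D ^ i := by
      have hc : ∀ i ≤ 2, ∀ᶠ u in 𝓝 y, ‖iteratedFDeriv ℝ i τ u‖ < ‖iteratedFDeriv ℝ i τ y‖ + 1 :=
        fun i hi => (hV.self_of_nhds.1.continuousAt_iteratedFDeriv
          (by exact_mod_cast hi)).norm.eventually_lt_const (lt_add_one _)
      -- The summand 1 absorbs the variation of both derivatives near `y` and gives `1 ≤ D`, so that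
      -- D ≤ D² also covers the second derivative.
      refine ⟨‖iteratedFDeriv ℝ 1 τ y‖ + ‖iteratedFDeriv ℝ 2 τ y‖ + 1, ?_, ?_⟩
      · have := norm_nonneg (iteratedFDeriv ℝ 1 τ y)
        have := norm_nonneg (iteratedFDeriv ℝ 2 τ y)
        linarith
      · filter_upwards [hc 1 (by norm_num), hc 2 le_rfl] with u h1 h2 i hi1 hi2
        have n1 := norm_nonneg (iteratedFDeriv ℝ 1 τ y)
        have n2 := norm_nonneg (iteratedFDeriv ℝ 2 τ y)
        interval_cases i
        · rw [pow_one]; linarith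
        · nlinarith
    have hsmall : ∀ᶠ i in l, 2 * B i * D ^ 2 < ε := by
      have : Tendsto (fun i => 2 * B i * D ^ 2) l (𝓝 (2 * 0 * D ^ 2)) :=
        (hB.const_mul 2).mul_const _
      exact this.eventually_lt_const (by simpa using hε)
    refine ⟨_, mem_nhdsWithin_of_mem_nhds (hV.eventually_nhds.and hD), ?_⟩
    filter_upwards [hsmall] with i hi u hu
    have heq : (fun u => G i (e'.symm u)) =ᶠ[𝓝 u] (k i) ∘ τ := by
      filter_upwards [hu.1] with z hz
      rw [hG, chartLift_of_mem _ hz.2]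
      rfl
    rw [(Filter.EventuallyEq.iteratedFDeriv ℝ heq (n : ℕ)).eq_of_nhds]
    have hBi : 0 ≤ B i := (norm_nonneg _).trans (hbd i 0 (by norm_num) 0)
    refine lt_of_le_of_lt (norm_iteratedFDeriv_comp_le_of_eventually (hk i)
      (hu.1.mono fun z hz => hz.1) hn'
      (fun j hj => hbd i j (hj.trans hn) _)
      (fun j hj1 hj2 => hu.2 j hj1 (hj2.trans hn))) (lt_of_le_of_lt ?_ hi)
    have hfac : ((n : ℕ).factorial : ℝ) ≤ 2 := by
      exact_mod_cast (Nat.factorial_le hn)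
    exact mul_le_mul (mul_le_mul_of_nonneg_right hfac hBi) (pow_le_pow_right₀ hD1 hn)
      (by positivity) (by positivity)
  · have h1 := hcont.eventually (chartLift_eventually_eq_zero hK hKt hx)
    refine ⟨_, mem_nhdsWithin_of_mem_nhds h1.eventually_nhds, ?_⟩
    refine Eventually.of_forall fun i u hu => ?_
    have heq : (fun u => G i (e'.symm u)) =ᶠ[𝓝 u] fun _ => (0 : ℝ) := by
      filter_upwards [hu] with z hz
      rw [hG]
      exact hz _ (hs i)
    rw [(Filter.EventuallyEq.iteratedFDeriv ℝ heq (n : ℕ)).eq_of_nhds]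
    simpa using hε

end ChartLift

/-! ### Rescaled bump functions and their images under continuous linear maps -/

section Bumps

theorem exists_localized_linear {E : Type*} [NormedAddCommGroup E] [InnerProductSpace ℝ E]
    [FiniteDimensional ℝ E] (α : E →L[ℝ] ℝ) :
    ∃ h : E → ℝ, ContDiff ℝ 2 h ∧ (∀ y, ‖y‖ ≤ 1 / 2 → h y = α y) ∧
      support h ⊆ closedBall 0 1 ∧
      ∃ H : ℝ, 0 ≤ H ∧ ∀ j ≤ 2, ∀ y, ‖iteratedFDeriv ℝ j h y‖ ≤ H := by
  let χ : ContDiffBump (0 : E) := ⟨1 / 2, 1, by norm_num, by norm_num⟩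
  have hsm : ContDiff ℝ 2 fun y => χ y * α y := χ.contDiff.mul α.contDiff
  have hsupp : support (fun y => χ y * α y) ⊆ closedBall 0 1 := by
    intro y hy
    have h1 : y ∈ support χ := left_ne_zero_of_mul hy
    rw [χ.support_eq] at h1
    exact ball_subset_closedBall h1
  refine ⟨fun y => χ y * α y, hsm, fun y hy => ?_, hsupp, ?_⟩
  · have : χ y = 1 := χ.one_of_mem_closedBall (mem_closedBall_zero_iff.2 hy)
    simp [this]
  · have hcs : HasCompactSupport fun y => χ y * α y :=
      HasCompactSupport.of_support_subset_isCompact (isCompact_closedBall _ _) hsupp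
    have hb : ∀ j : ℕ, j ≤ 2 → ∃ H, ∀ y, ‖iteratedFDeriv ℝ j (fun y => χ y * α y) y‖ ≤ H :=
      fun j hj => (hsm.continuous_iteratedFDeriv (by exact_mod_cast hj)).bounded_above_of_compact_support
        (hcs.iteratedFDeriv j)
    obtain ⟨H0, h0⟩ := hb 0 (by norm_num)
    obtain ⟨H1, h1⟩ := hb 1 (by norm_num)
    obtain ⟨H2, h2⟩ := hb 2 le_rfl
    refine ⟨max H0 (max H1 H2), ((norm_nonneg _).trans (h0 0)).trans (le_max_left _ _), fun j hj y => ?_⟩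
    interval_cases j
    · exact (h0 y).trans (le_max_left _ _)
    · exact (h1 y).trans ((le_max_left _ _).trans (le_max_right _ _))
    · exact (h2 y).trans ((le_max_right _ _).trans (le_max_right _ _))


variable {q : ℕ} {M : Type*} [TopologicalSpace M] [ChartedSpace (EuclideanSpace ℝ (Fin q)) M]
  [IsManifold (𝓡 q) (⊤ : ℕ∞) M] [T2Space M]
  {F : Type*} [NormedAddCommGroup F] [NormedSpace ℝ F]

/-- Functions of size `ε`, supported in a ball of radius `ε` around `p` in the chart at `p`, with a
prescribed differential at `p`; continuous linear maps send them to functions whose second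
derivatives are `O(ε⁻¹)`. -/
theorem exists_scaled_bumps (p : M) (α : EuclideanSpace ℝ (Fin q) →L[ℝ] ℝ) :
    ∃ (r₀ H : ℝ) (ψ : ℝ → C2Map q M ℝ), 0 < r₀ ∧ 0 ≤ H ∧
      closedBall (chartAt (EuclideanSpace ℝ (Fin q)) p p) r₀ ⊆
        (chartAt (EuclideanSpace ℝ (Fin q)) p).target ∧
      (∀ ε ∈ Ioc 0 r₀, ∀ x, ψ ε x ≠ 0 → x ∈ (chartAt (EuclideanSpace ℝ (Fin q)) p).source ∧
        chartAt (EuclideanSpace ℝ (Fin q)) p x ∈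
          closedBall (chartAt (EuclideanSpace ℝ (Fin q)) p p) ε) ∧
      (∀ ε ∈ Ioc 0 r₀, ∀ x, ‖ψ ε x‖ ≤ ε * H) ∧
      (∀ ε ∈ Ioc 0 r₀, ∀ y, ‖y‖ ≤ 1 / 2 →
        ψ ε ((chartAt (EuclideanSpace ℝ (Fin q)) p).symm
          (chartAt (EuclideanSpace ℝ (Fin q)) p p + ε • y)) = ε * α y) ∧
      (∀ S : C2Map q M ℝ →ₗ[ℝ] C2Map q M F, Continuous S → ∀ K : Set (EuclideanSpace ℝ (Fin q)),
        IsCompact K → K ⊆ (chartAt (EuclideanSpace ℝ (Fin q)) p).target →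
        ∃ b : ℝ, 0 ≤ b ∧ ∀ ε ∈ Ioc 0 r₀, ∀ u ∈ K, ‖iteratedFDeriv ℝ 2
          (fun u => S (ψ ε) ((chartAt (EuclideanSpace ℝ (Fin q)) p).symm u)) u‖ ≤ b / ε) := by
  classical
  set e := chartAt (EuclideanSpace ℝ (Fin q)) p
  have he : e ∈ atlas (EuclideanSpace ℝ (Fin q)) M := chart_mem_atlas _ p
  have hp : p ∈ e.source := mem_chart_source _ p
  set u₀ := e p
  obtain ⟨h, hh, hlin, hsupp, H, hH, hbd⟩ := exists_localized_linear α
  obtain ⟨r, hr, hball⟩ := Metric.nhds_basis_closedBall.mem_iff.1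
    (e.open_target.mem_nhds (e.map_source hp))
  set r₀ := min r 1
  have hr₀ : 0 < r₀ := lt_min hr one_pos
  have hball₀ : closedBall u₀ r₀ ⊆ e.target :=
    (closedBall_subset_closedBall (min_le_left _ _)).trans hball
  -- The j-th derivative of the rescaled profile has size ε^(1-j): values O(ε), slope of order one,
  -- second derivative O(1/ε).
  set k : ℝ → EuclideanSpace ℝ (Fin q) → ℝ := fun ε u => ε * h (ε⁻¹ • (u - u₀)) with hk
  have hkc : ∀ ε, ContDiff ℝ 2 (k ε) := fun ε => contDiff_const.mul
    (hh.comp ((contDiff_id.sub contDiff_const).const_smul _))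
  have hks : ∀ ε, 0 < ε → support (k ε) ⊆ closedBall u₀ ε := by
    intro ε hε u hu
    have h1 : ε⁻¹ • (u - u₀) ∈ closedBall (0 : EuclideanSpace ℝ (Fin q)) 1 :=
      hsupp (right_ne_zero_of_mul hu)
    rw [mem_closedBall_zero_iff, norm_smul, norm_inv, Real.norm_of_nonneg hε.le,
      inv_mul_le_iff₀ hε, mul_one] at h1
    rwa [mem_closedBall, dist_eq_norm]
  have hψ : ∀ ε, ∃ ψ : C2Map q M ℝ, ε ∈ Ioc 0 r₀ → ∀ x, ψ x = chartLift e (k ε) x := by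
    intro ε
    by_cases hε : ε ∈ Ioc 0 r₀
    · exact ⟨⟨chartLift e (k ε), contMDiff_chartLift he (isCompact_closedBall u₀ r₀) hball₀ (hkc ε)
        ((hks ε hε.1).trans (closedBall_subset_closedBall hε.2))⟩, fun _ x => rfl⟩
    · exact ⟨0, fun h => (hε h).elim⟩
  choose ψ hψ using hψ
  refine ⟨r₀, H, ψ, hr₀, hH, hball₀, ?_, ?_, ?_, ?_⟩
  · intro ε hε x hx
    rw [hψ ε hε] at hx
    exact ⟨(chartLift_ne_zero hx).1, hks ε hε.1 (chartLift_ne_zero hx).2⟩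
  · intro ε hε x
    rw [hψ ε hε]
    by_cases hx : x ∈ e.source
    · rw [chartLift_of_mem _ hx, hk, norm_mul, Real.norm_of_nonneg hε.1.le]
      refine mul_le_mul_of_nonneg_left ?_ hε.1.le
      simpa using hbd 0 (by norm_num) (ε⁻¹ • (e x - u₀))
    · rw [chartLift, if_neg hx, norm_zero]
      exact mul_nonneg hε.1.le hH
  · intro ε hε y hy
    have h1 : u₀ + ε • y ∈ closedBall u₀ r₀ := by
      rw [mem_closedBall, dist_eq_norm, add_sub_cancel_left, norm_smul,
        Real.norm_of_nonneg hε.1.le]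
      nlinarith [hε.1, hε.2, norm_nonneg y]
    rw [hψ ε hε, chartLift_of_mem _ (e.map_target (hball₀ h1)), e.right_inv (hball₀ h1), hk]
    simp only [add_sub_cancel_left, smul_smul, inv_mul_cancel₀ hε.1.ne', one_smul, hlin y hy]
  · intro S hS K hK hKt
    -- One more factor ε offsets the second derivative, since ε² ε⁻ʲ ≤ 1 for j ≤ 2 and ε ≤ 1; this
    -- is why `r₀` is capped at 1.
    have hder : ∀ i : ℝ × Ioc 0 r₀, ∀ j ≤ 2, ∀ u,
        ‖iteratedFDeriv ℝ j (fun u => i.1 * i.2 * k i.2 u) u‖ ≤ |i.1| * H := by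
      rintro ⟨t, ε, hε⟩ j hj u
      have hj' : ((j : ℕ) : WithTop ℕ∞) ≤ 2 := by exact_mod_cast hj
      have h1 : (fun u => t * ε * k ε u) =
          fun u => (t * ε ^ 2) • (fun z => h (ε⁻¹ • z)) (u - u₀) := by
        funext u
        simp only [hk, smul_eq_mul]
        ring
      have hcd : ContDiff ℝ j fun z => h (ε⁻¹ • z) :=
        (hh.comp (contDiff_id.const_smul _)).of_le hj'
      simp only
      rw [h1, iteratedFDeriv_const_smul_apply' (f := fun u => (fun z => h (ε⁻¹ • z)) (u - u₀))
        ((hcd.comp (contDiff_id.sub contDiff_const)).contDiffAt),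
        iteratedFDeriv_comp_sub (f := fun z => h (ε⁻¹ • z)), iteratedFDeriv_comp_const_smul _ (hh.of_le hj'), norm_smul,
        norm_smul, norm_mul, Real.norm_eq_abs, mul_assoc, norm_pow, norm_pow, norm_inv,
        Real.norm_of_nonneg hε.1.le, ← mul_assoc (ε ^ 2)]
      refine mul_le_mul_of_nonneg_left ?_ (abs_nonneg t)
      have hε1 : ε ≤ 1 := hε.2.trans (min_le_right _ _)
      have h2 : ε ^ 2 * ε⁻¹ ^ j ≤ 1 := by
        have : ε ^ 2 = ε ^ (2 - j) * ε ^ j := by rw [← pow_add, Nat.sub_add_cancel hj]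
        rw [this, mul_assoc, ← mul_pow, mul_inv_cancel₀ hε.1.ne', one_pow, mul_one]
        exact pow_le_one₀ hε.1.le hε1
      calc _ ≤ 1 * H := mul_le_mul h2 (hbd j hj _) (norm_nonneg _) zero_le_one
        _ = H := one_mul H
    -- This filter expresses t → 0 uniformly in ε. Continuity of `S` at 0 then yields a single
    -- threshold `t₀`, and linearity turns it into the bound (2 / t₀) / ε.
    have hB : Tendsto (fun i : ℝ × Ioc 0 r₀ => |i.1| * H) (comap Prod.fst (𝓝 0)) (𝓝 0) := by
      have : Tendsto (fun t : ℝ => |t| * H) (𝓝 0) (𝓝 (|0| * H)) :=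
        Continuous.tendsto (by fun_prop) 0
      rw [abs_zero, zero_mul] at this
      exact this.comp tendsto_comap
    have hG := tendsto_zero_of_chartLift he (isCompact_closedBall u₀ r₀) hball₀
      (fun i : ℝ × Ioc 0 r₀ => contDiff_const.mul (hkc i.2))
      (fun i u hu => closedBall_subset_closedBall i.2.2.2 (hks i.2 i.2.2.1 (right_ne_zero_of_mul hu)))
      hB hder (G := fun i => (i.1 * (i.2 : ℝ)) • ψ i.2) (fun i x => by
        have h1 : ((i.1 * (i.2 : ℝ)) • ψ i.2) x = i.1 * i.2 * ψ i.2 x := rfl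
        rw [h1, hψ _ i.2.2]
        by_cases hx : x ∈ e.source
        · rw [chartLift_of_mem _ hx, chartLift_of_mem _ hx]
        · rw [chartLift, chartLift, if_neg hx, if_neg hx, mul_zero])
    have hSG : Tendsto (fun i : ℝ × Ioc 0 r₀ => S ((i.1 * (i.2 : ℝ)) • ψ i.2))
        (comap Prod.fst (𝓝 0)) (𝓝 0) := by
      have := (hS.tendsto 0).comp hG
      rwa [map_zero] at this
    have h1 := Metric.tendstoUniformlyOn_iff.1 (C2Map.tendsto_iff.1 hSG e he 2 K hK hKt) 1 one_pos
    obtain ⟨V, hV, hVs⟩ := mem_comap.1 h1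
    obtain ⟨t₀, ht₀, hVt⟩ := Metric.mem_nhds_iff.1 hV
    refine ⟨2 / t₀, by positivity, fun ε hε u hu => ?_⟩
    have h2 : ((t₀ / 2, ⟨ε, hε⟩) : ℝ × Ioc 0 r₀) ∈ Prod.fst ⁻¹' V := by
      refine hVt ?_
      rw [mem_ball_zero_iff, Real.norm_of_nonneg (by positivity)]
      linarith
    have h3 := hVs h2 u hu
    have h4 : iteratedFDeriv ℝ 2 (fun u => (0 : C2Map q M F) (e.symm u)) u = 0 := by
      have : (fun u => (0 : C2Map q M F) (e.symm u)) = fun _ => (0 : F) := rfl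
      rw [this]
      simp
    have h5 : iteratedFDeriv ℝ 2 (fun u => S ((t₀ / 2 * ε) • ψ ε) (e.symm u)) u =
        (t₀ / 2 * ε) • iteratedFDeriv ℝ 2 (fun u => S (ψ ε) (e.symm u)) u := by
      rw [map_smul]
      exact iteratedFDeriv_const_smul_apply ((S (ψ ε)).contDiffAt he (hKt hu))
    have h6 : dist (iteratedFDeriv ℝ 2 (fun u => (0 : C2Map q M F) (e.symm u)) u)
      (iteratedFDeriv ℝ 2 (fun u => S ((t₀ / 2 * ε) • ψ ε) (e.symm u)) u) < 1 := h3
    rw [h4, h5, dist_zero_left, norm_smul, Real.norm_of_nonneg (by have := hε.1; positivity)] at h6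
    have hε0 := hε.1
    rw [div_div, le_div_iff₀ (by positivity)]
    nlinarith

end Bumps

/-! ### Second order Taylor estimate -/

section Taylor

/-- The mean value inequality is used twice, for the derivative and then for the map minus its
linear part; this gives the constant b instead of the sharp b / 2. -/
theorem norm_sub_sub_fderiv_le {E F : Type*} [NormedAddCommGroup E] [NormedSpace ℝ E]
    [NormedAddCommGroup F] [NormedSpace ℝ F] {f : E → F} {u y : E} {r b : ℝ}
    (hf : ∀ x ∈ ball u r, ContDiffAt ℝ 2 f x)
    (hb : ∀ x ∈ ball u r, ‖iteratedFDeriv ℝ 2 f x‖ ≤ b) (hy : ‖y‖ < r) :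
    ‖f (u + y) - f u - fderiv ℝ f u y‖ ≤ b * ‖y‖ ^ 2 := by
  have hsub : closedBall u ‖y‖ ⊆ ball u r := closedBall_subset_ball hy
  have hu : u ∈ closedBall u ‖y‖ := mem_closedBall_self (norm_nonneg _)
  have hb0 : 0 ≤ b := (norm_nonneg _).trans (hb u (hsub hu))
  have h1 : ∀ x ∈ closedBall u ‖y‖, ‖fderiv ℝ f x - fderiv ℝ f u‖ ≤ b * ‖y‖ := by
    intro x hx
    have h2 := (convex_closedBall u ‖y‖).norm_image_sub_le_of_norm_fderiv_le (𝕜 := ℝ)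
      (f := fderiv ℝ f) (C := b)
      (fun z hz => ((hf z (hsub hz)).fderiv_right (m := 1) (by norm_num)).differentiableAt
        (by norm_num)) (fun z hz => by
          rw [← norm_iteratedFDeriv_one, norm_iteratedFDeriv_fderiv]
          exact hb z (hsub hz)) hu hx
    refine h2.trans (mul_le_mul_of_nonneg_left ?_ hb0)
    rwa [← dist_eq_norm]
  have h3 := (convex_closedBall u ‖y‖).norm_image_sub_le_of_norm_fderiv_le' (𝕜 := ℝ)
    (f := f) (φ := fderiv ℝ f u) (C := b * ‖y‖)
    (fun z hz => (hf z (hsub hz)).differentiableAt (by norm_num)) h1 hu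
    (show u + y ∈ closedBall u ‖y‖ by simp)
  rw [add_sub_cancel_left] at h3
  calc _ ≤ _ := h3
    _ = b * ‖y‖ ^ 2 := by ring

end Taylor

/-! ### Backward orbits and periodic points -/

section Orbits

variable {q : ℕ} {M : Type*} [TopologicalSpace M] [ChartedSpace (EuclideanSpace ℝ (Fin q)) M]
  {φ : Diffeomorph (𝓡 q) (𝓡 q) M M 2}

theorem iterate_symm_iterate (n : ℕ) (m : M) : φ.symm^[n] (φ^[n] m) = m :=
  (LeftInverse.iterate φ.symm_apply_apply n) m

theorem iterate_iterate_symm (n : ℕ) (m : M) : φ^[n] (φ.symm^[n] m) = m :=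
  (LeftInverse.iterate φ.apply_symm_apply n) m

theorem iterate_symm_mem_periodicPts {m : M} {n : ℕ} :
    φ.symm^[n] m ∈ periodicPts φ ↔ m ∈ periodicPts φ := by
  constructor
  · rintro ⟨k, hk, h⟩
    refine ⟨k, hk, ?_⟩
    have h1 := h.eq
    have h2 := congrArg (φ^[n]) h1
    rw [← iterate_add_apply, Nat.add_comm, iterate_add_apply, iterate_iterate_symm] at h2
    exact h2
  · rintro ⟨k, hk, h⟩
    refine ⟨k, hk, ?_⟩
    have h1 : φ^[n] (φ^[k] (φ.symm^[n] m)) = φ^[n] (φ.symm^[n] m) := by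
      rw [← iterate_add_apply, Nat.add_comm, iterate_add_apply, iterate_iterate_symm]
      exact h
    exact φ.injective.iterate n h1

theorem iterate_symm_injective_of_notMem {m : M} (hm : m ∉ periodicPts φ) :
    Injective fun n : ℕ => φ.symm^[n] m := by
  have key : ∀ a k : ℕ, φ.symm^[a] m = φ.symm^[a + (k + 1)] m → False := by
    intro a k h
    rw [iterate_add_apply] at h
    have h1 := φ.symm.injective.iterate a h
    refine hm ⟨k + 1, Nat.succ_pos k, ?_⟩
    have h2 := congrArg (φ^[k + 1]) h1
    rw [iterate_iterate_symm] at h2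
    exact h2
  intro a b hab
  rcases lt_trichotomy a b with h | h | h
  · obtain ⟨k, rfl⟩ := Nat.exists_eq_add_of_lt h
    exact (key a k hab).elim
  · exact h
  · obtain ⟨k, rfl⟩ := Nat.exists_eq_add_of_lt h
    exact (key b k hab.symm).elim

/-- For a function supported in such a `U` and a point of `U`, only the term j = 0 survives among
the first n terms of the series. -/
theorem exists_nhds_forall_iterate_symm_notMem [T2Space M] {p : M} (hp : p ∉ periodicPts φ)
    (n : ℕ) : ∃ U ∈ 𝓝 p, ∀ x ∈ U, ∀ j, 1 ≤ j → j < n → φ.symm^[j] x ∉ U := by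
  have h1 : ∀ j ∈ Finset.Ico 1 n, ∀ᶠ z : M × M in 𝓝 (p, p), φ.symm^[j] z.1 ≠ z.2 := by
    intro j hj
    have hne : φ.symm^[j] p ≠ p := fun h => by
      have := iterate_symm_injective_of_notMem hp (a₁ := j) (a₂ := 0) h
      have := (Finset.mem_Ico.1 hj).1
      omega
    exact (isOpen_ne_fun ((φ.symm.continuous.iterate j).comp continuous_fst)
      continuous_snd).mem_nhds hne
  have h2 := (Finset.eventually_all (Finset.Ico 1 n)).2 h1
  rw [nhds_prod_eq] at h2
  obtain ⟨U, hU, hUU⟩ := mem_prod_same_iff.1 h2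
  exact ⟨U, hU, fun x hx j hj1 hj2 hjU =>
    hUU (mk_mem_prod hx hjU) j (Finset.mem_Ico.2 ⟨hj1, hj2⟩) rfl⟩

end Orbits

/-- The powers T^(kl) x all equal x, while summability sends them to 0. -/
theorem eq_zero_of_pow_apply_eq {F : Type*} [NormedAddCommGroup F] [NormedSpace ℝ F]
    {T : F →L[ℝ] F} {x : F} (hx : Summable fun j => ‖(T ^ j) x‖) {k : ℕ} (hk : 0 < k)
    (h : (T ^ k) x = x) : x = 0 := by
  have h1 : ∀ l : ℕ, (T ^ (k * l)) x = x := by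
    intro l
    induction l with
    | zero => simp
    | succ l ih => rw [Nat.mul_succ, pow_add, mul_apply_eq_comp, h, ih]
  have h2 : Tendsto (fun l : ℕ => ‖(T ^ (k * l)) x‖) atTop (𝓝 0) :=
    hx.tendsto_atTop_zero.comp (tendsto_id.const_mul_atTop' hk)
  simp only [h1] at h2
  exact norm_eq_zero.1 (tendsto_nhds_unique tendsto_const_nhds h2)

/-! ### Prescribing values and differentials of synchronizations -/

section Jets

section

variable {q : ℕ} {M : Type*} [TopologicalSpace M] [ChartedSpace (EuclideanSpace ℝ (Fin q)) M]
  {F : Type*} [NormedAddCommGroup F] [NormedSpace ℝ F]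

theorem tderiv_eq_fderiv (g : C2Map q M F) (m : M) :
    tderiv g m = fderiv ℝ (fun u => g ((chartAt (EuclideanSpace ℝ (Fin q)) m).symm u))
      (chartAt (EuclideanSpace ℝ (Fin q)) m m) :=
  mfderiv_eq_fderiv_chartAt (g.mdifferentiableAt m)

theorem tderiv_congr {g h : M → F} {m : M} (hgh : g =ᶠ[𝓝 m] h) :
    tderiv (q := q) g m = tderiv h m :=
  hgh.mfderiv_eq

theorem tderiv_zero (m : M) : tderiv (q := q) (fun _ : M => (0 : F)) m = 0 :=
  mfderiv_const

theorem tderiv_eq_zero {g : M → F} {m : M} (hg : ∀ᶠ x in 𝓝 m, g x = 0) :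
    tderiv (q := q) g m = 0 :=
  (tderiv_congr hg).trans (tderiv_zero m)

theorem tderiv_add (g h : C2Map q M F) (m : M) :
    tderiv (q := q) (g + h : C2Map q M F) m = tderiv g m + tderiv h m :=
  ((g.mdifferentiableAt m).hasMFDerivAt.add (h.mdifferentiableAt m).hasMFDerivAt).mfderiv

theorem tderiv_smul (r : ℝ) (g : C2Map q M F) (m : M) :
    tderiv (q := q) (r • g : C2Map q M F) m = r • tderiv g m :=
  ((g.mdifferentiableAt m).hasMFDerivAt.const_smul r).mfderiv

end

variable {q : ℕ} {M : Type*} [TopologicalSpace M] [ChartedSpace (EuclideanSpace ℝ (Fin q)) M]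
  [IsManifold (𝓡 q) (⊤ : ℕ∞) M] [T2Space M]
  {F : Type*} [NormedAddCommGroup F] [NormedSpace ℝ F] [CompleteSpace F]
  {T : F →L[ℝ] F} {c : F} {φ : Diffeomorph (𝓡 q) (𝓡 q) M M 2}
  {S : C2Map q M ℝ →ₗ[ℝ] C2Map q M F}

/-- At a nonperiodic point `p`, the differential of the synchronization of a suitable concentrated
function `ψ` is as close as one wants to `c ⊗ dψ`: the sup norm of the remaining terms is small
compared with the size of `ψ`, their second derivative is controlled by continuity in the `C²`
topology, and the first derivative is controlled by interpolation. -/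
theorem exists_norm_tderiv_sub_le (hS : Continuous S) (hc : Summable fun j => ‖(T ^ j) c‖)
    (hsync : ∀ w m, S w m = sync T c φ w m) {p : M} (hp : p ∉ periodicPts φ)
    (α : EuclideanSpace ℝ (Fin q) →L[ℝ] ℝ) (w : EuclideanSpace ℝ (Fin q)) {V : Set M}
    (hV : V ∈ 𝓝 p) {δ : ℝ} (hδ : 0 < δ) :
    ∃ ψ : C2Map q M ℝ, (∀ x, x ∉ V → ψ x = 0) ∧ ‖tderiv (S ψ) p w - α w • c‖ ≤ δ := by
  obtain ⟨r₀, H, ψ, hr₀, hH, hball, hsupp, hsup, hlin, hSbd⟩ :=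
    exists_scaled_bumps (F := F) p α
  set e := chartAt (EuclideanSpace ℝ (Fin q)) p with he
  have hp' : p ∈ e.source := mem_chart_source _ p
  set u₀ := e p with hu₀
  obtain ⟨b, hb0, hb⟩ := hSbd S hS (closedBall u₀ r₀) (isCompact_closedBall _ _) hball
  -- The constants are fixed in the order s, n, ε. The first bound keeps s w where the profile is
  -- linear; the second makes the Taylor remainder, after division by ε, at most s δ / 2.
  set s : ℝ := min (1 / (2 * (‖w‖ + 1))) (δ / (2 * (b * ‖w‖ ^ 2 + 1))) with hs
  have hs0 : 0 < s := lt_min (by positivity) (by positivity)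
  have hsw : ‖s • w‖ ≤ 1 / 2 := by
    rw [norm_smul, Real.norm_of_nonneg hs0.le]
    have h1 : s ≤ 1 / (2 * (‖w‖ + 1)) := min_le_left _ _
    rw [le_div_iff₀ (by positivity)] at h1
    nlinarith [norm_nonneg w]
  have hsb : b * s ^ 2 * ‖w‖ ^ 2 ≤ s * (δ / 2) := by
    have h1 : s ≤ δ / (2 * (b * ‖w‖ ^ 2 + 1)) := min_le_right _ _
    rw [le_div_iff₀ (by positivity)] at h1
    nlinarith
  -- The factor 2 accounts for tail errors at `p` and at the displaced point. The neighbourhood `U`,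
  -- hence ε, depends on this n.
  obtain ⟨n, hn, hn1⟩ : ∃ n : ℕ, 2 * H * ∑' j, ‖(T ^ (j + n)) c‖ < s * (δ / 2) ∧ 1 ≤ n := by
    have h1 : Tendsto (fun n => 2 * H * ∑' j, ‖(T ^ (j + n)) c‖) atTop (𝓝 (2 * H * 0)) :=
      (tendsto_sum_nat_add fun j => ‖(T ^ j) c‖).const_mul _
    have h2 : 2 * H * 0 < s * (δ / 2) := by rw [mul_zero]; positivity
    exact ((h1.eventually_lt_const h2).and (eventually_ge_atTop 1)).exists
  obtain ⟨U, hU, hUn⟩ := exists_nhds_forall_iterate_symm_notMem hp n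
  have hpre : e.symm ⁻¹' (U ∩ V) ∈ 𝓝 u₀ :=
    (e.continuousAt_symm (e.map_source hp')).preimage_mem_nhds
      (by rw [e.left_inv hp']; exact Filter.inter_mem hU hV)
  obtain ⟨r, hr, hrU⟩ := Metric.nhds_basis_closedBall.mem_iff.1 hpre
  set ε := min r r₀ with hε
  have hε0 : 0 < ε := lt_min hr hr₀
  have hεI : ε ∈ Ioc 0 r₀ := ⟨hε0, min_le_right _ _⟩
  have hεU : closedBall u₀ ε ⊆ e.symm ⁻¹' (U ∩ V) :=
    (closedBall_subset_closedBall (min_le_left _ _)).trans hrU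
  have hεr : closedBall u₀ ε ⊆ closedBall u₀ r₀ := closedBall_subset_closedBall (min_le_right _ _)
  have hsuppU : ∀ x, ψ ε x ≠ 0 → x ∈ U ∩ V := fun x hx => by
    obtain ⟨h1, h2⟩ := hsupp ε hεI x hx
    have h3 := hεU h2
    rwa [mem_preimage, e.left_inv h1] at h3
  refine ⟨ψ ε, fun x hx => by_contra fun h => hx (hsuppU x h).2, ?_⟩
  have htail : ∀ x ∈ U, ‖S (ψ ε) x - ψ ε x • c‖ ≤ ε * H * ∑' j, ‖(T ^ (j + n)) c‖ := by
    intro x hx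
    have h1 := norm_sync_le_tail (φ := φ) hc (hsup ε hεI) n x
    rw [Finset.sum_eq_single_of_mem 0 (Finset.mem_range.2 hn1)] at h1
    · rw [hsync]
      simpa using h1
    · intro j hj hj0
      have h2 : ψ ε (φ.symm^[j] x) = 0 := by
        by_contra h
        exact hUn x hx j (Nat.one_le_iff_ne_zero.2 hj0) (Finset.mem_range.1 hj) (hsuppU _ h).1
      rw [h2, zero_smul]
  set y := ε • s • w with hy
  have hynorm : ‖y‖ ≤ ε * (1 / 2) := by
    rw [hy, norm_smul, Real.norm_of_nonneg hε0.le]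
    exact mul_le_mul_of_nonneg_left hsw hε0.le
  have hyε : ‖y‖ < ε := by linarith
  have hpU : p ∈ U := mem_of_mem_nhds hU
  have hxU : e.symm (u₀ + y) ∈ U := (hεU (by
    rw [mem_closedBall, dist_eq_norm, add_sub_cancel_left]; exact hyε.le)).1
  have hψ1 : ψ ε (e.symm (u₀ + y)) = ε * (s * α w) := by
    rw [hy, hlin ε hεI _ hsw, map_smul, smul_eq_mul]
  have hψ0 : ψ ε p = 0 := by
    have := hlin ε hεI 0 (by simp)
    rwa [smul_zero, add_zero, map_zero, mul_zero, hu₀, e.left_inv hp'] at this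
  have ht1 := htail _ hxU
  have ht0 := htail _ hpU
  rw [hψ1] at ht1
  rw [hψ0, zero_smul, sub_zero] at ht0
  have htay := norm_sub_sub_fderiv_le (f := fun u => S (ψ ε) (e.symm u)) (u := u₀) (y := y)
    (r := ε) (b := b / ε)
    (fun x hx => (S (ψ ε)).contDiffAt (chart_mem_atlas _ p)
      (hball (hεr (ball_subset_closedBall hx))))
    (fun x hx => hb ε hεI x (hεr (ball_subset_closedBall hx))) hyε
  rw [← tderiv_eq_fderiv (S (ψ ε)) p] at htay
  simp only [hu₀, e.left_inv hp'] at htay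
  rw [← hu₀] at htay
  -- An increment of Sψ along y = ε s w minus its Taylor remainder. Both the left side and the error
  -- bounds carry a factor ε, which cancels.
  have hsplit : (ε * s) • (tderiv (S (ψ ε)) p w - α w • c) =
      (S (ψ ε) (e.symm (u₀ + y)) - (ε * (s * α w)) • c) - S (ψ ε) p -
      (S (ψ ε) (e.symm (u₀ + y)) - S (ψ ε) p - tderiv (S (ψ ε)) p y) := by
    have h1 : tderiv (S (ψ ε)) p y = (ε * s) • tderiv (S (ψ ε)) p w := by
      rw [hy, map_smul, map_smul, smul_smul]
    rw [h1]
    module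
  have hnorm : ε * s * ‖tderiv (S (ψ ε)) p w - α w • c‖ ≤ ε * s * δ := by
    calc ε * s * ‖tderiv (S (ψ ε)) p w - α w • c‖
        = ‖(ε * s) • (tderiv (S (ψ ε)) p w - α w • c)‖ := by
          rw [norm_smul, Real.norm_of_nonneg (by positivity)]
      _ ≤ ε * H * ∑' j, ‖(T ^ (j + n)) c‖ + ε * H * ∑' j, ‖(T ^ (j + n)) c‖ +
          b / ε * ‖y‖ ^ 2 := by
          rw [hsplit]
          exact (norm_sub_le _ _).trans (add_le_add ((norm_sub_le _ _).trans (add_le_add ht1 ht0))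
            htay)
      _ = ε * (2 * H * ∑' j, ‖(T ^ (j + n)) c‖) + ε * (b * s ^ 2 * ‖w‖ ^ 2) := by
          rw [hy, norm_smul, norm_smul, Real.norm_of_nonneg hε0.le, Real.norm_of_nonneg hs0.le]
          have := hε0.ne'
          field_simp
          ring
      _ ≤ ε * (s * (δ / 2)) + ε * (s * (δ / 2)) :=
          add_le_add (mul_le_mul_of_nonneg_left hn.le hε0.le)
            (mul_le_mul_of_nonneg_left hsb hε0.le)
      _ = ε * s * δ := by ring
  exact le_of_mul_le_mul_left hnorm (by positivity)


variable [CompactSpace M]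

/-- With ψ concentrated at φ⁻ⁱ(m) and vanishing near the earlier orbit points, the cocycle identity
turns an approximation of c there into one of Tⁱ c at m. Approximation suffices because the range is
closed. -/
theorem exists_tderiv_eq [FiniteDimensional ℝ F] (hS : Continuous S)
    (hc : Summable fun j => ‖(T ^ j) c‖)
    (hspan : Submodule.span ℝ (range fun j : ℕ => (T ^ j) c) = ⊤)
    (hsync : ∀ w m, S w m = sync T c φ w m) {m : M} (hm : m ∉ periodicPts φ)
    {v : EuclideanSpace ℝ (Fin q)} (hv : v ≠ 0) (y : F) :
    ∃ ψ : C2Map q M ℝ, tderiv (S ψ) m v = y := by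
  let L : C2Map q M ℝ →ₗ[ℝ] F :=
    { toFun := fun ψ => tderiv (S ψ) m v
      map_add' := fun a b => by rw [map_add, tderiv_add]; rfl
      map_smul' := fun r a => by rw [map_smul, tderiv_smul]; rfl }
  suffices h : LinearMap.range L = ⊤ from LinearMap.range_eq_top.1 h y
  rw [eq_top_iff, ← hspan, Submodule.span_le]
  rintro _ ⟨i, rfl⟩
  have hclosed : IsClosed (LinearMap.range L : Set F) := Submodule.closed_of_finiteDimensional _
  rw [← hclosed.closure_eq, Metric.mem_closure_iff]
  intro η hη
  set p := φ.symm^[i] m with hp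
  set w := tmap (φ.symm^[i]) m v with hw
  have hw0 : w ≠ 0 := fun h => hv (tmap_iterate_injective φ.symm i m (h.trans (map_zero _).symm))
  have hpn : p ∉ periodicPts φ := fun h => hm (iterate_symm_mem_periodicPts.1 h)
  set α : EuclideanSpace ℝ (Fin q) →L[ℝ] ℝ := (‖w‖ ^ 2)⁻¹ • innerSL ℝ w
  have hα : α w = 1 := by
    simp [α, hw0]
  have hV : {x : M | ∀ j ∈ Finset.range i, x ≠ φ.symm^[j] m} ∈ 𝓝 p := by
    refine (Finset.eventually_all (Finset.range i)).2 fun j hj => ?_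
    refine isOpen_ne.mem_nhds fun h => ?_
    have := iterate_symm_injective_of_notMem hm (a₁ := i) (a₂ := j) h
    have := Finset.mem_range.1 hj
    omega
  obtain ⟨V, hVp, hVc, hVs⟩ := exists_mem_nhds_isClosed_subset hV
  obtain ⟨ψ, hψ, hψd⟩ := exists_norm_tderiv_sub_le hS hc hsync hpn α w hVp
    (δ := η / (2 * (‖T ^ i‖ + 1))) (by positivity)
  refine ⟨_, ⟨ψ, rfl⟩, ?_⟩
  have h1 : tderiv (S ψ) m v = (T ^ i) (tderiv (S ψ) p w) := by
    have h2 := tderiv_eq_sum_of_cocycle (T := T) (c := c) (φ := φ) (f := S ψ)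
      (fun x => (S ψ).mdifferentiableAt x) ψ
      (fun x => by rw [hsync, hsync]; exact sync_eq hc ψ x) i m v
    rw [h2, Finset.sum_eq_zero, zero_add]
    intro j hj
    have h3 : tderiv (q := q) ψ (φ.symm^[j] m) = 0 := by
      refine tderiv_eq_zero ?_
      filter_upwards [hVc.isOpen_compl.mem_nhds (show φ.symm^[j] m ∈ Vᶜ from
        fun h => hVs h j hj rfl)] with x hx
      exact hψ x hx
    rw [h3]
    simp
  have h4 : L ψ = (T ^ i) (tderiv (S ψ) p w) := h1
  rw [h4, dist_comm, dist_eq_norm, ← map_sub]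
  rw [hα, one_smul] at hψd
  calc ‖(T ^ i) (tderiv (S ψ) p w - c)‖ ≤ ‖T ^ i‖ * (η / (2 * (‖T ^ i‖ + 1))) :=
        (T ^ i).le_opNorm_of_le hψd
    _ < η := by
        rw [mul_div_assoc', div_lt_iff₀ (by positivity)]
        nlinarith [norm_nonneg (T ^ i)]

theorem exists_eq_one_eq_zero {p : M} {Z : Set M} (hZ : Z.Finite) (hp : p ∉ Z) :
    ∃ ψ : C2Map q M ℝ, ψ p = 1 ∧ (∀ z ∈ Z, ψ z = 0) ∧ ∀ x, ‖ψ x‖ ≤ 1 := by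
  obtain ⟨f, h0, h1, h2⟩ := exists_contMDiffMap_zero_one_of_isClosed (𝓡 q) (n := 2)
    hZ.isClosed (isClosed_singleton (x := p)) (disjoint_singleton_right.2 hp)
  refine ⟨f, h1 rfl, fun z hz => h0 hz, fun x => ?_⟩
  rw [Real.norm_of_nonneg (h2 x).1]
  exact (h2 x).2

/-- A function equal to 1 at φ⁻ⁱ(m) can vanish at φ⁻ʲ(m') for i ≤ j < n, as m' is not on the forward
orbit of m. For j < i these points may coincide with φ⁻ⁱ(m), but they only contribute multiples of
Tʲ c, which the strong induction on i already places in the range. -/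
theorem exists_sync_sub_eq [FiniteDimensional ℝ F] (hc : Summable fun j => ‖(T ^ j) c‖)
    (hspan : Submodule.span ℝ (range fun j : ℕ => (T ^ j) c) = ⊤)
    (hsync : ∀ w m, S w m = sync T c φ w m) {m m' : M} (hm : m ∉ periodicPts φ)
    (hmm' : ∀ k, φ^[k] m ≠ m') (y : F) :
    ∃ ψ : C2Map q M ℝ, S ψ m - S ψ m' = y := by
  let L : C2Map q M ℝ →ₗ[ℝ] F :=
    { toFun := fun ψ => S ψ m - S ψ m'
      map_add' := fun a b => by
        rw [map_add]
        exact add_sub_add_comm _ _ _ _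
      map_smul' := fun r a => by
        rw [map_smul]
        exact (smul_sub _ _ _).symm }
  suffices h : LinearMap.range L = ⊤ from LinearMap.range_eq_top.1 h y
  rw [eq_top_iff, ← hspan, Submodule.span_le]
  rintro _ ⟨i, rfl⟩
  have hclosed : IsClosed (LinearMap.range L : Set F) := Submodule.closed_of_finiteDimensional _
  induction i using Nat.strong_induction_on with
  | _ i ih =>
  rw [← hclosed.closure_eq, Metric.mem_closure_iff]
  intro η hη
  obtain ⟨n, hn, hni⟩ : ∃ n : ℕ, 2 * ∑' j, ‖(T ^ (j + n)) c‖ < η ∧ i + 1 ≤ n := by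
    have h1 : Tendsto (fun n => 2 * ∑' j, ‖(T ^ (j + n)) c‖) atTop (𝓝 (2 * 0)) :=
      (tendsto_sum_nat_add fun j => ‖(T ^ j) c‖).const_mul _
    exact ((h1.eventually_lt_const (by simpa using hη)).and (eventually_ge_atTop _)).exists
  set Z : Set M := (fun j => φ.symm^[j] m) '' (Finset.range n \ {i} : Set ℕ) ∪
    (fun j => φ.symm^[j] m') '' (Finset.Ico i n : Set ℕ)
  have hZ : Z.Finite := ((Finset.finite_toSet _).sdiff.image _).union
    ((Finset.finite_toSet _).image _)
  have hpZ : φ.symm^[i] m ∉ Z := by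
    rintro (⟨j, hj, h⟩ | ⟨j, hj, h⟩)
    · exact hj.2 (iterate_symm_injective_of_notMem hm h)
    · have hij : i ≤ j := (Finset.mem_Ico.1 hj).1
      refine hmm' (j - i) ?_
      have h1 := congrArg (φ^[j]) h
      simp only [iterate_iterate_symm] at h1
      rw [h1]
      conv_rhs => rw [← Nat.sub_add_cancel hij]
      rw [iterate_add_apply, iterate_iterate_symm]
  obtain ⟨ψ, hψ1, hψ0, hψb⟩ := exists_eq_one_eq_zero (q := q) hZ hpZ
  have t1 := norm_sync_le_tail (φ := φ) hc hψb n m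
  have t2 := norm_sync_le_tail (φ := φ) hc hψb n m'
  rw [Finset.sum_eq_single_of_mem i (Finset.mem_range.2 hni) (fun j hj hji => by
    rw [hψ0 _ (Or.inl ⟨j, ⟨hj, hji⟩, rfl⟩), zero_smul]), hψ1, one_smul, ← hsync] at t1
  rw [← hsync] at t2
  have hR : ∑ j ∈ Finset.range n, ψ (φ.symm^[j] m') • (T ^ j) c ∈ LinearMap.range L := by
    refine Submodule.sum_mem _ fun j hj => ?_
    by_cases hji : j < i
    · exact Submodule.smul_mem _ _ (ih j hji)
    · rw [hψ0 _ (Or.inr ⟨j, Finset.mem_coe.2 (Finset.mem_Ico.2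
        ⟨not_lt.1 hji, Finset.mem_range.1 hj⟩), rfl⟩), zero_smul]
      exact Submodule.zero_mem _
  refine ⟨_, Submodule.add_mem _ (LinearMap.mem_range_self L ψ) hR, ?_⟩
  have hL : L ψ = S ψ m - S ψ m' := rfl
  rw [hL, dist_comm, dist_eq_norm]
  rw [one_mul] at t1 t2
  calc _ = ‖(S ψ m - (T ^ i) c) -
        (S ψ m' - ∑ j ∈ Finset.range n, ψ (φ.symm^[j] m') • (T ^ j) c)‖ := by congr 1; abel
    _ ≤ _ := norm_sub_le _ _
    _ ≤ _ := add_le_add t1 t2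
    _ < η := by linarith

theorem exists_sync_ne (hT : ∀ x, Summable fun j => ‖(T ^ j) x‖) (hc0 : c ≠ 0)
    (hsync : ∀ w m, S w m = sync T c φ w m) (hfin : (periodicPts φ).Finite)
    {m m' : M} (hm : m ∈ periodicPts φ) (hm' : m' ∈ periodicPts φ) (hne : m ≠ m') :
    ∃ ψ : C2Map q M ℝ, S ψ m ≠ S ψ m' := by
  obtain ⟨ψ, hψ1, hψ0, hψb⟩ := exists_eq_one_eq_zero (q := q) (p := m) (hfin.sdiff (t := {m}))
    (fun h => h.2 rfl)
  have hzero : ∀ x ∈ periodicPts φ, x ≠ m → ψ x = 0 := fun x hx hxm => hψ0 x ⟨hx, hxm⟩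
  refine ⟨ψ, fun heq => ?_⟩
  rw [hsync, hsync] at heq
  obtain ⟨n, hn, hpn⟩ := hm
  have hret : ∃ k, 0 < k ∧ φ.symm^[k] m = m := by
    refine ⟨n, hn, ?_⟩
    have := congrArg (φ.symm^[n]) hpn.eq
    rw [iterate_symm_iterate] at this
    exact this.symm
  -- For the first return time k the value x at m satisfies x = c + Tᵏ x, so x = 0 would give c = 0.
  have hx0 : sync T c φ ψ m ≠ 0 := by
    classical
    intro h0
    have hk := Nat.find_spec hret
    have hmin := fun j => Nat.find_min hret (m := j)
    set k := Nat.find hret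
    have h1 := sync_eq_sum (T := T) (φ := φ) (hT c) ψ k m
    rw [hk.2, h0, map_zero, add_zero, Finset.sum_eq_single_of_mem 0 (Finset.mem_range.2 hk.1)] at h1
    · simp only [iterate_zero, id, hψ1, pow_zero, one_smul] at h1
      exact hc0 h1.symm
    · intro j hj hj0
      rw [hzero _ (iterate_symm_mem_periodicPts.2 ⟨n, hn, hpn⟩), zero_smul]
      exact fun h => hmin j (Finset.mem_range.1 hj) ⟨Nat.pos_of_ne_zero hj0, h⟩
  -- If the backward orbit of m' first meets m after k steps, its value is Tᵏ x, and equality would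
  -- make x a fixed vector of Tᵏ. Otherwise every term at m' vanishes.
  by_cases hex : ∃ k, φ.symm^[k] m' = m
  · classical
    have hk := Nat.find_spec hex
    have hmin := fun j => Nat.find_min hex (m := j)
    set k := Nat.find hex
    have hk0 : 0 < k := by
      refine Nat.pos_of_ne_zero fun h => hne ?_
      rw [h] at hk
      exact hk.symm
    have h1 := sync_eq_sum (T := T) (φ := φ) (hT c) ψ k m'
    rw [hk, Finset.sum_eq_zero, zero_add, ← heq] at h1
    · exact hx0 (eq_zero_of_pow_apply_eq (hT _) hk0 h1.symm)
    · intro j hj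
      rw [hzero _ (iterate_symm_mem_periodicPts.2 hm') (hmin j (Finset.mem_range.1 hj)), zero_smul]
  · push Not at hex
    refine hx0 (heq.trans ?_)
    have : ∀ j : ℕ, ψ (φ.symm^[j] m') • (T ^ j) c = 0 := fun j => by
      rw [hzero _ (iterate_symm_mem_periodicPts.2 hm') (hex j), zero_smul]
    rw [sync, tsum_congr this, tsum_zero]

end Jets

/-! ### Complexification and injectivity through resolvent vectors -/

section LinearAlgebra

open scoped TensorProduct

theorem injective_of_linearIndependent_comp {K V W ι : Type*} [Field K] [AddCommGroup V]
    [Module K V] [AddCommGroup W] [Module K W] (f : V →ₗ[K] W) {v : ι → V}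
    (hv : Submodule.span K (range v) = ⊤) (h : LinearIndependent K (f ∘ v)) : Injective f := by
  refine (injective_iff_map_eq_zero _).2 fun x hx => ?_
  have hmem : x ∈ Submodule.span K (range v) := hv ▸ Submodule.mem_top
  rw [← Finsupp.range_linearCombination] at hmem
  obtain ⟨l, rfl⟩ := hmem
  rw [Finsupp.apply_linearCombination] at hx
  rw [linearIndependent_iff.1 h l hx, map_zero]

variable {E : Type*} [AddCommGroup E] [Module ℝ E]

/-- The complexification of a real linear functional. -/
def complexify (α : E →ₗ[ℝ] ℝ) : ℂ ⊗[ℝ] E →ₗ[ℂ] ℂ :=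
  LinearMap.liftBaseChange ℂ (Complex.ofRealCLM.toLinearMap ∘ₗ α)

@[simp]
theorem complexify_tmul (α : E →ₗ[ℝ] ℝ) (a : ℂ) (x : E) :
    complexify α (a ⊗ₜ[ℝ] x) = a * (α x : ℂ) := by
  simp [complexify]

theorem complexify_add (α β : E →ₗ[ℝ] ℝ) (z : ℂ ⊗[ℝ] E) :
    complexify (α + β) z = complexify α z + complexify β z := by
  induction z using TensorProduct.induction_on with
  | zero => simp
  | tmul a x => simp [mul_add]
  | add x y hx hy => rw [map_add, hx, hy, map_add, map_add]; ring

theorem complexify_smul (r : ℝ) (α : E →ₗ[ℝ] ℝ) (z : ℂ ⊗[ℝ] E) :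
    complexify (r • α) z = r * complexify α z := by
  induction z using TensorProduct.induction_on with
  | zero => simp
  | tmul a x => simp; ring
  | add x y hx hy => rw [map_add, hx, hy, map_add]; ring

theorem exists_complexify_ne_zero [FiniteDimensional ℝ E] {z : ℂ ⊗[ℝ] E} (hz : z ≠ 0) :
    ∃ α : E →ₗ[ℝ] ℝ, complexify α z ≠ 0 := by
  by_contra! h
  refine hz ?_
  let b := Module.finBasis ℝ E
  have key : ∀ z : ℂ ⊗[ℝ] E, z = ∑ i, complexify (b.coord i) z ⊗ₜ[ℝ] b i := by
    intro z
    induction z using TensorProduct.induction_on with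
    | zero => simp
    | tmul a x =>
      conv_lhs => rw [← b.sum_repr x, TensorProduct.tmul_sum]
      refine Finset.sum_congr rfl fun i _ => ?_
      rw [complexify_tmul, ← TensorProduct.smul_tmul]
      congr 1
      rw [Complex.real_smul, mul_comm]
      rfl
    | add x y hx hy =>
      conv_lhs => rw [hx, hy]
      simp only [map_add, TensorProduct.add_tmul, Finset.sum_add_distrib]
  rw [key z]
  simp [h]

/-- A real vector space is not a finite union of proper subspaces. The functional has to be real
because it becomes the differential of a real observation map, although the eigenvectors are
complex. -/
theorem exists_forall_complexify_ne_zero [FiniteDimensional ℝ E] {ι : Type*} [Finite ι]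
    {z : ι → ℂ ⊗[ℝ] E} (hz : ∀ i, z i ≠ 0) :
    ∃ α : E →ₗ[ℝ] ℝ, ∀ i, complexify α (z i) ≠ 0 := by
  by_contra! h
  let p : ι → Subspace ℝ (E →ₗ[ℝ] ℝ) := fun i =>
    { carrier := {α | complexify α (z i) = 0}
      add_mem' := fun {a b} ha hb => by
        have ha' : complexify a (z i) = 0 := ha
        have hb' : complexify b (z i) = 0 := hb
        change complexify (a + b) (z i) = 0
        rw [complexify_add, ha', hb', add_zero]
      zero_mem' := by
        change complexify (0 : E →ₗ[ℝ] ℝ) (z i) = 0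
        have := complexify_smul (0 : ℝ) (0 : E →ₗ[ℝ] ℝ) (z i)
        simpa using this
      smul_mem' := fun r a ha => by
        have ha' : complexify a (z i) = 0 := ha
        change complexify (r • a) (z i) = 0
        rw [complexify_smul, ha', mul_zero] }
  obtain ⟨i, hi⟩ := Subspace.exists_eq_top_of_iUnion_eq_univ (p := p)
    (eq_univ_of_forall fun α => by
      obtain ⟨i, hi⟩ := h α
      exact mem_iUnion.2 ⟨i, hi⟩)
  obtain ⟨α, hα⟩ := exists_complexify_ne_zero (hz i)
  have : α ∈ p i := hi ▸ Submodule.mem_top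
  exact hα this

variable {N : ℕ}

/-- A real linear map `D` with `D v = α v • ∑_{j < n} Aʲ C + Aⁿ D (B v)` is injective when the
vectors `(1 - λ Aⁿ)⁻¹ ∑_{j < n} Aʲ C` are independent, for `λ` in the simple spectrum of `B`. -/
theorem injective_of_resolventVector [FiniteDimensional ℝ E] {A : Matrix (Fin N) (Fin N) ℝ}
    {C : Fin N → ℝ} {n : ℕ} {B : E →ₗ[ℝ] E} {Λ : Set ℂ} (hΛ : Λ.Finite)
    (hcard : Λ.ncard = Module.finrank ℝ E) {z : Λ → ℂ ⊗[ℝ] E}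
    (hz : ∀ lam : Λ, Module.End.HasEigenvector (B.baseChange ℂ) (lam : ℂ) (z lam))
    (hA : IsUnit (1 - toComplex A)) (hreg : ∀ lam ∈ Λ, IsUnit (1 - lam • toComplex A ^ n))
    (hlin : LinearIndependent ℂ fun lam : Λ => resolventVector A C n lam)
    {α : E →ₗ[ℝ] ℝ} (hα : ∀ lam, complexify α (z lam) ≠ 0) {D : E →ₗ[ℝ] (Fin N → ℝ)}
    (hD : ∀ v, D v = α v • (∑ j ∈ Finset.range n, A ^ j *ᵥ C) + A ^ n *ᵥ D (B v)) :
    Injective D := by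
  set a := toComplex A with ha
  set c : Fin N → ℂ := fun i => (C i : ℂ) with hc
  let ι : (Fin N → ℝ) →ₗ[ℝ] (Fin N → ℂ) :=
    { toFun := fun x i => (x i : ℂ)
      map_add' := fun x y => by ext i; simp
      map_smul' := fun r x => by ext i; simp }
  have hιmul : ∀ (P : Matrix (Fin N) (Fin N) ℝ) x, ι (P *ᵥ x) = toComplex P *ᵥ ι x := fun P x =>
    (toComplex_mulVec P x).symm
  let DC : ℂ ⊗[ℝ] E →ₗ[ℂ] (Fin N → ℂ) := LinearMap.liftBaseChange ℂ (ι ∘ₗ D)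
  have hDC : ∀ (x : ℂ) v, DC (x ⊗ₜ[ℝ] v) = x • ι (D v) := fun x v =>
    LinearMap.liftBaseChange_tmul _ _ _ _
  set Γ : Fin N → ℂ := ∑ j ∈ Finset.range n, a ^ j *ᵥ c
  have hΓ : ι (∑ j ∈ Finset.range n, A ^ j *ᵥ C) = Γ := by
    rw [map_sum]
    refine Finset.sum_congr rfl fun j _ => ?_
    rw [hιmul, toComplex_pow]
    rfl
  have hrel : ∀ w, DC w = complexify α w • Γ + a ^ n *ᵥ DC (B.baseChange ℂ w) := by
    intro w
    induction w using TensorProduct.induction_on with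
    | zero => simp
    | tmul x v =>
      rw [hDC, hD v, map_add, map_smul, hΓ, hιmul, toComplex_pow, LinearMap.baseChange_tmul, hDC,
        complexify_tmul, Matrix.mulVec_smul, smul_add, mul_smul]
      rfl
    | add x y hx hy =>
      rw [map_add, hx, hy, map_add, map_add, map_add, Matrix.mulVec_add, add_smul]
      abel
  have hΓres : Γ = ((1 - a)⁻¹ * (1 - a ^ n)) *ᵥ c := by
    have h1 : Γ = (∑ j ∈ Finset.range n, a ^ j) *ᵥ c := (Matrix.sum_mulVec _ _ _).symm
    rw [h1, ← mul_neg_geom_sum a n, ← mul_assoc, Matrix.nonsing_inv_mul _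
      ((Matrix.isUnit_iff_isUnit_det _).1 hA), one_mul]
  -- On an eigenvector the relation reads (1 - λ aⁿ) DC z = α(z) Γ. Inverting the factor and summing
  -- the geometric series Γ produces the resolvent vector.
  have heig : ∀ lam : Λ, DC (z lam) = complexify α (z lam) • resolventVector A C n lam := by
    intro lam
    have h1 := hrel (z lam)
    rw [(hz lam).apply_eq_smul, map_smul, Matrix.mulVec_smul] at h1
    have h2 : (1 - (lam : ℂ) • a ^ n) *ᵥ DC (z lam) = complexify α (z lam) • Γ := by
      rw [Matrix.sub_mulVec, Matrix.one_mulVec, Matrix.smul_mulVec]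
      exact sub_eq_of_eq_add h1
    have h3 := congrArg (fun x => (1 - (lam : ℂ) • a ^ n)⁻¹ *ᵥ x) h2
    simp only [Matrix.mulVec_mulVec] at h3
    rw [Matrix.nonsing_inv_mul _ ((Matrix.isUnit_iff_isUnit_det _).1 (hreg lam lam.2)),
      Matrix.one_mulVec] at h3
    rw [h3, Matrix.mulVec_smul, hΓres, resolventVector, Matrix.mulVec_mulVec, mul_assoc]
  have := hΛ.fintype
  have hspan : Submodule.span ℂ (range z) = ⊤ := by
    refine LinearIndependent.span_eq_top_of_card_eq_finrank'
      (Module.End.eigenvectors_linearIndependent _ Λ z hz) ?_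
    rw [Module.finrank_baseChange, ← hcard, ← Nat.card_eq_fintype_card, Nat.card_coe_set_eq]
  have hinj : Injective DC := by
    refine injective_of_linearIndependent_comp DC hspan ?_
    have h1 := hlin.units_smul fun lam => Units.mk0 _ (hα lam)
    have h2 : (DC ∘ z) = (fun lam : Λ => Units.mk0 _ (hα lam)) •
        fun lam : Λ => resolventVector A C n lam := funext heig
    exact h2 ▸ h1
  refine (injective_iff_map_eq_zero _).2 fun v hv => ?_
  have h1 : (1 : ℂ) ⊗ₜ[ℝ] v = 0 := hinj (by rw [hDC, hv, map_zero, smul_zero, map_zero])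
  refine (Module.forall_dual_apply_eq_zero_iff ℝ v).1 fun β => ?_
  have h2 := complexify_tmul β 1 v
  rw [h1, map_zero, one_mul] at h2
  exact_mod_cast h2.symm

end LinearAlgebra

/-! ### Invertibility of the matrices in the resolvent vectors -/

section Resolvent

variable {q N : ℕ} {M : Type*} [TopologicalSpace M] [ChartedSpace (EuclideanSpace ℝ (Fin q)) M]

theorem norm_lt_one_of_mem_spectrum {P : Matrix (Fin N) (Fin N) ℂ} (hP : spectralRadius ℂ P < 1)
    {k : ℂ} (hk : k ∈ spectrum ℂ P) : ‖k‖ < 1 := by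
  have h1 : (‖k‖₊ : ENNReal) < 1 :=
    lt_of_le_of_lt (le_iSup₂ (f := fun (k : ℂ) (_ : k ∈ spectrum ℂ P) => (‖k‖₊ : ENNReal)) k hk) hP
  have h2 : ‖k‖₊ < 1 := by exact_mod_cast h1
  exact_mod_cast h2

theorem isUnit_one_sub_of_spectralRadius_lt_one {P : Matrix (Fin N) (Fin N) ℂ}
    (hP : spectralRadius ℂ P < 1) : IsUnit (1 - P) := by
  by_contra h
  have h1 : (1 : ℂ) ∈ spectrum ℂ P := by
    rw [spectrum.mem_iff, map_one]
    exact h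
  simpa using norm_lt_one_of_mem_spectrum hP h1

theorem finite_periodEigenvalues (φ : Diffeomorph (𝓡 q) (𝓡 q) M M 2) (m : M) :
    (periodEigenvalues φ m).Finite :=
  Module.End.finite_hasEigenvalue _

/-- Failure would give an eigenvalue μ of A with λ μⁿ = 1, yet |μ| < 1 yields |λ| |μ|ⁿ ≤ |λ_max|
|μ|^(n_min) < 1. -/
theorem isUnit_one_sub_smul_pow {φ : Diffeomorph (𝓡 q) (𝓡 q) M M 2}
    (hfin : (periodicPts φ).Finite) {A : Matrix (Fin N) (Fin N) ℝ}
    (hA : spectralRadius ℂ (toComplex A) < 1)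
    (hmax : ∀ (lamMax : ℂ) (nMin : ℕ), IsMaxPeriodEigenvalue φ lamMax →
      IsMinPeriod φ nMin → spectralRadius ℂ (lamMax • toComplex A ^ nMin) < 1)
    {m : M} (hm : m ∈ periodicPts φ) {lam : ℂ} (hlam : lam ∈ periodEigenvalues φ m) :
    IsUnit (1 - lam • toComplex A ^ minimalPeriod φ m) := by
  by_contra h
  set a := toComplex A
  set n := minimalPeriod φ m
  have hn : 0 < n := minimalPeriod_pos_of_mem_periodicPts hm
  have hlam0 : lam ≠ 0 := by
    rintro rfl
    exact h (by simp)
  have hspec : lam⁻¹ ∈ spectrum ℂ (a ^ n) := by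
    rw [spectrum.mem_iff]
    intro h1
    refine h ?_
    have h2 : 1 - lam • a ^ n = Units.mk0 lam hlam0 • (algebraMap ℂ _ lam⁻¹ - a ^ n) := by
      rw [Units.smul_mk0, smul_sub, Algebra.algebraMap_eq_smul_one, smul_smul,
        mul_inv_cancel₀ hlam0, one_smul]
    rw [h2]
    exact (isUnit_smul_iff _ _).2 h1
  rw [spectrum.map_pow_of_pos a hn] at hspec
  obtain ⟨mu, hmu, hmun⟩ := hspec
  obtain ⟨lamMax, hmem, hmax'⟩ := Set.exists_max_image
    (⋃ m ∈ periodicPts φ, periodEigenvalues φ m) (fun z => ‖z‖)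
    (hfin.biUnion fun x _ => finite_periodEigenvalues φ x) ⟨lam, mem_biUnion hm hlam⟩
  obtain ⟨x, hx, hxl⟩ := mem_iUnion₂.1 hmem
  have hne : (minimalPeriod φ '' periodicPts φ).Nonempty := ⟨_, m, hm, rfl⟩
  set k := sInf (minimalPeriod φ '' periodicPts φ) with hk
  have hmin : IsMinPeriod φ k := ⟨Nat.sInf_mem hne, fun y hy => Nat.sInf_le hy⟩
  have hrad := hmax lamMax k ⟨⟨x, hx, hxl⟩, fun y hy mu hmu => hmax' mu (mem_biUnion hy hmu)⟩ hmin
  have hlm : ‖lam‖ ≤ ‖lamMax‖ := hmax' lam (mem_biUnion hm hlam)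
  have hlM0 : lamMax ≠ 0 := fun h0 => by
    rw [h0, norm_zero] at hlm
    exact hlam0 (norm_le_zero_iff.1 hlm)
  have h3 : lamMax * mu ^ k ∈ spectrum ℂ (lamMax • a ^ k) :=
    (spectrum.smul_mem_smul_iff (r := Units.mk0 lamMax hlM0)).2 (spectrum.pow_mem_pow a k hmu)
  have h4 := norm_lt_one_of_mem_spectrum hrad h3
  have h5 := norm_lt_one_of_mem_spectrum hA hmu
  rw [norm_mul, norm_pow] at h4
  have h6 : ‖lam‖ * ‖mu‖ ^ n = 1 := by
    have h7 : mu ^ n = lam⁻¹ := hmun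
    rw [← norm_pow, h7, norm_inv, mul_inv_cancel₀ (norm_ne_zero_iff.2 hlam0)]
  have h7 : ‖mu‖ ^ n ≤ ‖mu‖ ^ k :=
    pow_le_pow_of_le_one (norm_nonneg _) h5.le (hmin.2 ⟨m, hm, rfl⟩)
  have h8 : ‖lam‖ * ‖mu‖ ^ n ≤ ‖lamMax‖ * ‖mu‖ ^ k :=
    mul_le_mul hlm h7 (by positivity) (norm_nonneg _)
  linarith

end Resolvent

/-! ### Immersivity at periodic points -/

section PeriodicImmersion

variable {q N : ℕ} {M : Type*} [TopologicalSpace M] [ChartedSpace (EuclideanSpace ℝ (Fin q)) M]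
  [IsManifold (𝓡 q) (⊤ : ℕ∞) M] [T2Space M]

theorem exists_tderiv_eq_of_nhds {p : M} {V : Set M} (hV : V ∈ 𝓝 p)
    (α : EuclideanSpace ℝ (Fin q) →L[ℝ] ℝ) :
    ∃ ψ : C2Map q M ℝ, (∀ x, x ∉ V → ψ x = 0) ∧ tderiv ψ p = α := by
  obtain ⟨r₀, H, ψ, hr₀, hH, hball, hsupp, hsup, hlin, -⟩ := exists_scaled_bumps (F := ℝ) p α
  set e := chartAt (EuclideanSpace ℝ (Fin q)) p
  have hp : p ∈ e.source := mem_chart_source _ p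
  have hpre : e.symm ⁻¹' V ∈ 𝓝 (e p) :=
    (e.continuousAt_symm (e.map_source hp)).preimage_mem_nhds (by rwa [e.left_inv hp])
  obtain ⟨r, hr, hrV⟩ := Metric.nhds_basis_closedBall.mem_iff.1 hpre
  set ε := min r r₀
  have hε0 : 0 < ε := lt_min hr hr₀
  have hεI : ε ∈ Ioc 0 r₀ := ⟨hε0, min_le_right _ _⟩
  refine ⟨ψ ε, fun x hx => by_contra fun h => hx ?_, ?_⟩
  · obtain ⟨h1, h2⟩ := hsupp ε hεI x h
    have h3 := hrV (closedBall_subset_closedBall (min_le_left _ _) h2)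
    rwa [mem_preimage, e.left_inv h1] at h3
  · rw [tderiv_eq_fderiv]
    have heq : (fun u => ψ ε (e.symm u)) =ᶠ[𝓝 (e p)] fun u => α (u - e p) := by
      filter_upwards [closedBall_mem_nhds (e p) (half_pos hε0)] with u hu
      have h1 : ‖ε⁻¹ • (u - e p)‖ ≤ 1 / 2 := by
        rw [mem_closedBall, dist_eq_norm] at hu
        rw [norm_smul, norm_inv, Real.norm_of_nonneg hε0.le, inv_mul_le_iff₀ hε0]
        linarith
      have h2 := hlin ε hεI _ h1
      rw [smul_smul, mul_inv_cancel₀ hε0.ne', one_smul, add_sub_cancel, map_smul, smul_eq_mul,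
        ← mul_assoc, mul_inv_cancel₀ hε0.ne', one_mul] at h2
      exact h2
    rw [heq.fderiv_eq]
    exact (α.hasFDerivAt.comp (e p) ((hasFDerivAt_id (𝕜 := ℝ) (e p)).sub_const (e p))).fderiv

theorem exists_forall_tderiv_eq {ι : Type*} (s : Finset ι) {p : ι → M} (hp : InjOn p s)
    (α : ι → EuclideanSpace ℝ (Fin q) →L[ℝ] ℝ) :
    ∃ ψ : C2Map q M ℝ, ∀ i ∈ s, tderiv ψ (p i) = α i := by
  classical
  let L : M → C2Map q M ℝ →ₗ[ℝ] (EuclideanSpace ℝ (Fin q) →L[ℝ] ℝ) := fun x =>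
    { toFun := fun ψ => tderiv ψ x
      map_add' := fun a b => tderiv_add a b x
      map_smul' := fun r a => tderiv_smul r a x }
  obtain ⟨U, hU, hdisj⟩ := ((s.finite_toSet.image p).t2_separation)
  choose ψ hψ0 hψ using fun i => exists_tderiv_eq_of_nhds ((hU (p i)).2.mem_nhds (hU (p i)).1) (α i)
  refine ⟨∑ i ∈ s, ψ i, fun i hi => ?_⟩
  have h1 : L (p i) (∑ j ∈ s, ψ j) = ∑ j ∈ s, L (p i) (ψ j) := map_sum _ _ _
  refine h1.trans ((Finset.sum_eq_single_of_mem i hi fun j hj hji => ?_).trans (hψ i))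
  refine tderiv_eq_zero ?_
  have hne : p i ≠ p j := fun h => hji (hp hi hj h).symm
  filter_upwards [(hU (p i)).2.mem_nhds (hU (p i)).1] with x hx
  refine hψ0 j x fun hxj => ?_
  exact disjoint_left.1 (hdisj ⟨i, hi, rfl⟩ ⟨j, hj, rfl⟩ hne) hx hxj

variable [CompactSpace M]

theorem exists_injective_tderiv {φ : Diffeomorph (𝓡 q) (𝓡 q) M M 2}
    (hfin : (periodicPts φ).Finite) {A : Matrix (Fin N) (Fin N) ℝ} {C : Fin N → ℝ}
    (hA : spectralRadius ℂ (toComplex A) < 1)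
    (hmax : ∀ (lamMax : ℂ) (nMin : ℕ), IsMaxPeriodEigenvalue φ lamMax →
      IsMinPeriod φ nMin → spectralRadius ℂ (lamMax • toComplex A ^ nMin) < 1)
    {m : M} (hm : m ∈ periodicPts φ) (heig : (periodEigenvalues φ m).ncard = q)
    (hlin : LinearIndependent ℂ
      (fun lam : periodEigenvalues φ m => resolventVector A C (minimalPeriod φ m) lam))
    {S : C2Map q M ℝ →ₗ[ℝ] C2Map q M (EuclideanSpace ℝ (Fin N))}
    (hsync : ∀ w m, S w m =
      sync (Matrix.toEuclideanCLM (𝕜 := ℝ) A) (WithLp.toLp 2 C) φ w m) :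
    ∃ ψ : C2Map q M ℝ, Injective (tderiv (q := q) (S ψ) m) := by
  set n := minimalPeriod φ m with hn
  have hn0 : 0 < n := minimalPeriod_pos_of_mem_periodicPts hm
  have hper : φ.symm^[n] m = m := by
    have h1 := congrArg (φ.symm^[n]) (isPeriodicPt_minimalPeriod φ m).eq
    rw [iterate_symm_iterate] at h1
    exact h1.symm
  set B := periodTangentMap φ m with hB
  have hBt : B = tmap (φ.symm^[n]) m := rfl
  have hev : ∀ lam : periodEigenvalues φ m, ∃ z, Module.End.HasEigenvector
      ((B : EuclideanSpace ℝ (Fin q) →ₗ[ℝ] EuclideanSpace ℝ (Fin q)).baseChange ℂ) (lam : ℂ) z :=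
    fun lam => Module.End.HasEigenvalue.exists_hasEigenvector lam.2
  choose z hz using hev
  have := (finite_periodEigenvalues φ m).to_subtype
  obtain ⟨α, hα⟩ := exists_forall_complexify_ne_zero fun lam => (hz lam).2
  -- Prescribing α ∘ (T_m φ⁻ʲ)⁻¹ at the j-th orbit point makes every term contribute the same
  -- covector α at m, so the sum becomes α(v) ∑ AʲC.
  have hleft : ∀ j : ℕ, ∃ β : EuclideanSpace ℝ (Fin q) →L[ℝ] ℝ,
      ∀ v, β (tmap (φ.symm^[j]) m v) = α v := by
    intro j
    obtain ⟨g, hg⟩ := LinearMap.exists_leftInverse_of_injective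
      (tmap (q := q) (φ.symm^[j]) m : EuclideanSpace ℝ (Fin q) →ₗ[ℝ] EuclideanSpace ℝ (Fin q))
      (LinearMap.ker_eq_bot.2 (tmap_iterate_injective φ.symm j m))
    refine ⟨LinearMap.toContinuousLinearMap (α ∘ₗ g), fun v => ?_⟩
    exact congrArg α (LinearMap.congr_fun hg v)
  choose β hβ using hleft
  have hinj : InjOn (fun j : ℕ => φ.symm^[j] m) (Finset.range n) := by
    have key : ∀ a b : ℕ, a ≤ b → b < n → φ.symm^[a] m = φ.symm^[b] m → a = b := by
      intro a b hab hb h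
      by_contra hne
      have h1 := congrArg (φ^[b]) h
      rw [iterate_iterate_symm, ← Nat.sub_add_cancel hab, iterate_add_apply,
        iterate_iterate_symm] at h1
      exact not_isPeriodicPt_of_pos_of_lt_minimalPeriod (by omega) (by omega) h1
    intro a ha b hb hab
    have ha' := Finset.mem_range.1 (Finset.mem_coe.1 ha)
    have hb' := Finset.mem_range.1 (Finset.mem_coe.1 hb)
    rcases le_total a b with h | h
    · exact key a b h hb' hab
    · exact (key b a h ha' hab.symm).symm
  obtain ⟨ψ, hψ⟩ := exists_forall_tderiv_eq (Finset.range n) hinj β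
  refine ⟨ψ, ?_⟩
  have hc := summable_norm_pow_mulVec hA (WithLp.toLp 2 C)
  have hformula := fun v => tderiv_eq_sum_of_cocycle (f := S ψ) (φ := φ)
    (fun x => (S ψ).mdifferentiableAt x) ψ
    (fun x => by rw [hsync, hsync]; exact sync_eq hc ψ x) n m v
  let D : EuclideanSpace ℝ (Fin q) →ₗ[ℝ] (Fin N → ℝ) :=
    (WithLp.linearEquiv 2 ℝ (Fin N → ℝ)).toLinearMap ∘ₗ (tderiv (q := q) (S ψ) m).toLinearMap
  have hDinj : Injective D := by
    refine injective_of_resolventVector (A := A) (C := C) (n := n)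
      (B := (B : EuclideanSpace ℝ (Fin q) →ₗ[ℝ] EuclideanSpace ℝ (Fin q)))
      (finite_periodEigenvalues φ m) (by rw [heig]; simp) hz
      (isUnit_one_sub_of_spectralRadius_lt_one hA)
      (fun lam hlam => isUnit_one_sub_smul_pow hfin hA hmax hm hlam) hlin hα fun v => ?_
    have h1 := hformula v
    rw [hper, ← hBt, Finset.sum_congr rfl (g := fun j => α v •
      (Matrix.toEuclideanCLM (𝕜 := ℝ) A ^ j) (WithLp.toLp 2 C)) (fun j hj => by
        rw [hψ j hj, hβ]), ← Finset.smul_sum] at h1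
    have h2 := congrArg (WithLp.linearEquiv 2 ℝ (Fin N → ℝ)) h1
    rw [map_add, map_smul, map_sum] at h2
    simp only [← map_pow] at h2
    exact h2
  exact Injective.of_comp (f := WithLp.linearEquiv 2 ℝ (Fin N → ℝ)) hDinj

end PeriodicImmersion

/-! ### Continuity into C² by the closed graph theorem -/

section ClosedGraph

/-- The limit `p` is not assumed to come from a function: locally uniform convergence in each degree
makes it the Taylor series of its own degree zero term. -/
theorem hasFTaylorSeriesUpToOn_of_tendsto {E F : Type*} [NormedAddCommGroup E] [NormedSpace ℝ E]
    [NormedAddCommGroup F] [NormedSpace ℝ F] {U : Set E} (hU : IsOpen U) {f : ℕ → E → F}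
    (hf : ∀ n, ContDiffOn ℝ 2 (f n) U) {p : E → FormalMultilinearSeries ℝ E F}
    (hp : ∀ k : ℕ, k ≤ 2 → TendstoLocallyUniformlyOn (fun n => iteratedFDeriv ℝ k (f n))
      (fun u => p u k) atTop U) :
    HasFTaylorSeriesUpToOn 2 (fun u => (p u 0).curry0) p U := by
  have hp' : ∀ k : ℕ, k ≤ 2 → TendstoLocallyUniformlyOn
      (fun n => iteratedFDerivWithin ℝ k (f n) U) (fun u => p u k) atTop U := fun k hk =>
    (hp k hk).congr fun n => (iteratedFDerivWithin_of_isOpen k hU).symm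
  refine ⟨fun _ _ => rfl, fun k hk x hx => ?_, fun k hk => ?_⟩
  · have hk2 : k + 1 ≤ 2 := by
      have : k < 2 := by exact_mod_cast hk
      omega
    refine (hasFDerivAt_of_tendstoLocallyUniformlyOn hU (l := atTop)
      (f := fun n => iteratedFDerivWithin ℝ k (f n) U)
      (f' := fun n x => (iteratedFDerivWithin ℝ (k + 1) (f n) U x).curryLeft)
      (g := fun x => p x k) (g' := fun x => (p x (k + 1)).curryLeft)
      ?_ (fun n x hx => ?_) (fun x hx => (hp' k (by omega)).tendsto_at hx) hx).hasFDerivWithinAt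
    · exact (continuousMultilinearCurryLeftEquiv ℝ (fun _ : Fin (k + 1) => E)
        F).isometry.uniformContinuous.comp_tendstoLocallyUniformlyOn (hp' (k + 1) hk2)
    · exact (((hf n).ftaylorSeriesWithin hU.uniqueDiffOn).fderivWithin k hk x hx).hasFDerivAt
        (hU.mem_nhds hx)
  · exact (hp' k (by exact_mod_cast hk)).continuousOn (Frequently.of_forall fun n =>
      ((hf n).ftaylorSeriesWithin hU.uniqueDiffOn).cont k hk)

variable {q : ℕ} {M : Type*} [TopologicalSpace M] [ChartedSpace (EuclideanSpace ℝ (Fin q)) M]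
  [IsManifold (𝓡 q) (⊤ : ℕ∞) M]
  {F : Type*} [NormedAddCommGroup F] [NormedSpace ℝ F]

theorem C2Map.contDiffAt_of_fin (g : C2Map q M F)
    {e : OpenPartialHomeomorph M (EuclideanSpace ℝ (Fin q))}
    (he : e ∈ atlas (EuclideanSpace ℝ (Fin q)) M) {u : EuclideanSpace ℝ (Fin q)}
    (hu : u ∈ e.target) (k : Fin 3) : ContDiffAt ℝ (k : ℕ) (fun u => g (e.symm u)) u := by
  have hk : ((k : ℕ) : WithTop ℕ∞) ≤ 2 := by
    have : (k : ℕ) ≤ 2 := by omega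
    exact_mod_cast this
  exact (g.contDiffAt he hu).of_le hk

instance compactSpace_closedBall (c : EuclideanSpace ℝ (Fin q)) (r : ℝ) :
    CompactSpace (closedBall c r) :=
  isCompact_iff_compactSpace.1 (isCompact_closedBall c r)

/-- Continuous maps on a closed ball whose values are multilinear maps of degree at most two. -/
def JetSpace (F : Type*) [NormedAddCommGroup F] [NormedSpace ℝ F] (c : EuclideanSpace ℝ (Fin q))
    (r : ℝ) : Type _ :=
  (k : Fin 3) → C(closedBall c r, EuclideanSpace ℝ (Fin q) [×(k : ℕ)]→L[ℝ] F)

instance (c : EuclideanSpace ℝ (Fin q)) (r : ℝ) : NormedAddCommGroup (JetSpace F c r) :=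
  inferInstanceAs (NormedAddCommGroup ((k : Fin 3) →
    C(closedBall c r, EuclideanSpace ℝ (Fin q) [×(k : ℕ)]→L[ℝ] F)))

instance (c : EuclideanSpace ℝ (Fin q)) (r : ℝ) : NormedSpace ℝ (JetSpace F c r) :=
  inferInstanceAs (NormedSpace ℝ ((k : Fin 3) →
    C(closedBall c r, EuclideanSpace ℝ (Fin q) [×(k : ℕ)]→L[ℝ] F)))

instance [CompleteSpace F] (c : EuclideanSpace ℝ (Fin q)) (r : ℝ) :
    CompleteSpace (JetSpace F c r) :=
  inferInstanceAs (CompleteSpace ((k : Fin 3) →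
    C(closedBall c r, EuclideanSpace ℝ (Fin q) [×(k : ℕ)]→L[ℝ] F)))

theorem JetSpace.norm_apply_le {c : EuclideanSpace ℝ (Fin q)} {r : ℝ} (y : JetSpace F c r)
    (k : Fin 3) (x : closedBall c r) : ‖y k x‖ ≤ ‖y‖ :=
  ((y k).norm_coe_le_norm x).trans (norm_le_pi_norm (G := fun k : Fin 3 =>
    C(closedBall c r, EuclideanSpace ℝ (Fin q) [×(k : ℕ)]→L[ℝ] F)) y k)

variable {e : OpenPartialHomeomorph M (EuclideanSpace ℝ (Fin q))}
  {c : EuclideanSpace ℝ (Fin q)} {r : ℝ}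

/-- The derivatives up to order two of a local representative, over a part of the chart domain. -/
def C2Map.jet (he : e ∈ atlas (EuclideanSpace ℝ (Fin q)) M) (hK : closedBall c r ⊆ e.target) :
    C2Map q M F →ₗ[ℝ] JetSpace F c r where
  toFun g k := ⟨fun u => iteratedFDeriv ℝ k (fun u => g (e.symm u)) u, by
    have h : ContinuousOn (iteratedFDeriv ℝ k (fun u => g (e.symm u))) (closedBall c r) := fun u hu => by
      have h1 := g.continuousAt_iteratedFDeriv he k (hK hu)
      exact (ContinuousAt.comp (f := fun u => (g, u)) h1
        (by fun_prop : ContinuousAt (fun u => (g, u)) u)).continuousWithinAt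
    exact h.domRestrict⟩
  map_add' g h := by
    refine funext fun k => ContinuousMap.ext fun u => ?_
    exact iteratedFDeriv_add_apply (g.contDiffAt_of_fin he (hK u.2) k)
      (h.contDiffAt_of_fin he (hK u.2) k)
  map_smul' r g := by
    refine funext fun k => ContinuousMap.ext fun u => ?_
    exact iteratedFDeriv_const_smul_apply (g.contDiffAt_of_fin he (hK u.2) k)

theorem C2Map.tendsto_jet_iff {ι : Type*} {l : Filter ι} {G : ι → C2Map q M F}
    (he : e ∈ atlas (EuclideanSpace ℝ (Fin q)) M) (hK : closedBall c r ⊆ e.target)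
    {y : JetSpace F c r} :
    Tendsto (fun i => C2Map.jet he hK (G i)) l (𝓝 y) ↔ ∀ k : Fin 3,
      TendstoUniformly (fun i (u : closedBall c r) => iteratedFDeriv ℝ (k : ℕ) (fun u => G i (e.symm u)) u)
        (y k) l := by
  refine Iff.trans (tendsto_pi_nhds (A := fun k : Fin 3 =>
    C(closedBall c r, EuclideanSpace ℝ (Fin q) [×(k : ℕ)]→L[ℝ] F))) ?_
  exact forall_congr' fun k => ContinuousMap.tendsto_iff_tendstoUniformly

variable {he : e ∈ atlas (EuclideanSpace ℝ (Fin q)) M} {hK : closedBall c r ⊆ e.target}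
  {G : ℕ → C2Map q M F} {y : JetSpace F c r}

theorem C2Map.exists_contDiffOn_of_tendsto_jet
    (h : Tendsto (fun n => C2Map.jet he hK (G n)) atTop (𝓝 y)) :
    ∃ f : EuclideanSpace ℝ (Fin q) → F, ContDiffOn ℝ 2 f (ball c r) ∧
      (∀ x ∈ ball c r, Tendsto (fun n => G n (e.symm x)) atTop (𝓝 (f x))) ∧
      ∀ (k : Fin 3) (x : closedBall c r), (x : EuclideanSpace ℝ (Fin q)) ∈ ball c r →
        iteratedFDeriv ℝ (k : ℕ) f x = y k x := by
  classical
  rw [C2Map.tendsto_jet_iff] at h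
  let p : EuclideanSpace ℝ (Fin q) → FormalMultilinearSeries ℝ (EuclideanSpace ℝ (Fin q)) F :=
    fun x k => if h : k < 3 ∧ x ∈ closedBall c r then y ⟨k, h.1⟩ ⟨x, h.2⟩ else 0
  have hpy : ∀ (k : Fin 3) (x : closedBall c r), p x k = y k x := fun k x =>
    dif_pos (⟨k.2, x.2⟩ : (k : ℕ) < 3 ∧ (x : EuclideanSpace ℝ (Fin q)) ∈ closedBall c r)
  have hp : ∀ k : Fin 3, TendstoUniformlyOn
      (fun n => iteratedFDeriv ℝ (k : ℕ) (fun u => G n (e.symm u))) (fun x => p x k) atTop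
      (closedBall c r) := fun k => by
    rw [tendstoUniformlyOn_iff_tendstoUniformly_comp_coe]
    have h1 : (fun x => p x k) ∘ Subtype.val = y k := funext fun x => hpy k x
    rw [h1]
    exact h k
  have hT := hasFTaylorSeriesUpToOn_of_tendsto (U := ball c r) isOpen_ball
    (f := fun n u => G n (e.symm u)) (p := p)
    (fun n => ((G n).contDiffOn he).mono (ball_subset_closedBall.trans hK))
    (fun k hk => ((hp ⟨k, by omega⟩).mono ball_subset_closedBall).tendstoLocallyUniformlyOn)
  refine ⟨_, hT.contDiffOn (n := 2), fun x hx => ?_, fun k x hx => ?_⟩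
  · have h1 := (hp 0).tendsto_at (ball_subset_closedBall hx)
    exact ((continuousMultilinearCurryFin0 ℝ (EuclideanSpace ℝ (Fin q)) F).continuous.tendsto
      _).comp h1
  · have hk : ((k : ℕ) : WithTop ℕ∞) ≤ 2 := by
      have : (k : ℕ) ≤ 2 := by omega
      exact_mod_cast this
    rw [← hpy, hT.eq_iteratedFDerivWithin_of_uniqueDiffOn hk isOpen_ball.uniqueDiffOn hx,
      iteratedFDerivWithin_of_isOpen _ isOpen_ball hx]

/-- This is closedness of the graph: the pointwise limit determines the limit jet on the open ball,
and density carries the equality to the closed ball. -/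
theorem C2Map.jet_eq_of_tendsto (hr : 0 < r)
    (h : Tendsto (fun n => C2Map.jet he hK (G n)) atTop (𝓝 y)) {g : C2Map q M F}
    (hg : ∀ x ∈ ball c r, Tendsto (fun n => G n (e.symm x)) atTop (𝓝 (g (e.symm x)))) :
    C2Map.jet he hK g = y := by
  obtain ⟨f, hf, hlim, hy⟩ := C2Map.exists_contDiffOn_of_tendsto_jet h
  have hfg : EqOn f (fun u => g (e.symm u)) (ball c r) := fun x hx =>
    tendsto_nhds_unique (hlim x hx) (hg x hx)
  funext k
  refine ContinuousMap.coe_injective (Continuous.ext_on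
    (s := {x : closedBall c r | (x : EuclideanSpace ℝ (Fin q)) ∈ ball c r}) ?_
    (map_continuous _) (map_continuous _) fun x hx => ?_)
  · rw [Subtype.dense_iff]
    intro x hx
    rw [← closure_ball c hr.ne'] at hx
    have h1 : ball c r ⊆ Subtype.val '' {x : closedBall c r |
        (x : EuclideanSpace ℝ (Fin q)) ∈ ball c r} := fun z hz =>
      ⟨⟨z, ball_subset_closedBall hz⟩, hz, rfl⟩
    exact closure_mono h1 hx
  · rw [← hy k x hx]
    exact (((hfg.eventuallyEq_of_mem (isOpen_ball.mem_nhds hx)).iteratedFDeriv ℝ k).eq_of_nhds).symm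

/-- The closed graph theorem for linear maps into `C²(M, F)`. -/
theorem C2Map.continuous_of_continuous_apply [CompleteSpace F] {X : Type*} [NormedAddCommGroup X]
    [NormedSpace ℝ X] [CompleteSpace X] (L : X →ₗ[ℝ] C2Map q M F)
    (hL : ∀ m, Continuous fun x => L x m) : Continuous L := by
  -- Jets over one closed ball live in a Banach space, where the closed graph theorem applies; such
  -- balls cover the chart targets and recover the C² topology locally.
  have hball : ∀ {e : OpenPartialHomeomorph M (EuclideanSpace ℝ (Fin q))}
      (he : e ∈ atlas (EuclideanSpace ℝ (Fin q)) M) {c : EuclideanSpace ℝ (Fin q)} {ρ : ℝ}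
      (hρ : 0 < ρ) (hb : closedBall c ρ ⊆ e.target),
      Continuous fun x => C2Map.jet he hb (L x) := fun he c ρ hρ hb => by
    exact LinearMap.continuous_of_seq_closed_graph (𝕜 := ℝ) (F := JetSpace F c ρ) (C2Map.jet he hb ∘ₗ L)
      fun u x y hu hy => (C2Map.jet_eq_of_tendsto (he := he) (hK := hb) hρ hy
        fun z _ => ((hL _).tendsto x).comp hu).symm
  refine continuous_iff_continuousAt.2 fun x => C2Map.tendsto_iff.2 fun e he k K hKc hKt => ?_
  rw [← tendstoLocallyUniformlyOn_iff_tendstoUniformlyOn_of_compact hKc]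
  refine TendstoLocallyUniformlyOn.mono (s := e.target) ?_ hKt
  refine tendstoLocallyUniformlyOn_of_forall_exists_nhds fun c hc => ?_
  obtain ⟨ρ, hρ, hb⟩ := Metric.nhds_basis_closedBall.mem_iff.1 (e.open_target.mem_nhds hc)
  refine ⟨closedBall c ρ, mem_nhdsWithin_of_mem_nhds (closedBall_mem_nhds c hρ), ?_⟩
  exact tendstoUniformlyOn_iff_tendstoUniformly_comp_coe.2
    ((C2Map.tendsto_jet_iff he hb).1 ((hball he hρ hb).tendsto x) k)

variable [CompactSpace M]

theorem exists_finset_chart_balls (q : ℕ) (M : Type*) [TopologicalSpace M]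
    [ChartedSpace (EuclideanSpace ℝ (Fin q)) M] [CompactSpace M] :
    ∃ (t : Finset M) (r : M → ℝ), (∀ m, 0 < r m) ∧
      (∀ m, closedBall (chartAt (EuclideanSpace ℝ (Fin q)) m m) (r m) ⊆
        (chartAt (EuclideanSpace ℝ (Fin q)) m).target) ∧
      ∀ x, ∃ m ∈ t, x ∈ (chartAt (EuclideanSpace ℝ (Fin q)) m).source ∧
        chartAt (EuclideanSpace ℝ (Fin q)) m x ∈
          ball (chartAt (EuclideanSpace ℝ (Fin q)) m m) (r m) := by
  have h1 : ∀ m : M, ∃ r > 0, closedBall (chartAt (EuclideanSpace ℝ (Fin q)) m m) r ⊆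
      (chartAt (EuclideanSpace ℝ (Fin q)) m).target := fun m =>
    Metric.nhds_basis_closedBall.mem_iff.1
      ((chartAt (EuclideanSpace ℝ (Fin q)) m).open_target.mem_nhds (mem_chart_target _ m))
  choose r hr hK using h1
  obtain ⟨t, ht⟩ := (isCompact_univ (X := M)).elim_nhds_subcover'
    (fun m _ => (chartAt (EuclideanSpace ℝ (Fin q)) m).source ∩
      chartAt (EuclideanSpace ℝ (Fin q)) m ⁻¹' ball (chartAt (EuclideanSpace ℝ (Fin q)) m m) (r m))
    fun m _ => ((chartAt (EuclideanSpace ℝ (Fin q)) m).isOpen_inter_preimage isOpen_ball).mem_nhds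
      ⟨mem_chart_source _ m, mem_ball_self (hr m)⟩
  refine ⟨t.map (Embedding.subtype _), r, hr, hK, fun x => ?_⟩
  obtain ⟨m, hm, hx⟩ := mem_iUnion₂.1 (ht (mem_univ x))
  exact ⟨m, Finset.mem_map.2 ⟨m, hm, rfl⟩, hx⟩

theorem exists_linearEquiv_of_isClosed_range.{u} {V : Type*} [AddCommGroup V] [Module ℝ V]
    [TopologicalSpace V] {B : Type u} [NormedAddCommGroup B] [NormedSpace ℝ B] [CompleteSpace B]
    (J : V →ₗ[ℝ] B) (hinj : Injective J) (hclosed : IsClosed (LinearMap.range J : Set B))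
    (hJ : Continuous J) :
    ∃ (X : Type u) (_ : NormedAddCommGroup X) (_ : NormedSpace ℝ X) (_ : CompleteSpace X)
      (I : V ≃ₗ[ℝ] X), Continuous I ∧ ∀ v, ‖I v‖ = ‖J v‖ :=
  ⟨LinearMap.range J, inferInstance, inferInstance, hclosed.completeSpace_coe,
    LinearEquiv.ofInjective J hinj, hJ.subtype_mk _, fun _ => rfl⟩

/-- A complete norm on `C²(M, ℝ)` that is finer than pointwise bounds and coarser than the `C²`
topology. -/
theorem C2Map.exists_linearEquiv_completeSpace.{u} (q : ℕ) (M : Type u) [TopologicalSpace M]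
    [ChartedSpace (EuclideanSpace ℝ (Fin q)) M] [IsManifold (𝓡 q) (⊤ : ℕ∞) M] [CompactSpace M] :
    ∃ (X : Type u) (_ : NormedAddCommGroup X) (_ : NormedSpace ℝ X) (_ : CompleteSpace X)
      (I : C2Map q M ℝ ≃ₗ[ℝ] X), Continuous I ∧ ∀ w m, ‖w m‖ ≤ ‖I w‖ := by
  obtain ⟨t, r, hr, hK, hcov⟩ := exists_finset_chart_balls q M
  let J : C2Map q M ℝ →ₗ[ℝ] (m : t) →
      JetSpace ℝ (chartAt (EuclideanSpace ℝ (Fin q)) (m : M) m) (r m) :=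
    LinearMap.pi fun m => C2Map.jet (chart_mem_atlas _ (m : M)) (hK m)
  have hbd : ∀ w m, ‖w m‖ ≤ ‖J w‖ := fun w x => by
    obtain ⟨m, hm, hx, hxb⟩ := hcov x
    have h1 := (JetSpace.norm_apply_le (J w ⟨m, hm⟩) 0 ⟨_, ball_subset_closedBall hxb⟩).trans
      (norm_le_pi_norm (J w) ⟨m, hm⟩)
    have h2 : ‖J w ⟨m, hm⟩ 0 ⟨_, ball_subset_closedBall hxb⟩‖ = ‖w x‖ := by
      refine (norm_iteratedFDeriv_zero (𝕜 := ℝ)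
        (f := fun u => w ((chartAt (EuclideanSpace ℝ (Fin q)) m).symm u))).trans ?_
      rw [(chartAt (EuclideanSpace ℝ (Fin q)) m).left_inv hx]
    rwa [h2] at h1
  have hinj : Injective J := (injective_iff_map_eq_zero _).2 fun w hw => by
    ext1 x
    have h1 := hbd w x
    rw [hw] at h1
    exact norm_le_zero_iff.1 (h1.trans (norm_zero (E := (m : t) →
      JetSpace ℝ (chartAt (EuclideanSpace ℝ (Fin q)) (m : M) m) (r m))).le)
  have hclosed : IsClosed (LinearMap.range J : Set ((m : t) →
      JetSpace ℝ (chartAt (EuclideanSpace ℝ (Fin q)) (m : M) m) (r m))) := by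
    refine IsSeqClosed.isClosed fun y z hy hyz => ?_
    choose w hw using hy
    obtain rfl : (fun n => J (w n)) = y := funext hw
    have h1 := fun m hm => C2Map.exists_contDiffOn_of_tendsto_jet
      (he := chart_mem_atlas _ m) (hK := hK m) ((tendsto_pi_nhds.1 hyz) ⟨m, hm⟩)
    choose f hf hlim _ using h1
    have hlim' : ∀ x, ∃ a, Tendsto (fun n => w n x) atTop (𝓝 a) := fun x => by
      obtain ⟨m, hm, hx, hxb⟩ := hcov x
      have h2 := hlim m hm _ hxb
      simp only [(chartAt (EuclideanSpace ℝ (Fin q)) m).left_inv hx] at h2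
      exact ⟨_, h2⟩
    choose g hg using hlim'
    have hgs : ContMDiff (𝓡 q) 𝓘(ℝ, ℝ) 2 g := fun x => by
      obtain ⟨m, hm, hx, hxb⟩ := hcov x
      have h3 : ContMDiffAt (𝓡 q) 𝓘(ℝ, ℝ) 2
          (f m hm ∘ chartAt (EuclideanSpace ℝ (Fin q)) m) x :=
        ((hf m hm).contDiffAt (isOpen_ball.mem_nhds hxb)).contMDiffAt.comp x
          ((contMDiffOn_of_mem_maximalAtlas (I := 𝓡 q) (n := 2)
            (IsManifold.chart_mem_maximalAtlas m)).contMDiffAt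
            ((chartAt (EuclideanSpace ℝ (Fin q)) m).open_source.mem_nhds hx))
      refine h3.congr_of_eventuallyEq ?_
      filter_upwards [((chartAt (EuclideanSpace ℝ (Fin q)) m).isOpen_inter_preimage
        isOpen_ball).mem_nhds ⟨hx, hxb⟩] with z hz
      have h4 := hlim m hm _ hz.2
      simp only [(chartAt (EuclideanSpace ℝ (Fin q)) m).left_inv hz.1] at h4
      exact tendsto_nhds_unique (hg z) h4
    exact ⟨⟨g, hgs⟩, funext fun m => C2Map.jet_eq_of_tendsto
      (he := chart_mem_atlas _ (m : M)) (hK := hK m) (hr m) ((tendsto_pi_nhds.1 hyz) m)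
      fun x _ => hg _⟩
  have hJ : Continuous J := by
    refine continuous_pi fun m => ?_
    refine continuous_iff_continuousAt.2 fun g => (C2Map.tendsto_jet_iff
      (chart_mem_atlas _ (m : M)) (hK m)).2 fun k => ?_
    exact tendstoUniformlyOn_iff_tendstoUniformly_comp_coe.1
      (C2Map.tendsto_iff.1 tendsto_id _ (chart_mem_atlas _ (m : M)) k _
        (isCompact_closedBall _ _) (hK m))
  obtain ⟨X, i1, i2, i3, I, hI, hIJ⟩ := exists_linearEquiv_of_isClosed_range J hinj hclosed hJ
  exact ⟨X, i1, i2, i3, I, hI, fun w m => (hbd w m).trans_eq (hIJ w).symm⟩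

/-- The sup norm is dominated by an auxiliary complete norm, so evaluations of `S` are continuous
for that norm. The closed graph theorem upgrades this to C² continuity, and `I` leads back to the C²
topology of the source. -/
theorem C2Map.continuous_of_bound [CompleteSpace F] (S : C2Map q M ℝ →ₗ[ℝ] C2Map q M F)
    (hS : ∀ m, ∃ C : ℝ, ∀ (w : C2Map q M ℝ) (B : ℝ), (∀ x, ‖w x‖ ≤ B) → ‖S w m‖ ≤ C * B) :
    Continuous S := by
  obtain ⟨X, _, _, _, I, hI, hIbd⟩ := C2Map.exists_linearEquiv_completeSpace q M
  have hSJ : ∀ m, Continuous fun x => S (I.symm x) m := fun m => by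
    obtain ⟨C, hC⟩ := hS m
    let L : X →ₗ[ℝ] F :=
      { toFun := fun x => S (I.symm x) m
        map_add' := fun x y => by
          rw [map_add, map_add]
          rfl
        map_smul' := fun a x => by
          rw [map_smul, map_smul]
          rfl }
    exact (L.mkContinuous C fun x => hC _ _ fun y => by simpa using hIbd (I.symm x) y).continuous
  have h1 := (C2Map.continuous_of_continuous_apply
    (S ∘ₗ (I.symm : X →ₗ[ℝ] C2Map q M ℝ)) hSJ).comp hI
  exact h1.congr fun w => congrArg S (I.symm_apply_apply w)

/-- Synchronizations of class `C²` depend continuously on the observation map in the `C²`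
topologies: this is automatic, by the closed graph theorem. -/
theorem continuous_of_eq_sync [CompleteSpace F] {T : F →L[ℝ] F} {c : F}
    {φ : Diffeomorph (𝓡 q) (𝓡 q) M M 2} {S : C2Map q M ℝ →ₗ[ℝ] C2Map q M F}
    (hc : Summable fun j => ‖(T ^ j) c‖) (hsync : ∀ w m, S w m = sync T c φ w m) :
    Continuous S := by
  refine C2Map.continuous_of_bound S fun m => ⟨∑' j, ‖(T ^ j) c‖, fun w B hB => ?_⟩
  rw [hsync, mul_comm]
  simpa using norm_sync_le_tail hc hB 0 m

end ClosedGraph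

/-! ### From local perturbations to generic injective immersions -/

section Generic

theorem exists_dense_of_finite {X Z : Type*} [TopologicalSpace X] {Q : X → Z → Prop} {s : Set Z}
    (hs : s.Finite) (h : ∀ z ∈ s, IsOpen {x | Q x z} ∧ Dense {x | Q x z}) :
    ∃ O : Set X, IsOpen O ∧ Dense O ∧ ∀ x ∈ O, ∀ z ∈ s, Q x z := by
  let _ : TopologicalSpace Z := ⊥
  have : DiscreteTopology Z := ⟨rfl⟩
  refine exists_dense_of_forall_nhds hs.isCompact fun z hz => ⟨{z}, by simp, {x | Q x z},
    (h z hz).1, (h z hz).2, ?_⟩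
  rintro x hx y rfl
  exact hx

theorem exists_nhds_dense_of_forall_nhds {X Y Z : Type*} [TopologicalSpace X] [TopologicalSpace Y]
    [TopologicalSpace Z] {Q : X → Y × Z → Prop} {K : Set Z} (hK : IsCompact K) {y₀ : Y}
    (h : ∀ z ∈ K, ∃ V ∈ 𝓝 (y₀, z), ∃ O : Set X, IsOpen O ∧ Dense O ∧ ∀ x ∈ O, ∀ p ∈ V, Q x p) :
    ∃ U ∈ 𝓝 y₀, ∃ O : Set X, IsOpen O ∧ Dense O ∧ ∀ x ∈ O, ∀ y ∈ U, ∀ z ∈ K, Q x (y, z) := by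
  refine hK.induction_on (p := fun s => ∃ U ∈ 𝓝 y₀, ∃ O : Set X, IsOpen O ∧ Dense O ∧
    ∀ x ∈ O, ∀ y ∈ U, ∀ z ∈ s, Q x (y, z)) ⟨univ, univ_mem, univ, isOpen_univ, dense_univ, by simp⟩
    ?_ ?_ ?_
  · rintro s t hst ⟨U, hU, O, h1, h2, h3⟩
    exact ⟨U, hU, O, h1, h2, fun x hx y hy z hz => h3 x hx y hy z (hst hz)⟩
  · rintro s t ⟨U, hU, O, h1, h2, h3⟩ ⟨U', hU', O', h1', h2', h3'⟩
    refine ⟨U ∩ U', inter_mem hU hU', O ∩ O', h1.inter h1', h2.inter_of_isOpen_left h2' h1,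
      fun x hx y hy z hz => ?_⟩
    exact hz.elim (h3 x hx.1 y hy.1 z) (h3' x hx.2 y hy.2 z)
  · intro z hz
    obtain ⟨V, hV, O, h1, h2, h3⟩ := h z hz
    obtain ⟨U, hU, W, hW, hUW⟩ := mem_nhds_prod_iff.1 hV
    exact ⟨W, mem_nhdsWithin_of_mem_nhds hW, U, hU, O, h1, h2,
      fun x hx y hy w hw => h3 x hx _ (hUW ⟨hy, hw⟩)⟩

variable {q N : ℕ} {M : Type*} [TopologicalSpace M] [ChartedSpace (EuclideanSpace ℝ (Fin q)) M]

/-- A forward orbit reaching a periodic point starts at one, and distinct points on each other's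
forward orbits are periodic. Hence, up to exchanging the points, `exists_sync_sub_eq` applies. -/
theorem exists_sub_eq_of_notMem_periodicPts {φ : Diffeomorph (𝓡 q) (𝓡 q) M M 2} {m m' : M}
    (hne : m ≠ m') (h : m ∉ periodicPts φ ∨ m' ∉ periodicPts φ) :
    (m ∉ periodicPts φ ∧ ∀ k, φ^[k] m ≠ m') ∨ (m' ∉ periodicPts φ ∧ ∀ k, φ^[k] m' ≠ m) := by
  have hiter : ∀ (x : M) (k : ℕ), φ^[k] x ∈ periodicPts φ → x ∈ periodicPts φ := fun x k hk => by
    rw [← iterate_symm_iterate (φ := φ) k x]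
    exact iterate_symm_mem_periodicPts.2 hk
  by_cases hm : m ∈ periodicPts φ
  · have hm' := h.resolve_left (not_not_intro hm)
    exact Or.inr ⟨hm', fun k hk => hm' (hiter m' k (hk ▸ hm))⟩
  by_cases hk : ∃ k, φ^[k] m = m'
  · obtain ⟨k, rfl⟩ := hk
    refine Or.inr ⟨fun h => hm (hiter m k h), fun j hj => hm ⟨j + k, ?_, ?_⟩⟩
    · rcases Nat.eq_zero_or_pos k with rfl | hk0
      · exact (hne rfl).elim
      · omega
    · rw [IsPeriodicPt, IsFixedPt, iterate_add_apply, hj]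
  · exact Or.inl ⟨hm, not_exists.1 hk⟩

variable [IsManifold (𝓡 q) (⊤ : ℕ∞) M]

theorem C2Map.dense_of_eventually_add_smul_mem {P : Set (C2Map q M ℝ)}
    (h : ∀ w, ∃ ψ : C2Map q M ℝ, ∀ᶠ t : ℝ in 𝓝[≠] 0, w + t • ψ ∈ P) : Dense P := by
  intro w
  obtain ⟨ψ, hψ⟩ := h w
  have h1 : Continuous fun t : ℝ => w + t • ψ :=
    continuous_const.add (C2Map.continuous_smul_left ψ)
  have h2 := (h1.tendsto 0).mono_left (nhdsWithin_le_nhds (s := {0}ᶜ))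
  rw [zero_smul, add_zero] at h2
  exact mem_closure_of_tendsto h2 hψ

variable {S : C2Map q M ℝ →ₗ[ℝ] C2Map q M (EuclideanSpace ℝ (Fin N))}

theorem isOpen_dense_apply_ne (hS : Continuous S) {m m' : M}
    (h : ∃ ψ : C2Map q M ℝ, S ψ m ≠ S ψ m') :
    IsOpen {w | S w m ≠ S w m'} ∧ Dense {w | S w m ≠ S w m'} := by
  have hev : ∀ m : M, Continuous fun w => S w m := fun m =>
    C2Map.continuous_eval.comp (f := fun w => (S w, m)) (by fun_prop)
  refine ⟨isOpen_ne_fun (hev m) (hev m'), C2Map.dense_of_eventually_add_smul_mem fun w => ?_⟩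
  obtain ⟨ψ, hψ⟩ := h
  have hval : ∀ (t : ℝ) (x : M), S (w + t • ψ) x = S w x + t • S ψ x := fun t x => by
    rw [map_add, map_smul]
    rfl
  by_cases hw : S w m = S w m'
  · refine ⟨ψ, eventually_nhdsWithin_of_forall fun t ht => ?_⟩
    simp only [mem_ofPred_eq, hval, hw]
    exact fun h => hψ (smul_right_injective _ ht (add_left_cancel h))
  · exact ⟨0, Eventually.of_forall fun t => by simpa using hw⟩

theorem isOpen_dense_injective_tderiv (hS : Continuous S) {m : M}
    (h : ∃ ψ : C2Map q M ℝ, Injective (tderiv (q := q) (S ψ) m)) :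
    IsOpen {w | Injective (tderiv (q := q) (S w) m)} ∧
      Dense {w | Injective (tderiv (q := q) (S w) m)} := by
  constructor
  · refine isOpen_iff_mem_nhds.2 fun w hw => ?_
    have h1 : Tendsto (fun w' => (S w', (m, m))) (𝓝 w) (𝓝 (S w, (m, m))) :=
      Continuous.tendsto (by fun_prop) w
    filter_upwards [h1.eventually ((S w).eventually_of_injective_mfderiv hw)] with w' hw'
    exact hw'.2
  · refine C2Map.dense_of_eventually_add_smul_mem fun w => ?_
    obtain ⟨ψ, hψ⟩ := h
    refine ⟨ψ, ?_⟩
    obtain ⟨R, hR⟩ := LinearMap.exists_leftInverse_of_injective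
      (tderiv (q := q) (S ψ) m : EuclideanSpace ℝ (Fin q) →ₗ[ℝ] EuclideanSpace ℝ (Fin N))
      (LinearMap.ker_eq_bot.2 hψ)
    set B : Module.End ℝ (EuclideanSpace ℝ (Fin q)) := R ∘ₗ
      (tderiv (q := q) (S w) m : EuclideanSpace ℝ (Fin q) →ₗ[ℝ] EuclideanSpace ℝ (Fin N)) with hB
    -- A kernel vector v of the perturbed differential satisfies B v = -t v, which excludes only
    -- finitely many t.
    have hfin : {t : ℝ | B.HasEigenvalue (-t)}.Finite :=
      (Module.End.finite_hasEigenvalue B).preimage neg_injective.injOn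
    filter_upwards [(nhdsNE_le_cofinite (0 : ℝ)) hfin.compl_mem_cofinite] with t ht
    refine (injective_iff_map_eq_zero _).2 fun v hv => ?_
    by_contra hv0
    refine ht (Module.End.hasEigenvalue_of_hasEigenvector (x := v)
      ⟨Module.End.mem_eigenspace_iff.2 ?_, hv0⟩)
    rw [map_add, map_smul, tderiv_add, tderiv_smul] at hv
    have h1 := congrArg R hv
    have h2 : R (tderiv (q := q) (S ψ) m v) = v := LinearMap.congr_fun hR v
    have h3 : R (tderiv (q := q) (S w) m v) + t • R (tderiv (q := q) (S ψ) m v) = 0 := by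
      rw [← map_smul, ← map_add, ← map_zero R, ← h1]
      rfl
    rw [h2] at h3
    rw [neg_smul]
    exact eq_neg_of_add_eq_zero_left h3

theorem exists_nhds_dense_injective_tderiv (hN : 2 * q < N) (hS : Continuous S) {m : M}
    (h : ∀ v ≠ 0, ∀ y, ∃ ψ : C2Map q M ℝ, tderiv (q := q) (S ψ) m v = y) :
    ∃ V ∈ 𝓝 m, ∃ O : Set (C2Map q M ℝ), IsOpen O ∧ Dense O ∧
      ∀ w ∈ O, ∀ x ∈ V, Injective (tderiv (q := q) (S w) x) := by
  set e := chartAt (EuclideanSpace ℝ (Fin q)) m with he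
  have hea : e ∈ atlas (EuclideanSpace ℝ (Fin q)) M := chart_mem_atlas _ m
  have hm : m ∈ e.source := mem_chart_source _ m
  have hu : e m ∈ e.target := e.map_source hm
  have hdiff : ∀ (g : C2Map q M (EuclideanSpace ℝ (Fin N))), ∀ u ∈ e.target,
      DifferentiableAt ℝ (fun u => g (e.symm u)) u := fun g u hu =>
    (g.contDiffAt hea hu).differentiableAt (by norm_num)
  -- The unknown is a base point together with a direction, hence 2q parameters. Compactness of the
  -- unit sphere gives one neighbourhood of the base point for all directions.
  obtain ⟨U, hU, O, hO, hOd, hUO⟩ := exists_nhds_dense_of_forall_nhds (y₀ := e m)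
    (isCompact_sphere (0 : EuclideanSpace ℝ (Fin q)) 1)
    (Q := fun w p => fderiv ℝ (fun u => S w (e.symm u)) p.1 p.2 ≠ 0) fun v hv => by
      refine exists_nhds_dense_eval_ne_zero (by simpa [two_mul] using hN) S hS
        (fun g p => fderiv ℝ (fun u => g (e.symm u)) p.1 p.2)
        (e.open_target.prod (isOpen_univ (X := EuclideanSpace ℝ (Fin q)))) ?_ ?_ ?_ ?_
        (x₀ := (e m, v)) ⟨hu, trivial⟩ ?_
      · intro g g' p hp
        exact DFunLike.congr_fun (fderiv_add (hdiff g _ hp.1) (hdiff g' _ hp.1)) p.2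
      · intro r g p hp
        exact DFunLike.congr_fun (fderiv_const_smul (hdiff g _ hp.1) r) p.2
      · intro g
        have h1 : ContDiffOn ℝ 1 (fderiv ℝ (fun u => g (e.symm u))) e.target :=
          (g.contDiffOn hea).fderiv_of_isOpen e.open_target (by norm_num)
        exact (h1.comp contDiff_fst.contDiffOn fun p hp => hp.1).clm_apply
          contDiff_snd.contDiffOn
      · intro g p hp
        have h1 : ContinuousAt (fun x : C2Map q M (EuclideanSpace ℝ (Fin N)) ×
            (EuclideanSpace ℝ (Fin q) × EuclideanSpace ℝ (Fin q)) => (x.1, x.2.1)) (g, p) :=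
          Continuous.continuousAt (by fun_prop)
        have h2 := ContinuousAt.comp (x := (g, p)) (g.continuousAt_fderiv hea hp.1) h1
        have h3 : ContinuousAt (fun x : C2Map q M (EuclideanSpace ℝ (Fin N)) ×
            (EuclideanSpace ℝ (Fin q) × EuclideanSpace ℝ (Fin q)) => x.2.2) (g, p) :=
          Continuous.continuousAt (by fun_prop)
        exact h2.clm_apply h3
      · intro y
        obtain ⟨ψ, hψ⟩ := h v (ne_zero_of_mem_unit_sphere ⟨v, hv⟩) y
        exact ⟨ψ, by rw [← hψ, tderiv_eq_fderiv]⟩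
  refine ⟨e.source ∩ e ⁻¹' U, inter_mem (e.open_source.mem_nhds hm)
    (e.continuousAt hm hU), O, hO, hOd, fun w hw x hx => ?_⟩
  refine ((S w).injective_mfderiv_iff hea hx.1).2 ((injective_iff_map_eq_zero _).2 fun v hv => ?_)
  by_contra hv0
  refine hUO w hw (e x) hx.2 (‖v‖⁻¹ • v) (by simp [norm_smul, hv0]) ?_
  simp only
  rw [map_smul, hv, smul_zero]

theorem exists_nhds_dense_apply_ne (hN : 2 * q < N) (hS : Continuous S) {z : M × M}
    (h : ∀ y, ∃ ψ : C2Map q M ℝ, S ψ z.1 - S ψ z.2 = y) :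
    ∃ V ∈ 𝓝 z, ∃ O : Set (C2Map q M ℝ), IsOpen O ∧ Dense O ∧
      ∀ w ∈ O, ∀ x ∈ V, S w x.1 ≠ S w x.2 := by
  obtain ⟨m, m'⟩ := z
  set e := chartAt (EuclideanSpace ℝ (Fin q)) m with he
  set e' := chartAt (EuclideanSpace ℝ (Fin q)) m' with he'
  have hea : e ∈ atlas (EuclideanSpace ℝ (Fin q)) M := chart_mem_atlas _ m
  have hea' : e' ∈ atlas (EuclideanSpace ℝ (Fin q)) M := chart_mem_atlas _ m'
  have hm : m ∈ e.source := mem_chart_source _ m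
  have hm' : m' ∈ e'.source := mem_chart_source _ m'
  obtain ⟨U, hU, O, hO, hOd, hUO⟩ := exists_nhds_dense_eval_ne_zero (by simpa [two_mul] using hN)
    S hS (fun g p => g (e.symm p.1) - g (e'.symm p.2))
    (e.open_target.prod e'.open_target) (x₀ := (e m, e' m'))
    (fun g g' p hp => add_sub_add_comm _ _ _ _) (fun r g p hp => (smul_sub r (g (e.symm p.1)) (g (e'.symm p.2))).symm)
    (fun g => by
      have h1 := ((g.contDiffOn hea).comp (t := e.target) (s := e.target ×ˢ e'.target)
        contDiff_fst.contDiffOn fun p hp => hp.1)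
      have h2 := ((g.contDiffOn hea').comp (t := e'.target) (s := e.target ×ˢ e'.target)
        contDiff_snd.contDiffOn fun p hp => hp.2)
      exact (h1.sub h2).of_le (by norm_num))
    (fun g p hp => by
      have h1 : ContinuousAt (fun x : C2Map q M (EuclideanSpace ℝ (Fin N)) ×
          (EuclideanSpace ℝ (Fin q) × EuclideanSpace ℝ (Fin q)) => (x.1, x.2.1)) (g, p) :=
        Continuous.continuousAt (by fun_prop)
      have h2 : ContinuousAt (fun x : C2Map q M (EuclideanSpace ℝ (Fin N)) ×
          (EuclideanSpace ℝ (Fin q) × EuclideanSpace ℝ (Fin q)) => (x.1, x.2.2)) (g, p) :=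
        Continuous.continuousAt (by fun_prop)
      exact (ContinuousAt.comp (x := (g, p)) (g.continuousAt_apply hea hp.1) h1).sub
        (ContinuousAt.comp (x := (g, p)) (g.continuousAt_apply hea' hp.2) h2))
    ⟨e.map_source hm, e'.map_source hm'⟩
    (fun y => by simpa only [e.left_inv hm, e'.left_inv hm'] using h y)
  have hc : ContinuousAt (fun x : M × M => (e x.1, e' x.2)) (m, m') :=
    ((e.continuousAt hm).comp (x := (m, m')) continuousAt_fst).prodMk
      ((e'.continuousAt hm').comp (x := (m, m')) continuousAt_snd)
  refine ⟨_, inter_mem ((e.open_source.prod e'.open_source).mem_nhds ⟨hm, hm'⟩) (hc hU), O, hO,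
    hOd, fun w hw x hx hxx => ?_⟩
  refine hUO w hw _ hx.2 ?_
  simp only [e.left_inv hx.1.1, e'.left_inv hx.1.2, hxx, sub_self]

variable [CompactSpace M] [T2Space M]

/-- A linear family of maps that can be made immersive and injective on a finite set, and moved
arbitrarily away from it, consists generically of injective immersions. -/
theorem dense_injective_immersion (hN : 2 * q < N) (hS : Continuous S) {P : Set M} (hP : P.Finite)
    (himm : ∀ m ∈ P, ∃ ψ : C2Map q M ℝ, Injective (tderiv (q := q) (S ψ) m))
    (hinj : ∀ m ∈ P, ∀ m' ∈ P, m ≠ m' → ∃ ψ : C2Map q M ℝ, S ψ m ≠ S ψ m')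
    (himm' : ∀ m ∉ P, ∀ v ≠ 0, ∀ y, ∃ ψ : C2Map q M ℝ, tderiv (q := q) (S ψ) m v = y)
    (hinj' : ∀ m m', m ≠ m' → (m ∉ P ∨ m' ∉ P) → ∀ y, ∃ ψ : C2Map q M ℝ, S ψ m - S ψ m' = y) :
    Dense {w | (∀ m, Injective (mfderiv (𝓡 q) 𝓘(ℝ, EuclideanSpace ℝ (Fin N)) (S w) m)) ∧
      Injective (S w)} := by
  refine dense_iff_inter_open.2 fun 𝒪 h𝒪 h𝒪ne => ?_
  let good : Set (C2Map q M ℝ × (M × M)) := {p | (S p.1 p.2.1 = S p.1 p.2.2 → p.2.1 = p.2.2) ∧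
    Injective (tderiv (q := q) (S p.1) p.2.1)}
  have hgood : IsOpen good := by
    refine isOpen_iff_mem_nhds.2 fun p hp => ?_
    have h1 : Tendsto (fun p : C2Map q M ℝ × (M × M) => (S p.1, p.2)) (𝓝 p) (𝓝 (S p.1, p.2)) :=
      Continuous.tendsto (by fun_prop) p
    exact h1.eventually ((S p.1).eventually_of_injective hp.2 hp.1)
  obtain ⟨O₁, hO₁, hO₁d, himm₁⟩ := exists_dense_of_finite hP
    fun m hm => isOpen_dense_injective_tderiv hS (himm m hm)
  obtain ⟨O₂, hO₂, hO₂d, hinj₁⟩ := exists_dense_of_finite (hP.offDiag)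
    (Q := fun w z => S w z.1 ≠ S w z.2)
    fun z hz => isOpen_dense_apply_ne hS (hinj _ hz.1 _ hz.2.1 hz.2.2)
  obtain ⟨w₁, hw₁, hw₁O⟩ := (hO₁d.inter_of_isOpen_left hO₂d hO₁).inter_open_nonempty 𝒪 h𝒪 h𝒪ne
  have hgood₁ : ∀ z ∈ P ×ˢ P, (w₁, z) ∈ good := fun z hz => by
    refine ⟨fun h => ?_, himm₁ w₁ hw₁O.1 _ hz.1⟩
    by_contra hne
    exact hinj₁ w₁ hw₁O.2 z ⟨hz.1, hz.2, hne⟩ h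
  have hPc : IsCompact (P ×ˢ P) := (hP.prod hP).isCompact
  -- Perturbations inside `u₁` stay good on all of `v₁`, and a point whose diagonal pair lies
  -- outside `v₁` is not in `P`, so that surjectivity is available there.
  obtain ⟨u₁, v₁, hu₁, hv₁, hwu₁, hPv₁, huv₁⟩ := generalized_tube_lemma
    (isCompact_singleton (x := w₁)) hPc hgood (by rintro ⟨_, z⟩ ⟨rfl, hz⟩; exact hgood₁ z hz)
  have hK₁ : IsCompact {x : M | (x, x) ∉ v₁} :=
    (hv₁.preimage (f := fun x : M => (x, x)) (by fun_prop)).isClosed_compl.isCompact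
  obtain ⟨O₃, hO₃, hO₃d, himm₂⟩ := exists_dense_of_forall_nhds hK₁
    fun x hx => exists_nhds_dense_injective_tderiv hN hS
      (himm' x fun h => hx (hPv₁ ⟨h, h⟩))
  obtain ⟨w₂, hw₂, hw₂O⟩ := hO₃d.inter_open_nonempty (𝒪 ∩ u₁) (h𝒪.inter hu₁)
    ⟨w₁, hw₁, hwu₁ rfl⟩
  have hgood₂ : ∀ z ∈ diagonal M ∪ P ×ˢ P, (w₂, z) ∈ good := by
    rintro z (hz | hz)
    · refine ⟨fun _ => hz, ?_⟩
      by_cases hzv : (z.1, z.1) ∈ v₁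
      · exact (huv₁ (mk_mem_prod hw₂.2 hzv)).2
      · exact himm₂ w₂ hw₂O _ hzv
    · exact huv₁ (mk_mem_prod hw₂.2 (hPv₁ hz))
  -- Goodness is now protected near the diagonal as well. The remaining pairs form a compact set of
  -- distinct points that are not both in `P`.
  obtain ⟨u₂, v₂, hu₂, hv₂, hwu₂, hPv₂, huv₂⟩ := generalized_tube_lemma
    (isCompact_singleton (x := w₂)) (isClosed_diagonal.isCompact.union hPc) hgood
    (by rintro ⟨_, z⟩ ⟨rfl, hz⟩; exact hgood₂ z hz)
  obtain ⟨O₄, hO₄, hO₄d, hinj₃⟩ := exists_dense_of_forall_nhds hv₂.isClosed_compl.isCompact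
    fun z hz => exists_nhds_dense_apply_ne hN hS (z := z)
      (hinj' z.1 z.2 (fun h => hz (hPv₂ (Or.inl h)))
        (not_and_or.1 fun h => hz (hPv₂ (Or.inr h))))
  obtain ⟨w₃, hw₃, hw₃O⟩ := hO₄d.inter_open_nonempty (𝒪 ∩ u₂) (h𝒪.inter hu₂)
    ⟨w₂, hw₂.1, hwu₂ rfl⟩
  refine ⟨w₃, hw₃.1, fun m => (huv₂ (mk_mem_prod hw₃.2 (hPv₂ (Or.inl (mem_diagonal m))))).2,
    fun x y hxy => ?_⟩
  by_cases hv : (x, y) ∈ v₂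
  · exact (huv₂ (mk_mem_prod hw₃.2 hv)).1 hxy
  · exact (hinj₃ w₃ hw₃O _ hv hxy).elim

end Generic

/-! ### Spanning by the vectors AʲC -/

section Reachability

variable {N : ℕ}

theorem toEuclideanCLM_pow_toLp (A : Matrix (Fin N) (Fin N) ℝ) (C : Fin N → ℝ) (j : ℕ) :
    (Matrix.toEuclideanCLM (𝕜 := ℝ) A ^ j) (WithLp.toLp 2 C) = WithLp.toLp 2 (A ^ j *ᵥ C) := by
  rw [← map_pow]
  rfl

theorem span_toEuclideanCLM_pow_eq_top {A : Matrix (Fin N) (Fin N) ℝ} {C : Fin N → ℝ}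
    (hreach : LinearIndependent ℝ (fun j : Fin N => A ^ (j : ℕ) *ᵥ C)) :
    Submodule.span ℝ (range fun j : ℕ =>
      (Matrix.toEuclideanCLM (𝕜 := ℝ) A ^ j) (WithLp.toLp 2 C)) = ⊤ := by
  have h1 := hreach.map' (WithLp.linearEquiv 2 ℝ (Fin N → ℝ)).symm.toLinearMap
    (LinearEquiv.ker _)
  have h2 := h1.span_eq_top_of_card_eq_finrank' (by simp)
  rw [eq_top_iff, ← h2]
  refine Submodule.span_mono ?_
  rintro _ ⟨j, rfl⟩
  exact ⟨j, toEuclideanCLM_pow_toLp A C j⟩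

end Reachability

end LinearGS

end


/-! ### The main theorem -/

theorem mainTheorem2
    {q N : ℕ}
    {M : Type*} [TopologicalSpace M] [ChartedSpace (EuclideanSpace ℝ (Fin q)) M]
    [IsManifold (𝓡 q) (⊤ : ℕ∞) M] [CompactSpace M] [ConnectedSpace M] [T2Space M]
    [SecondCountableTopology M]
    (φ : Diffeomorph (𝓡 q) (𝓡 q) M M 2)
    -- there are finitely many periodic points, and `N > max {2q, ℓ}`
    (hfin : (Function.periodicPts φ).Finite)
    (hN : max (2 * q) (LinearGS.periodsLcm φ hfin) < N)
    (A : Matrix (Fin N) (Fin N) ℝ) (C : Fin N → ℝ)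
    (hA : spectralRadius ℂ (LinearGS.toComplex A) < 1)
    -- the synchronizations are of class `C²` and depend continuously on the observation map
    (hC2 : ∀ ω : LinearGS.C2Map q M ℝ,
      ContMDiff (𝓡 q) 𝓘(ℝ, EuclideanSpace ℝ (Fin N)) 2 (LinearGS.generalizedSync A C φ ω))
    (hcont : Continuous (fun ω : LinearGS.C2Map q M ℝ =>
      (⟨LinearGS.generalizedSync A C φ ω, hC2 ω⟩ :
        LinearGS.C2Map q M (EuclideanSpace ℝ (Fin N)))))
    -- condition (i)
    (heig : ∀ m ∈ Function.periodicPts φ, (LinearGS.periodEigenvalues φ m).ncard = q)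
    (hmax : ∀ (lamMax : ℂ) (nMin : ℕ), LinearGS.IsMaxPeriodEigenvalue φ lamMax →
      LinearGS.IsMinPeriod φ nMin → spectralRadius ℂ (lamMax • LinearGS.toComplex A ^ nMin) < 1)
    (hlin : ∀ m ∈ Function.periodicPts φ, LinearIndependent ℂ
      (fun lam : LinearGS.periodEigenvalues φ m =>
        LinearGS.resolventVector A C (Function.minimalPeriod φ m) lam))
    -- condition (ii)
    (hreach : LinearIndependent ℝ (fun j : Fin N => A ^ (j : ℕ) *ᵥ C)) :
    LinearGS.IsGeneric (fun ω : LinearGS.C2Map q M ℝ =>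
      LinearGS.IsC2Embedding q (LinearGS.generalizedSync A C φ ω)) := by
  have hN2 : 2 * q < N := (le_max_left _ _).trans_lt hN
  have hT := LinearGS.summable_norm_pow_mulVec hA
  have hc := hT (WithLp.toLp 2 C)
  have hspan := LinearGS.span_toEuclideanCLM_pow_eq_top hreach
  have hc0 : WithLp.toLp 2 C ≠ (0 : EuclideanSpace ℝ (Fin N)) := by
    intro h
    have h1 := hreach.ne_zero (⟨0, by omega⟩ : Fin N)
    rw [pow_zero, Matrix.one_mulVec] at h1
    exact h1 (by simpa using h)
  let S : LinearGS.C2Map q M ℝ →ₗ[ℝ] LinearGS.C2Map q M (EuclideanSpace ℝ (Fin N)) :=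
    { toFun := fun w => ⟨LinearGS.generalizedSync A C φ w, hC2 w⟩
      map_add' := fun w w' => by
        ext1 m
        refine (LinearGS.generalizedSync_eq A C φ _ m).trans
          ((LinearGS.sync_add hc w w' m).trans ?_)
        exact congrArg₂ (· + ·) (LinearGS.generalizedSync_eq A C φ w m).symm
          (LinearGS.generalizedSync_eq A C φ w' m).symm
      map_smul' := fun r w => by
        ext1 m
        refine (LinearGS.generalizedSync_eq A C φ _ m).trans
          ((LinearGS.sync_smul r w m).trans ?_)
        exact congrArg (r • ·) (LinearGS.generalizedSync_eq A C φ w m).symm }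
  have hsync : ∀ w m, S w m =
      LinearGS.sync (Matrix.toEuclideanCLM (𝕜 := ℝ) A) (WithLp.toLp 2 C) φ w m := fun w m =>
    LinearGS.generalizedSync_eq A C φ w m
  have hS : Continuous S := LinearGS.continuous_of_eq_sync hc hsync
  -- Compactness of M makes a continuous injection a homeomorphism onto its image.
  have hset : {w : LinearGS.C2Map q M ℝ |
      LinearGS.IsC2Embedding q (LinearGS.generalizedSync A C φ w)} =
      {w | (∀ m, Function.Injective
        (mfderiv (𝓡 q) 𝓘(ℝ, EuclideanSpace ℝ (Fin N)) (S w) m)) ∧ Function.Injective (S w)} := by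
    ext w
    exact ⟨fun h => ⟨h.immersion, h.isEmbedding.injective⟩, fun h => ⟨hC2 w, h.1,
      ((hC2 w).continuous.isClosedEmbedding h.2).isEmbedding⟩⟩
  rw [LinearGS.IsGeneric, hset]
  refine ⟨LinearGS.C2Map.isOpen_injective_immersion.preimage hS,
    LinearGS.dense_injective_immersion hN2 hS hfin
      (fun m hm => LinearGS.exists_injective_tderiv hfin hA hmax hm (heig m hm) (hlin m hm) hsync)
      (fun m hm m' hm' hne => LinearGS.exists_sync_ne hT hc0 hsync hfin hm hm' hne)
      (fun m hm v hv y => LinearGS.exists_tderiv_eq hS hc hspan hsync hm hv y) ?_⟩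
  intro m m' hne h y
  rcases LinearGS.exists_sub_eq_of_notMem_periodicPts hne h with ⟨h1, h2⟩ | ⟨h1, h2⟩
  · exact LinearGS.exists_sync_sub_eq hc hspan hsync h1 h2 y
  · obtain ⟨ψ, hψ⟩ := LinearGS.exists_sync_sub_eq hc hspan hsync h1 h2 (-y)
    exact ⟨ψ, by rw [← neg_sub, hψ, neg_neg]⟩
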